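/- **Setting.** There are $N$ sources and $M$ sinks; let $\Sigma=\{1,\dots,N\}$ and $\Pi=\{1,\dots,M\}$. Let $X_1,\dots,X_N$ be jointly distributed random variables on finite alphabets $\mathcal X_1,\dots,\mathcal X_N$; source $i$ observes $X_i^n$, where the vectors $(X_1,\dots,X_N)$ at times $1,\dots,n$ are i.i.d. Sink $j$ must reconstruct $X_i^n$ for all $i$ in a given set $\Sigma_j\subseteq\Sigma$; let $\Pi_i=\{j:i\in\Sigma_j\}$. Under dispersive information routing (DIR), every source $i$ sends, for every nonempty $\mathcal K\subseteq\Pi$, one packet that is delivered exactly to the sinks in $\mathcal K$. A code of length $n$ with sizes $L_{i,\mathcal K}\ge 1$ consists of encoders $f_i:\mathcal X_i^n\to\prod_{\emptyset\ne\mathcal K\subseteq\Pi}\{1,\dots,L_{i,\mathcal K}\}$ and decoders $g_j:\prod_{i\in\Sigma}\prod_{\mathcal K\ni j}\{1,\dots,L_{i,\mathcal K}\}\to\prod_{i\in\Sigma_j}\mathcal X_i^n$. Its error probability $P_e$ is the average over the sinks $j$ of the probability that the output of $g_j$ differs from $(X_i^n)_{i\in\Sigma_j}$. A tuple $(R_{i,\mathcal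 K})$, $i\in\Sigma$, $\emptyset\ne\mathcal K\subseteq\Pi$, is *achievable* if for all $\eta>0$ and $0<\epsilon<1$ there is, for every sufficiently large $n$, a code of length $n$ with $\frac1n\log_2 L_{i,\mathcal K}\le R_{i,\mathcal K}+\eta$ for all $i,\mathcal K$ and $P_e<\epsilon$. **Notation.** For $\emptyset\neq\mathcal K\subseteq\Pi$ let $\mathcal I(\mathcal K)=\{\mathcal K':\mathcal K\subseteq\mathcal K'\subseteq\Pi,\ |\mathcal K'|>|\mathcal K|\}$. For $k\in\Pi$ let $\mathcal J(k)=\{\mathcal K\subseteq\Pi:k\in\mathcal K\}$. A collection $\mathcal Q$ of nonempty subsets of $\Pi$ is in $\mathcal Q^*$ if $\mathcal K\in\mathcal Q$ implies $\mathcal I(\mathcal K)\subseteq\mathcal Q$. Let $U_{i,\mathcal K}$ ($i\in\Sigma$, $\emptyset\ne\mathcal K\subseteq\Pi$) be random variables on arbitrary finite alphabets, jointly distributed with $(X_1,\dots,X_N)$; write $\{U_i\}_{\mathcal Q}=(U_{i,\mathcal K})_{\mathcal K\in\mathcal Q}$, $\{X\}_\Gamma=(X_i)_{i\in\Gamma}$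 and $\{U_\Sigma\}_{\mathcal Q}=(U_{i,\mathcal K})_{i\in\Sigma,\mathcal K\in\mathcal Q}$. Call them *admissible* if for every $j\in\Pi$ $$P\big(\{X\}_\Sigma,\{U_\Sigma\}_{\mathcal J(j)}\big)=P\big(\{X\}_\Sigma\big)\prod_{i\in\Sigma}P\big(\{U_i\}_{\mathcal J(j)}\mid X_i\big).$$ With entropies in bits, define $$\alpha(i,\mathcal Q)=-H(\{U_i\}_{\mathcal Q}\mid X_i)+\sum_{\mathcal K\in\mathcal Q}H\big(U_{i,\mathcal K}\mid\{U_i\}_{\mathcal I(\mathcal K)}\big),$$ and, for $\mathcal Q_1,\dots,\mathcal Q_N\subseteq\mathcal J(k)$ with $\mathcal Q_i^c=\mathcal J(k)\setminus\mathcal Q_i$, $$\beta(k,\mathcal Q_1,\dots,\mathcal Q_N)=H\big((\{U_i\}_{\mathcal Q_i^c})_{i\in\Sigma}\mid(\{U_i\}_{\mathcal Q_i})_{i\in\Sigma}\big)-\sum_{i\in\Sigma}\sum_{\mathcal K\in\mathcal Q_i^c}H\big(U_{i,\mathcal K}\mid\{U_i\}_{\mathcal I(\mathcal K)}\big),$$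 and, for $\Gamma\subseteq\Sigma_k$, $$\gamma_k(\Gamma)=H\big(\{X\}_\Gamma\mid\{X\}_{\Sigma_k\setminus\Gamma},\{U_\Sigma\}_{\mathcal J(k)}\big).$$ **Theorem (achievable rate region for DIR).** Let $(U_{i,\mathcal K})$ be admissible, and let $R'_{i,\mathcal K}$ and $R''_{i,\mathcal K}$ ($i\in\Sigma$, $\emptyset\neq\mathcal K\subseteq\Pi$) and $\tilde R_{i,\mathcal K}$ ($i\in\Sigma$, $\emptyset\ne\mathcal K\subseteq\Pi_i$) be nonnegative rates such that 1. $\sum_{\mathcal K\in\mathcal Q}R'_{i,\mathcal K}\ge\alpha(i,\mathcal Q)$ for all $i\in\Sigma$ and $\mathcal Q\in\mathcal Q^*$; 2. $\sum_{i\in\Sigma}\sum_{\mathcal K\in\mathcal Q_i^c}R''_{i,\mathcal K}\ge\sum_{i\in\Sigma}\sum_{\mathcal K\in\mathcal Q_i^c}R'_{i,\mathcal K}+\beta(k,\mathcal Q_1,\dots,\mathcal Q_N)$ for all $k\in\Pi$ and all $\mathcal Q_1,\dots,\mathcal Q_N\subseteq\mathcal J(k)$ in $\mathcal Q^*$ that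 are not all equal to $\mathcal J(k)$; 3. $\sum_{i\in\Gamma}\sum_{\mathcal K\subseteq\Pi_i,\,k\in\mathcal K}\tilde R_{i,\mathcal K}\ge\gamma_k(\Gamma)$ for all $k\in\Pi$ and $\emptyset\neq\Gamma\subseteq\Sigma_k$. Then every tuple $(R_{i,\mathcal K})$ with $R_{i,\mathcal K}\ge R''_{i,\mathcal K}+\tilde R_{i,\mathcal K}$ if $\mathcal K\subseteq\Pi_i$, and $R_{i,\mathcal K}\ge R''_{i,\mathcal K}$ if $\mathcal K\not\subseteq\Pi_i$, is achievable. Moreover, every tuple in $\mathcal R_{DIR}$, the convex closure (closed convex hull) of the set of all tuples obtained in this way from all admissible $(U_{i,\mathcal K})$ and all such rates $R',R'',\tilde R$, is achievable. -/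

import Mathlib

noncomputable section

namespace DIR

/-! ### Finite probability and entropy -/

/-- The probability `P(f = a)` of the value `a` of the random variable `f`, when the finite sample
space `Ω` carries the probability mass function `p`. -/
def law {Ω α : Type*} [Fintype Ω] (p : Ω → ℝ) (f : Ω → α) (a : α) : ℝ :=
  ∑ ω, ({ω' | f ω' = a} : Set Ω).indicator p ω

/-- The conditional entropy `H(A | B) = - ∑ P(a, b) log₂ P(a | b)`, in bits.  Pairs `(a, b)` of
probability zero contribute `0`. -/
def condEntropy {Ω α β : Type*} [Fintype Ω] [Fintype α] [Fintype β]
    (p : Ω → ℝ) (A : Ω → α) (B : Ω → β) : ℝ :=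
  -∑ a, ∑ b, law p (fun ω => (A ω, B ω)) (a, b) *
    Real.logb 2 (law p (fun ω => (A ω, B ω)) (a, b) / law p B b)

/-! ### Subsets of the set of sinks -/

/-- The nonempty subsets of the set `{1, …, M}` of sinks.  Every source sends one packet to each
of them. -/
abbrev Packet (M : ℕ) : Type := {K : Finset (Fin M) // K.Nonempty}

/-- `𝓘_{W+}(B)`: the sets of sinks that contain `B` and have more than `W` elements. -/
def above {M : ℕ} (W : ℕ) (B : Finset (Fin M)) : Finset (Packet M) :=
  Finset.univ.filter fun K => W < K.1.card ∧ B ⊆ K.1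

/-- `𝓙(S)`: the sets of sinks that meet `S`. -/
def meeting {M : ℕ} (S : Finset (Fin M)) : Finset (Packet M) :=
  Finset.univ.filter fun K => 0 < (K.1 ∩ S).card

/-- The class `𝓠*`: with a set `K`, the collection `Q` contains all of `𝓘_{|K|+}(K)`. -/
def IsUpClosed {M : ℕ} (Q : Finset (Packet M)) : Prop :=
  ∀ K ∈ Q, above K.1.card K.1 ⊆ Q

/-- `Π_i`: the sinks that reconstruct source `i`, where `D j` is the set of sources that sink `j`
reconstructs. -/
def sinksOf {N M : ℕ} (D : Fin M → Finset (Fin N)) (i : Fin N) : Finset (Fin M) :=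
  Finset.univ.filter fun j => i ∈ D j

/-! ### Block codes and achievable rates -/

section Codes

variable {N M : ℕ} {𝒳 : Fin N → Type*}

/-- A block code of length `n`.  Encoder `i` maps `X_i^n` to one index with `L i K` possible values
for every nonempty set `K` of sinks; decoder `j` sees the indices of all sources with `j ∈ K` and
estimates the blocks of the sources in `D j`. -/
structure Code (𝒳 : Fin N → Type*) (D : Fin M → Finset (Fin N)) (n : ℕ)
    (L : Fin N → Packet M → ℕ) where
  enc : ∀ i : Fin N, (Fin n → 𝒳 i) → ∀ K : Packet M, Fin (L i K)
  dec : ∀ j : Fin M, (∀ i : Fin N, ∀ K : {K : Packet M // j ∈ K.1}, Fin (L i K.1)) →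
    ∀ i : {i : Fin N // i ∈ D j}, Fin n → 𝒳 i.1

/-- The estimate of sink `j`, when the sources produce `x`. -/
def Code.estimate {D : Fin M → Finset (Fin N)} {n : ℕ} {L : Fin N → Packet M → ℕ}
    (c : Code 𝒳 D n L) (x : Fin n → ∀ i, 𝒳 i) (j : Fin M) :
    ∀ i : {i : Fin N // i ∈ D j}, Fin n → 𝒳 i.1 :=
  c.dec j fun i K => c.enc i (fun t => x t i) K.1

variable [∀ i, Fintype (𝒳 i)]

/-- The error probability, averaged over the sinks, when the vectors `(X_1, …, X_N)` at times
`1, …, n` are independent with common probability mass function `PX`. -/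
def Code.errorProb {D : Fin M → Finset (Fin N)} {n : ℕ} {L : Fin N → Packet M → ℕ}
    (c : Code 𝒳 D n L) (PX : (∀ i, 𝒳 i) → ℝ) : ℝ :=
  (1 / (M : ℝ)) * ∑ j, ∑ x : Fin n → ∀ i, 𝒳 i,
    ({x' | c.estimate x' j ≠ fun (i : {i : Fin N // i ∈ D j}) t => x' t i.1} : Set (Fin n → ∀ i, 𝒳 i)).indicator
      (fun x' => ∏ t, PX (x' t)) x

/-- Achievability of a packet rate tuple. -/
def Achievable (PX : (∀ i, 𝒳 i) → ℝ) (D : Fin M → Finset (Fin N))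
    (R : Fin N → Packet M → ℝ) : Prop :=
  ∀ η : ℝ, 0 < η → ∀ ε : ℝ, 0 < ε → ε < 1 → ∃ n₀ : ℕ, ∀ n : ℕ, n₀ ≤ n →
    ∃ (L : Fin N → Packet M → ℕ) (c : Code 𝒳 D n L),
      (∀ i K, 0 < L i K) ∧
      (∀ i K, 1 / (n : ℝ) * Real.logb 2 (L i K) ≤ R i K + η) ∧
      c.errorProb PX < ε

end Codes

/-! ### Auxiliary random variables and the rate region -/

section Region

variable {N M : ℕ} {𝒳 : Fin N → Type*} {𝒰 : Fin N → Packet M → Type*}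

/-- The sample space of the sources `X_i` together with the auxiliary variables `U_{i,K}`. -/
abbrev Joint (𝒳 : Fin N → Type*) (𝒰 : Fin N → Packet M → Type*) : Type _ :=
  (∀ i, 𝒳 i) × (∀ i K, 𝒰 i K)

/-- The family `{X}_Γ` of random variables. -/
def Xs (Γ : Finset (Fin N)) (ω : Joint 𝒳 𝒰) : ∀ i : {i // i ∈ Γ}, 𝒳 i.1 :=
  fun i => ω.1 i.1

/-- The family `{U_i}_Q` of random variables. -/
def Us (i : Fin N) (Q : Finset (Packet M)) (ω : Joint 𝒳 𝒰) : ∀ K : {K // K ∈ Q}, 𝒰 i K.1 :=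
  fun K => ω.2 i K.1

/-- The family of all `{U_i}_{Q_i}`, `i = 1, …, N`. -/
def UsAll (Q : Fin N → Finset (Packet M)) (ω : Joint 𝒳 𝒰) :
    ∀ i, ∀ K : {K // K ∈ Q i}, 𝒰 i K.1 :=
  fun i => Us i (Q i) ω

variable [∀ i, Fintype (𝒳 i)] [∀ i K, Fintype (𝒰 i K)]

/-- `P` is a joint probability mass function of sources and auxiliary variables, under which the
sources have the prescribed probability mass function `PX`, and such that for every sink `j`
`P({X}_Σ, {U_Σ}_{𝓙(j)}) = P({X}_Σ) ∏_i P({U_i}_{𝓙(j)} | X_i)`. -/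
structure IsAuxiliary (PX : (∀ i, 𝒳 i) → ℝ) (P : Joint 𝒳 𝒰 → ℝ) : Prop where
  pmf : P ∈ stdSimplex ℝ (Joint 𝒳 𝒰)
  marginal : ∀ x, law P (fun ω => ω.1) x = PX x
  markov : ∀ (j : Fin M) (x : ∀ i, 𝒳 i) (u : ∀ i, ∀ K : {K // K ∈ meeting {j}}, 𝒰 i K.1),
    law P (fun ω => (ω.1, UsAll (fun _ => meeting {j}) ω)) (x, u) =
      law P (fun ω => ω.1) x *
        ∏ i, law P (fun ω => (Us i (meeting {j}) ω, ω.1 i)) (u i, x i) /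
          law P (fun ω => ω.1 i) (x i)

/-- `H(U_{i,K} | {U_i}_{𝓘_{|K|+}(K)})`. -/
def layerEntropy (P : Joint 𝒳 𝒰 → ℝ) (i : Fin N) (K : Packet M) : ℝ :=
  condEntropy P (fun ω => ω.2 i K) (Us i (above K.1.card K.1))

/-- `α(i, Q)`. -/
def alpha (P : Joint 𝒳 𝒰 → ℝ) (i : Fin N) (Q : Finset (Packet M)) : ℝ :=
  -condEntropy P (Us i Q) (fun ω => ω.1 i) + ∑ K ∈ Q, layerEntropy P i K

/-- `β(k, Q_1, …, Q_N)`, with complements taken in `𝓙(k)`. -/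
def beta (P : Joint 𝒳 𝒰 → ℝ) (k : Fin M) (Q : Fin N → Finset (Packet M)) : ℝ :=
  condEntropy P (UsAll fun i => meeting {k} \ Q i) (UsAll Q) -
    ∑ i, ∑ K ∈ meeting {k} \ Q i, layerEntropy P i K

/-- `γ_k(Γ)`, with the complement of `Γ` taken in `D k`. -/
def gamma (P : Joint 𝒳 𝒰 → ℝ) (D : Fin M → Finset (Fin N)) (k : Fin M)
    (Γ : Finset (Fin N)) : ℝ :=
  condEntropy P (Xs Γ) fun ω => (Xs (D k \ Γ) ω, UsAll (fun _ => meeting {k}) ω)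

/-- The rate conditions on `R'`, `R''`, `R̃` (here `R₁`, `R₂`, `R₃`) and the packet rates `R`.
Rates are nonnegative, and `R₃ i K` only matters for `K ⊆ Π_i`. -/
structure RateConditions (P : Joint 𝒳 𝒰 → ℝ) (D : Fin M → Finset (Fin N))
    (R₁ R₂ R₃ R : Fin N → Packet M → ℝ) : Prop where
  nonneg₁ : ∀ i K, 0 ≤ R₁ i K
  nonneg₂ : ∀ i K, 0 ≤ R₂ i K
  nonneg₃ : ∀ i K, K.1 ⊆ sinksOf D i → 0 ≤ R₃ i K
  covering : ∀ i Q, IsUpClosed Q → alpha P i Q ≤ ∑ K ∈ Q, R₁ i K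
  packing : ∀ (k : Fin M) (Q : Fin N → Finset (Packet M)),
    (∀ i, Q i ⊆ meeting {k}) → (∀ i, IsUpClosed (Q i)) → (∃ i, Q i ≠ meeting {k}) →
      (∑ i, ∑ K ∈ meeting {k} \ Q i, R₁ i K) + beta P k Q ≤
        ∑ i, ∑ K ∈ meeting {k} \ Q i, R₂ i K
  binning : ∀ (k : Fin M) (Γ : Finset (Fin N)), Γ ⊆ D k → Γ.Nonempty →
    gamma P D k Γ ≤
      ∑ i ∈ Γ, ∑ K ∈ Finset.univ.filter (fun K : Packet M => k ∈ K.1 ∧ K.1 ⊆ sinksOf D i), R₃ i K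
  rate : ∀ i K, (if K.1 ⊆ sinksOf D i then R₂ i K + R₃ i K else R₂ i K) ≤ R i K

/-- The region `R_DIR`: the closed convex hull of the rate tuples obtained from all choices of
auxiliary random variables on finite alphabets. -/
def region (PX : (∀ i, 𝒳 i) → ℝ) (D : Fin M → Finset (Fin N)) : Set (Fin N → Packet M → ℝ) :=
  closure (convexHull ℝ {R | ∃ (𝒱 : Fin N → Packet M → Type) (_ : ∀ i K, Fintype (𝒱 i K))
    (P : Joint 𝒳 𝒱 → ℝ) (R₁ R₂ R₃ : Fin N → Packet M → ℝ),
      IsAuxiliary PX P ∧ RateConditions P D R₁ R₂ R₃ R})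

end Region

end DIR

end

noncomputable section
namespace DIR

/-! ### Indicators -/

/-! The scheme uses random binning instead of random covering codebooks. Suppose that each $\{U_i\}$
is the output of a channel with input $X_i$, independently over $i$. For each pair $(i,K)$ draw a
random hash of rate $\rho_{i,K}$ whose argument consists of the sequences $U_{i,K'}$ for all
$K'\supseteq K$. For two given sequences, the sets $K$ at which these arguments agree form a
collection that contains with $K$ every superset; this is why only collections in $\mathcal Q^*$
matter.

If $\sum_{K\in\mathcal Q}\rho_{i,K}<H(\{U_i\}_{\mathcal Q}\mid X_i)$ for all nonempty $\mathcal
Q\in\mathcal Q^*$, a second moment argument shows that the hashes of source $i$ are nearly uniform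
and nearly independent of $X_i^n$ (`hash_nearly_uniform`). Their values can therefore be fixed in
advance, known to all sinks, and each encoder selects an auxiliary sequence with these hashes,
essentially from the conditional law given the source (`exists_selection`). It transmits an
independent second hash of that sequence, of rate $R''$, and a hash of the source sequence, of rate
$\tilde R$. Sink $k$ recovers the auxiliary sequences from hashes of total rate $\rho+R''$, and then
the sources with the auxiliary sequences as side information; both are Slepian-Wolf decoding
(`slepian_wolf`). `exists_code` combines these steps.

For $\rho_{i,K}=H(U_{i,K}\mid\{U_i\}_{\mathcal I(K)})-R'_{i,K}$ the requirements are the three rate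
conditions up to strictness, which the slack $\eta$ provides. This $\rho$ may be negative, so $t$
independent uniform bits are attached to every $U_{i,K}$: this adds $t$ to each $\rho_{i,K}$,
changes both sides of the first two conditions equally, and leaves $\gamma_k$ alone. Admissible
variables are replaced by independent channels $P(\{U_i\}\mid X_i)$; this preserves the law of
$(X_i,\{U_i\})$ and, for each single sink, the law of all sources and the auxiliary variables there,
which suffices (`IsAuxiliary.law_local`, `IsAuxiliary.law_sink`).

Finally, the achievable tuples form a closed set that is convex by time sharing, so it contains
$\mathcal R_{DIR}$. -/

open Classical in
/-- The indicator of a proposition. -/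
def ind (c : Prop) : ℝ := if c then 1 else 0

theorem ind_of {c : Prop} (h : c) : ind c = 1 := by simp [ind, h]

theorem ind_of_not {c : Prop} (h : ¬c) : ind c = 0 := by simp [ind, h]

theorem ind_nonneg (c : Prop) : 0 ≤ ind c := by
  by_cases h : c <;> simp [ind, h]

theorem ind_le_one (c : Prop) : ind c ≤ 1 := by
  by_cases h : c <;> simp [ind, h]

theorem ind_and (c d : Prop) : ind (c ∧ d) = ind c * ind d := by
  by_cases h : c <;> by_cases h' : d <;> simp [ind, h, h']

theorem ind_mono {c d : Prop} (h : c → d) : ind c ≤ ind d := by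
  by_cases hc : c
  · rw [ind_of hc, ind_of (h hc)]
  · rw [ind_of_not hc]; exact ind_nonneg d

theorem ind_or_le (c d : Prop) : ind (c ∨ d) ≤ ind c + ind d := by
  by_cases h : c <;> by_cases h' : d <;> simp [ind, h, h']

theorem ind_exists_le {ι : Type*} [Fintype ι] (c : ι → Prop) :
    ind (∃ i, c i) ≤ ∑ i, ind (c i) := by
  by_cases h : ∃ i, c i
  · obtain ⟨i, hi⟩ := h
    rw [ind_of ⟨i, hi⟩, ← ind_of hi]
    exact Finset.single_le_sum (f := fun i => ind (c i)) (fun i _ => ind_nonneg _)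
      (Finset.mem_univ i)
  · rw [ind_of_not h]; exact Finset.sum_nonneg fun i _ => ind_nonneg _

theorem ind_forall {ι : Type*} [Fintype ι] (c : ι → Prop) :
    ind (∀ i, c i) = ∏ i, ind (c i) := by
  by_cases h : ∀ i, c i
  · rw [ind_of h]; exact (Finset.prod_eq_one fun i _ => ind_of (h i)).symm
  · rw [ind_of_not h]
    push Not at h
    obtain ⟨i, hi⟩ := h
    exact (Finset.prod_eq_zero (Finset.mem_univ i) (ind_of_not hi)).symm

theorem sum_ind_eq_mul {α : Type*} [Fintype α] (x : α) (f : α → ℝ) :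
    ∑ a, ind (x = a) * f a = f x := by
  classical
  rw [Finset.sum_eq_single x]
  · rw [ind_of rfl, one_mul]
  · intro b _ hb; rw [ind_of_not (Ne.symm hb), zero_mul]
  · intro h; exact absurd (Finset.mem_univ x) h

theorem sum_ind_eq {α : Type*} [Fintype α] (x : α) : ∑ a, ind (x = a) = 1 := by
  simpa using sum_ind_eq_mul x fun _ => 1

/-! ### Finite probability mass functions -/

section Law

variable {Ω α β γ : Type*} [Fintype Ω]

theorem law_eq (p : Ω → ℝ) (f : Ω → α) (a : α) : law p f a = ∑ ω, p ω * ind (f ω = a) := by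
  classical
  unfold law
  refine Finset.sum_congr rfl fun ω _ => ?_
  by_cases h : f ω = a <;> simp [ind, h]

theorem law_nonneg {p : Ω → ℝ} (hp : ∀ ω, 0 ≤ p ω) (f : Ω → α) (a : α) : 0 ≤ law p f a := by
  rw [law_eq]
  exact Finset.sum_nonneg fun ω _ => mul_nonneg (hp ω) (ind_nonneg _)

theorem le_law {p : Ω → ℝ} (hp : ∀ ω, 0 ≤ p ω) (f : Ω → α) (ω : Ω) : p ω ≤ law p f (f ω) := by
  rw [law_eq]
  have := Finset.single_le_sum (f := fun ω' => p ω' * ind (f ω' = f ω))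
    (fun ω' _ => mul_nonneg (hp ω') (ind_nonneg _)) (Finset.mem_univ ω)
  simpa [ind_of] using this

theorem sum_law_mul [Fintype α] (p : Ω → ℝ) (f : Ω → α) (g : α → ℝ) :
    ∑ a, law p f a * g a = ∑ ω, p ω * g (f ω) := by
  simp_rw [law_eq, Finset.sum_mul]
  rw [Finset.sum_comm]
  refine Finset.sum_congr rfl fun ω _ => ?_
  simp_rw [mul_assoc]
  rw [← Finset.mul_sum, sum_ind_eq_mul]

theorem sum_law [Fintype α] (p : Ω → ℝ) (f : Ω → α) : ∑ a, law p f a = ∑ ω, p ω := by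
  simpa using sum_law_mul p f fun _ => 1

theorem law_mem_stdSimplex [Fintype α] {p : Ω → ℝ} (hp : p ∈ stdSimplex ℝ Ω) (f : Ω → α) :
    law p f ∈ stdSimplex ℝ α :=
  ⟨law_nonneg hp.1 f, by rw [sum_law, hp.2]⟩

theorem law_law [Fintype α] (p : Ω → ℝ) (f : Ω → α) (g : α → β) :
    law (law p f) g = law p fun ω => g (f ω) := by
  funext b
  rw [law_eq, law_eq, sum_law_mul]

theorem law_congr {p : Ω → ℝ} {f : Ω → α} {g : Ω → β} {a : α} {b : β}
    (h : ∀ ω, f ω = a ↔ g ω = b) : law p f a = law p g b := by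
  simp_rw [law_eq, h]

theorem sum_law_pair [Fintype α] (p : Ω → ℝ) (A : Ω → α) (B : Ω → β) (b : β) :
    ∑ a, law p (fun ω => (A ω, B ω)) (a, b) = law p B b := by
  simp_rw [law_eq, Prod.mk.injEq, ind_and]
  rw [Finset.sum_comm]
  refine Finset.sum_congr rfl fun ω _ => ?_
  rw [← Finset.mul_sum, ← Finset.sum_mul, sum_ind_eq, one_mul]

/-- The conditional probability `P(A = a | B = b)`. -/
def condProb (p : Ω → ℝ) (A : Ω → α) (B : Ω → β) (a : α) (b : β) : ℝ :=
  law p (fun ω => (A ω, B ω)) (a, b) / law p B b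

theorem condProb_nonneg {p : Ω → ℝ} (hp : ∀ ω, 0 ≤ p ω) (A : Ω → α) (B : Ω → β) (a : α) (b : β) :
    0 ≤ condProb p A B a b :=
  div_nonneg (law_nonneg hp _ _) (law_nonneg hp _ _)

theorem condProb_pos {p : Ω → ℝ} (hp : ∀ ω, 0 ≤ p ω) (A : Ω → α) (B : Ω → β) {ω : Ω}
    (hω : 0 < p ω) : 0 < condProb p A B (A ω) (B ω) :=
  div_pos (hω.trans_le (le_law hp (fun ω => (A ω, B ω)) ω)) (hω.trans_le (le_law hp B ω))

theorem sum_condProb_le_one [Fintype α] (p : Ω → ℝ) (A : Ω → α)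
    (B : Ω → β) (b : β) : ∑ a, condProb p A B a b ≤ 1 := by
  simp_rw [condProb]
  rw [← Finset.sum_div, sum_law_pair]
  exact div_self_le_one _

theorem condEntropy_eq [Fintype α] [Fintype β] (p : Ω → ℝ) (A : Ω → α) (B : Ω → β) :
    condEntropy p A B = ∑ ω, p ω * -Real.logb 2 (condProb p A B (A ω) (B ω)) := by
  have h := sum_law_mul p (fun ω => (A ω, B ω))
    fun ab => -Real.logb 2 (condProb p A B ab.1 ab.2)
  rw [← h, Fintype.sum_prod_type, condEntropy, ← Finset.sum_neg_distrib]
  refine Finset.sum_congr rfl fun a _ => ?_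
  rw [← Finset.sum_neg_distrib]
  exact Finset.sum_congr rfl fun b _ => by rw [condProb, mul_neg]

theorem condEntropy_congr_law {Ω' : Type*} [Fintype Ω'] [Fintype α] [Fintype β]
    {p : Ω → ℝ} {p' : Ω' → ℝ} {A : Ω → α} {B : Ω → β} {A' : Ω' → α} {B' : Ω' → β}
    (h : ∀ a b, law p (fun ω => (A ω, B ω)) (a, b) = law p' (fun ω => (A' ω, B' ω)) (a, b)) :
    condEntropy p A B = condEntropy p' A' B' := by
  have hB : ∀ b, law p B b = law p' B' b := fun b => by
    rw [← sum_law_pair p A, ← sum_law_pair p' A']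
    exact Finset.sum_congr rfl fun a _ => h a b
  simp_rw [condEntropy, h, hB]

end Law

/-! ### Independent repetitions -/

section IID

variable {Ω α β : Type*} [Fintype Ω]

/-- The probability mass function of `n` independent repetitions. -/
def iid (p : Ω → ℝ) (n : ℕ) (ω : Fin n → Ω) : ℝ := ∏ t, p (ω t)

theorem sum_pi_prod {ι : Type*} [Fintype ι] [DecidableEq ι] {Y : ι → Type*} [∀ i, Fintype (Y i)]
    (f : ∀ i, Y i → ℝ) : ∑ y : ∀ i, Y i, ∏ i, f i (y i) = ∏ i, ∑ y, f i y := by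
  rw [Finset.prod_univ_sum, Fintype.piFinset_univ]

omit [Fintype Ω] in
theorem iid_nonneg {p : Ω → ℝ} (hp : ∀ ω, 0 ≤ p ω) (n : ℕ) (ω : Fin n → Ω) : 0 ≤ iid p n ω :=
  Finset.prod_nonneg fun _ _ => hp _

theorem sum_iid {p : Ω → ℝ} (hp : p ∈ stdSimplex ℝ Ω) (n : ℕ) : ∑ ω, iid p n ω = 1 := by
  simp_rw [iid]
  rw [sum_pi_prod fun _ => p, hp.2, Finset.prod_const_one]

theorem iid_law (p : Ω → ℝ) (f : Ω → α) (n : ℕ) :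
    iid (law p f) n = law (iid p n) fun ω t => f (ω t) := by
  funext y
  rw [law_eq]
  simp_rw [iid, law_eq, funext_iff, ind_forall]
  rw [← sum_pi_prod fun (t : Fin n) ω => p ω * ind (f ω = y t)]
  exact Finset.sum_congr rfl fun ω _ => Finset.prod_mul_distrib

theorem sum_iid_law [Fintype α] (p : Ω → ℝ) (f : Ω → α) (n : ℕ) (g : (Fin n → α) → ℝ) :
    ∑ y, iid (law p f) n y * g y = ∑ ω, iid p n ω * g fun t => f (ω t) := by
  rw [iid_law, sum_law_mul]

theorem sum_iid_succ (p : Ω → ℝ) (n : ℕ) (g : (Fin (n + 1) → Ω) → ℝ) :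
    ∑ ω, iid p (n + 1) ω * g ω = ∑ a, p a * ∑ ω, iid p n ω * g (Fin.cons a ω) := by
  rw [← Fintype.sum_equiv (Fin.consEquiv fun _ : Fin (n + 1) => Ω)
    (fun x => iid p (n + 1) (Fin.cons x.1 x.2) * g (Fin.cons x.1 x.2)) _ (fun x => rfl),
    Fintype.sum_prod_type]
  refine Finset.sum_congr rfl fun a _ => ?_
  rw [Finset.mul_sum]
  refine Finset.sum_congr rfl fun ω _ => ?_
  simp only [iid, Fin.prod_univ_succ, Fin.cons_zero, Fin.cons_succ]
  ring

theorem sum_iid_mul_sum {p : Ω → ℝ} (hp : p ∈ stdSimplex ℝ Ω) {f : Ω → ℝ}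
    (hf : ∑ ω, p ω * f ω = 0) (n : ℕ) : ∑ ω, iid p n ω * ∑ t, f (ω t) = 0 := by
  induction n with
  | zero => simp
  | succ n ih =>
    rw [sum_iid_succ]
    simp only [Fin.sum_univ_succ, Fin.cons_zero, Fin.cons_succ, mul_add, Finset.sum_add_distrib,
      ih, ← Finset.sum_mul, sum_iid hp, one_mul, hf]
    simp

/-- The cross terms of independent centred variables vanish by `sum_iid_mul_sum`, so variances add.
-/
theorem sum_iid_mul_sq {p : Ω → ℝ} (hp : p ∈ stdSimplex ℝ Ω) {f : Ω → ℝ}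
    (hf : ∑ ω, p ω * f ω = 0) (n : ℕ) :
    ∑ ω, iid p n ω * (∑ t, f (ω t)) ^ 2 = n * ∑ ω, p ω * f ω ^ 2 := by
  induction n with
  | zero => simp
  | succ n ih =>
    rw [sum_iid_succ]
    have key : ∀ a, ∑ ω, iid p n ω * (∑ t, f ((Fin.cons a ω : Fin (n + 1) → Ω) t)) ^ 2 =
        f a ^ 2 + n * ∑ ω, p ω * f ω ^ 2 := by
      intro a
      simp only [Fin.sum_univ_succ, Fin.cons_zero, Fin.cons_succ]
      have : ∀ ω : Fin n → Ω, iid p n ω * (f a + ∑ t, f (ω t)) ^ 2 =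
          iid p n ω * f a ^ 2 + 2 * f a * (iid p n ω * ∑ t, f (ω t)) +
            iid p n ω * (∑ t, f (ω t)) ^ 2 := fun ω => by ring
      simp_rw [this, Finset.sum_add_distrib]
      rw [ih, ← Finset.mul_sum, sum_iid_mul_sum hp hf, ← Finset.sum_mul, sum_iid hp]
      ring
    simp_rw [key, mul_add, Finset.sum_add_distrib, ← Finset.sum_mul, hp.2]
    push_cast; ring

/-- Chebyshev's inequality: the variance of the sum grows like $n$, the squared deviation like
$n^2$. -/
theorem weak_law {p : Ω → ℝ} (hp : p ∈ stdSimplex ℝ Ω) (f : Ω → ℝ) {δ ε : ℝ} (hδ : 0 < δ)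
    (hε : 0 < ε) : ∃ n₀ : ℕ, ∀ n, n₀ ≤ n →
      ∑ ω, iid p n ω * ind (n * δ < |∑ t, f (ω t) - n * ∑ ω, p ω * f ω|) ≤ ε := by
  set μ := ∑ ω, p ω * f ω with hμ
  set V := ∑ ω, p ω * (f ω - μ) ^ 2 with hV
  have hf : ∑ ω, p ω * (f ω - μ) = 0 := by
    simp_rw [mul_sub, Finset.sum_sub_distrib, ← Finset.sum_mul, hp.2, ← hμ]; ring
  have hV0 : 0 ≤ V := Finset.sum_nonneg fun ω _ => mul_nonneg (hp.1 ω) (sq_nonneg _)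
  obtain ⟨n₀, hn₀⟩ := exists_nat_ge (V / (ε * δ ^ 2))
  refine ⟨n₀ + 1, fun n hn => ?_⟩
  have hn0 : (0 : ℝ) < n := by exact_mod_cast (Nat.succ_pos n₀).trans_le hn
  have hle : ∀ ω : Fin n → Ω, iid p n ω * ind (n * δ < |∑ t, f (ω t) - n * μ|) ≤
      iid p n ω * (∑ t, (f (ω t) - μ)) ^ 2 / (n * δ) ^ 2 := by
    intro ω
    rw [mul_div_assoc]
    refine mul_le_mul_of_nonneg_left ?_ (iid_nonneg hp.1 n ω)
    have e : ∑ t, (f (ω t) - μ) = ∑ t, f (ω t) - n * μ := by simp [Finset.sum_sub_distrib]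
    rw [e]
    by_cases h : n * δ < |∑ t, f (ω t) - n * μ|
    · rw [ind_of h, one_le_div (by positivity), ← sq_abs (_ - _)]
      gcongr
    · rw [ind_of_not h]; positivity
  refine (Finset.sum_le_sum fun ω _ => hle ω).trans ?_
  rw [← Finset.sum_div, sum_iid_mul_sq hp hf, ← hV, div_le_iff₀ (by positivity)]
  rw [div_le_iff₀ (by positivity)] at hn₀
  have : (n₀ : ℝ) ≤ n := by exact_mod_cast (Nat.le_succ n₀).trans hn
  have h1 : V ≤ n * (ε * δ ^ 2) := hn₀.trans (by gcongr)
  calc n * V ≤ n * (n * (ε * δ ^ 2)) := by gcongr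
    _ = _ := by ring

/-- The conditional asymptotic equipartition property. -/
theorem aep [Fintype α] [Fintype β] {p : Ω → ℝ} (hp : p ∈ stdSimplex ℝ Ω) (A : Ω → α) (B : Ω → β)
    {δ ε : ℝ} (hδ : 0 < δ) (hε : 0 < ε) : ∃ n₀ : ℕ, ∀ n : ℕ, n₀ ≤ n →
      ∑ ω, iid p n ω * ind (¬((2 : ℝ) ^ (-(n * (condEntropy p A B + δ))) ≤
          ∏ t, condProb p A B (A (ω t)) (B (ω t)) ∧
        ∏ t, condProb p A B (A (ω t)) (B (ω t)) ≤
          (2 : ℝ) ^ (-(n * (condEntropy p A B - δ))))) ≤ ε := by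
  obtain ⟨n₀, h⟩ := weak_law hp (fun ω => -Real.logb 2 (condProb p A B (A ω) (B ω))) hδ hε
  refine ⟨n₀, fun n hn => le_trans (Finset.sum_le_sum fun ω _ => ?_) (h n hn)⟩
  rw [← condEntropy_eq]
  rcases (iid_nonneg hp.1 n ω).eq_or_lt with h0 | h0
  · simp [← h0]
  refine mul_le_mul_of_nonneg_left (ind_mono fun hnot => ?_) h0.le
  by_contra hle
  apply hnot
  -- Only sequences of positive probability count, and for them no factor vanishes, so the logarithm
  -- of the product splits.
  have hpos : ∀ t, 0 < condProb p A B (A (ω t)) (B (ω t)) := fun t =>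
    condProb_pos hp.1 A B ((hp.1 _).lt_of_ne' fun hz =>
      h0.ne' (Finset.prod_eq_zero (Finset.mem_univ t) hz))
  have hprod := Finset.prod_pos fun (t : Fin n) (_ : t ∈ Finset.univ) => hpos t
  have hlog : Real.logb 2 (∏ t, condProb p A B (A (ω t)) (B (ω t))) =
      -∑ t, -Real.logb 2 (condProb p A B (A (ω t)) (B (ω t))) := by
    rw [Real.logb_prod _ _ fun t _ => (hpos t).ne', Finset.sum_neg_distrib, neg_neg]
  rw [not_lt, abs_le] at hle
  rw [← Real.le_logb_iff_rpow_le one_lt_two hprod, ← Real.logb_le_iff_le_rpow one_lt_two hprod,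
    hlog]
  constructor <;> linarith [hle.1, hle.2]

end IID

end DIR
end

noncomputable section
namespace DIR

/-! ### Random functions -/

section Hash

/-- The uniform distribution. -/
def unif (R : Type*) [Fintype R] (_ : R) : ℝ := (Fintype.card R : ℝ)⁻¹

theorem unif_mem_stdSimplex (R : Type*) [Fintype R] [Nonempty R] : unif R ∈ stdSimplex ℝ R :=
  ⟨fun _ => by unfold unif; positivity, by simp [unif]⟩

theorem prod_mem_stdSimplex {ι : Type*} [Fintype ι] [DecidableEq ι] {Y : ι → Type*}
    [∀ i, Fintype (Y i)] {w : ∀ i, Y i → ℝ} (hw : ∀ i, w i ∈ stdSimplex ℝ (Y i)) :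
    (fun y : ∀ i, Y i => ∏ i, w i (y i)) ∈ stdSimplex ℝ (∀ i, Y i) :=
  ⟨fun y => Finset.prod_nonneg fun i _ => (hw i).1 _, by
    rw [sum_pi_prod]; exact Finset.prod_eq_one fun i _ => (hw i).2⟩

/-- The probabilistic method. Hash functions, prescribed hash values and encoders are all made
deterministic by it. -/
theorem exists_le_of_sum_le {α : Type*} [Fintype α] {w : α → ℝ} (hw : w ∈ stdSimplex ℝ α)
    {F : α → ℝ} {c : ℝ} (h : ∑ a, w a * F a ≤ c) : ∃ a, F a ≤ c := by
  by_contra! hc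
  have h1 : ∑ a, w a * c ≤ ∑ a, w a * F a :=
    Finset.sum_le_sum fun a _ => mul_le_mul_of_nonneg_left (hc a).le (hw.1 a)
  have h2 : ∑ a, w a * (F a - c) = 0 := by
    simp_rw [mul_sub, Finset.sum_sub_distrib]
    rw [← Finset.sum_mul, hw.2] at *
    linarith
  rw [Finset.sum_eq_zero_iff_of_nonneg
    fun a _ => mul_nonneg (hw.1 a) (sub_nonneg.2 (hc a).le)] at h2
  have h3 : ∑ a, w a = 0 := Finset.sum_eq_zero fun a ha =>
    (mul_eq_zero.1 (h2 a ha)).resolve_right (sub_pos.2 (hc a)).ne'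
  rw [hw.2] at h3
  exact one_ne_zero h3

/-- Marginals of a product distribution. -/
theorem sum_pi_restrict {I J : Type*} [Fintype I] [Fintype J] [DecidableEq I] [DecidableEq J]
    {Y : J → Type*} [∀ j, Fintype (Y j)] {w : ∀ j, Y j → ℝ}
    (hw : ∀ j, w j ∈ stdSimplex ℝ (Y j)) {e : I → J} (he : Function.Injective e)
    (F : (∀ i, Y (e i)) → ℝ) :
    ∑ φ : ∀ j, Y j, (∏ j, w j (φ j)) * F (fun i => φ (e i)) =
      ∑ u : ∀ i, Y (e i), (∏ i, w (e i) (u i)) * F u := by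
  rw [← sum_law_mul (fun φ : ∀ j, Y j => ∏ j, w j (φ j)) (fun φ i => φ (e i))]
  refine Finset.sum_congr rfl fun u _ => ?_
  congr 1
  rw [law_eq]
  -- The constraint becomes a product over all of `J`: it is vacuous off the range of `e`, and
  -- injectivity of `e` leaves one equation at each `e i`.
  have h1 : ∀ φ : ∀ j, Y j, ind ((fun i => φ (e i)) = u) =
      ∏ j, ind (∀ i (h : e i = j), φ j = h ▸ u i) := fun φ => by
    rw [← ind_forall]
    congr 1
    rw [funext_iff, eq_iff_iff]
    constructor
    · rintro h _ i rfl; exact h i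
    · intro h i; exact h _ i rfl
  simp_rw [h1, ← Finset.prod_mul_distrib]
  rw [sum_pi_prod fun j y => w j y * ind (∀ i (h : e i = j), y = h ▸ u i)]
  refine (Fintype.prod_of_injective e he _ _ ?_ ?_).symm
  · intro j hj
    rw [← (hw j).2]
    refine Finset.sum_congr rfl fun y _ => ?_
    rw [ind_of, mul_one]
    rintro i rfl
    exact absurd ⟨i, rfl⟩ hj
  · intro i
    have : ∀ y, ind (∀ i' (h : e i' = e i), y = h ▸ u i') = ind (u i = y) := fun y => by
      congr 1
      rw [eq_iff_iff]
      constructor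
      · intro h; exact (h i rfl).symm
      · rintro rfl i' h
        obtain rfl := he h
        rfl
    simp_rw [this, mul_comm _ (ind _)]
    rw [sum_ind_eq_mul]

theorem unif_fun {A ℋ : Type*} [Fintype A] [DecidableEq A] [Fintype ℋ] (h : A → ℋ) :
    unif (A → ℋ) h = ∏ a, unif ℋ (h a) := by
  simp [unif]

/-- Collision probability of a uniformly random function. -/
theorem sum_unif_collision {A ℋ : Type*} [Fintype A] [DecidableEq A] [Fintype ℋ] [Nonempty ℋ]
    (a a' : A) : ∑ h : A → ℋ, unif (A → ℋ) h * ind (h a = h a') =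
      (Fintype.card ℋ : ℝ)⁻¹ ^ (ind (a ≠ a')) := by
  by_cases haa : a = a'
  · subst haa
    simp only [ne_eq, not_true_eq_false, ind_of, ind_of_not, not_false_eq_true, Real.rpow_zero,
      mul_one]
    exact (unif_mem_stdSimplex (A → ℋ)).2
  · rw [ind_of haa, Real.rpow_one]
    have hinj : Function.Injective ![a, a'] := by
      intro i j; fin_cases i <;> fin_cases j <;> simp [haa, Ne.symm haa]
    have := sum_pi_restrict (w := fun _ : A => unif ℋ) (fun _ => unif_mem_stdSimplex ℋ) hinj
      (fun u => ind (u 0 = u 1))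
    simp_rw [unif_fun]
    refine this.trans ?_
    rw [← Fintype.sum_equiv (finTwoArrowEquiv ℋ).symm
      (fun x => unif ℋ x.1 * unif ℋ x.2 * ind (x.1 = x.2)) _ (fun x => by simp),
      Fintype.sum_prod_type]
    have : ∀ x y : ℋ, unif ℋ x * unif ℋ y * ind (x = y) = unif ℋ x * (ind (x = y) * unif ℋ y) :=
      fun x y => by ring
    simp_rw [this, ← Finset.mul_sum, sum_ind_eq_mul]
    have := (unif_mem_stdSimplex ℋ).2
    simp only [unif] at this ⊢
    rw [← Finset.mul_sum, this, mul_one]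

/-- Collision probability of a family of independent uniformly random functions, of which those
with index `e i` are evaluated. -/
theorem sum_unif_collision_family {I T : Type*} [Fintype I] [DecidableEq I] [Fintype T]
    [DecidableEq T] {A ℋ : T → Type*} [∀ t, Fintype (A t)] [∀ t, DecidableEq (A t)]
    [∀ t, Fintype (ℋ t)] [∀ t, Nonempty (ℋ t)] {e : I → T} (he : Function.Injective e)
    (a a' : ∀ i, A (e i)) :
    ∑ h : ∀ t, A t → ℋ t, (∏ t, unif (A t → ℋ t) (h t)) *
        ind (∀ i, h (e i) (a i) = h (e i) (a' i)) =
      ∏ i, (Fintype.card (ℋ (e i)) : ℝ)⁻¹ ^ ind (a i ≠ a' i) := by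
  refine (sum_pi_restrict (fun t => unif_mem_stdSimplex (A t → ℋ t)) he
    fun h => ind (∀ i, h i (a i) = h i (a' i))).trans ?_
  simp_rw [ind_forall, ← Finset.prod_mul_distrib]
  rw [sum_pi_prod fun i (h : A (e i) → ℋ (e i)) =>
    unif (A (e i) → ℋ (e i)) h * ind (h (a i) = h (a' i))]
  exact Finset.prod_congr rfl fun i _ => sum_unif_collision _ _

end Hash

/-! ### Total variation of product distributions -/

/-- Factors are exchanged one at a time: $|A_0A-B_0B|\le|A_0-B_0|A+B_0|A-B|$, and the untouched
factors sum to one. -/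
theorem sum_abs_prod_sub_prod_le {N : ℕ} {Y : Fin N → Type*} [∀ i, Fintype (Y i)]
    {A B : ∀ i, Y i → ℝ} (hA : ∀ i, A i ∈ stdSimplex ℝ (Y i)) (hB : ∀ i, B i ∈ stdSimplex ℝ (Y i)) :
    ∑ y : ∀ i, Y i, |∏ i, A i (y i) - ∏ i, B i (y i)| ≤ ∑ i, ∑ y, |A i y - B i y| := by
  induction N with
  | zero => simp
  | succ N ih =>
    rw [← Fintype.sum_equiv (Fin.consEquiv Y)
      (fun x => |A 0 x.1 * ∏ i : Fin N, A i.succ (x.2 i) - B 0 x.1 * ∏ i : Fin N, B i.succ (x.2 i)|)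
      _ (fun x => by simp [Fin.consEquiv, Fin.prod_univ_succ]), Fintype.sum_prod_type,
      Fin.sum_univ_succ]
    have hA' := (prod_mem_stdSimplex fun i : Fin N => hA i.succ).2
    have ih' := ih (fun i => hA i.succ) (fun i => hB i.succ)
    calc _ ≤ ∑ y, ∑ z : ∀ i : Fin N, Y i.succ, (|A 0 y - B 0 y| * ∏ i : Fin N, A i.succ (z i) +
          B 0 y * |∏ i : Fin N, A i.succ (z i) - ∏ i : Fin N, B i.succ (z i)|) := by
          refine Finset.sum_le_sum fun y _ => Finset.sum_le_sum fun z _ => ?_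
          have h0 : 0 ≤ ∏ i : Fin N, A i.succ (z i) :=
            Finset.prod_nonneg fun i _ => (hA i.succ).1 _
          rw [← abs_of_nonneg h0, ← abs_mul, abs_of_nonneg h0,
            ← abs_of_nonneg ((hB 0).1 y), ← abs_mul, abs_of_nonneg ((hB 0).1 y)]
          refine le_trans (le_of_eq ?_) (abs_add_le _ _)
          congr 1; ring
      _ ≤ _ := by
          simp_rw [Finset.sum_add_distrib, ← Finset.mul_sum, hA', mul_one, ← Finset.sum_mul,
            (hB 0).2, one_mul]
          gcongr

/-! ### Decoding by joint typicality -/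

section Decoding

/-- The value `z` is not the only one in `typ` with its hash. -/
def Confused {Z ℋ : Type*} (typ : Set Z) (h : Z → ℋ) (z : Z) : Prop :=
  z ∉ typ ∨ ∃ z' ∈ typ, z' ≠ z ∧ h z' = h z

/-- Some element of `typ` with a given hash. -/
def decodeIn {Z ℋ : Type*} [Nonempty Z] (typ : Set Z) (h : Z → ℋ) (v : ℋ) : Z :=
  Classical.epsilon fun z => z ∈ typ ∧ h z = v

theorem decodeIn_eq {Z ℋ : Type*} [Nonempty Z] {typ : Set Z} {h : Z → ℋ} {z : Z}
    (hz : ¬Confused typ h z) : decodeIn typ h (h z) = z := by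
  simp only [Confused, not_or, not_not, not_exists, not_and] at hz
  have := Classical.epsilon_spec (p := fun z' => z' ∈ typ ∧ h z' = h z) ⟨z, hz.1, rfl⟩
  by_contra hne
  exact hz.2 _ this.1 hne this.2

theorem sum_ind_le_one {α : Type*} [Fintype α] {c : α → Prop} (h : ∀ x y, c x → c y → x = y) :
    ∑ x, ind (c x) ≤ 1 := by
  by_cases hc : ∃ x, c x
  · obtain ⟨x, hx⟩ := hc
    rw [← sum_ind_eq x]
    exact Finset.sum_le_sum fun y _ => ind_mono fun hy => h x y hx hy
  · push Not at hc
    rw [Finset.sum_eq_zero fun x _ => ind_of_not (hc x)]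
    exact zero_le_one

/-- Union bound over the competitors `z'`, with the average over the hash functions moved inside,
where it becomes a collision probability. -/
theorem sum_confused_le {S Z ℋ R : Type*} [Fintype S] [Fintype Z] [Fintype R] {p : S → ℝ}
    (hp : ∀ s, 0 ≤ p s) {w : R → ℝ} (hw : w ∈ stdSimplex ℝ R) (z : S → Z) (typ : Set Z)
    (hash : R → Z → ℋ) :
    ∑ r, w r * ∑ s, p s * ind (Confused typ (hash r) (z s)) ≤
      ∑ s, p s * ind (z s ∉ typ) + ∑ s, p s * ∑ z', ind (z' ∈ typ ∧ z' ≠ z s) *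
        ∑ r, w r * ind (hash r z' = hash r (z s)) := by
  have h1 : ∀ r s, ind (Confused typ (hash r) (z s)) ≤ ind (z s ∉ typ) +
      ∑ z', ind (z' ∈ typ ∧ z' ≠ z s) * ind (hash r z' = hash r (z s)) := fun r s => by
    refine (ind_or_le _ _).trans (add_le_add le_rfl ((ind_exists_le _).trans
      (Finset.sum_le_sum fun z' _ => ?_)))
    rw [← ind_and]
    exact ind_mono fun h => ⟨⟨h.1, h.2.1⟩, h.2.2⟩
  calc _ ≤ ∑ r, w r * ∑ s, p s * (ind (z s ∉ typ) +
        ∑ z', ind (z' ∈ typ ∧ z' ≠ z s) * ind (hash r z' = hash r (z s))) :=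
        Finset.sum_le_sum fun r _ => mul_le_mul_of_nonneg_left (Finset.sum_le_sum fun s _ =>
          mul_le_mul_of_nonneg_left (h1 r s) (hp s)) (hw.1 r)
    _ = _ := by
        simp_rw [mul_add, Finset.sum_add_distrib, mul_add, Finset.sum_add_distrib,
          ← Finset.sum_mul, hw.2, one_mul]
        congr 1
        simp_rw [Finset.mul_sum]
        rw [Finset.sum_comm]
        refine Finset.sum_congr rfl fun s _ => ?_
        rw [Finset.sum_comm]
        refine Finset.sum_congr rfl fun z' _ => Finset.sum_congr rfl fun r _ => by ring

theorem exists_pos_forall_le {ι : Type*} [Finite ι] {f : ι → ℝ} (hf : ∀ i, 0 < f i) :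
    ∃ δ > 0, ∀ i, δ ≤ f i := by
  rcases isEmpty_or_nonempty ι with h | h
  · exact ⟨1, one_pos, fun i => h.elim i⟩
  · obtain ⟨i, hi⟩ := Finite.exists_min f
    exact ⟨f i, hf i, hi⟩

theorem exists_two_rpow_neg_le {δ ε : ℝ} (hδ : 0 < δ) (hε : 0 < ε) :
    ∃ n₀ : ℕ, ∀ n : ℕ, n₀ ≤ n → (2 : ℝ) ^ (-(n * δ)) ≤ ε := by
  obtain ⟨n₀, h⟩ := exists_nat_ge (-Real.logb 2 ε / δ)
  refine ⟨n₀, fun n hn => ?_⟩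
  rw [← Real.le_logb_iff_rpow_le one_lt_two hε]
  rw [div_le_iff₀ hδ] at h
  have : (n₀ : ℝ) * δ ≤ n * δ := by gcongr
  linarith

theorem exists_forall_nat {ι : Type*} [Finite ι] {q : ι → ℕ → Prop}
    (h : ∀ i, ∃ n₀, ∀ n, n₀ ≤ n → q i n) : ∃ n₀, ∀ n, n₀ ≤ n → ∀ i, q i n := by
  choose f hf using h
  obtain ⟨b, hb⟩ := (Set.finite_range f).bddAbove
  exact ⟨b, fun n hn i => hf i n ((hb ⟨i, rfl⟩).trans hn)⟩

/-- Slepian-Wolf decoding of independent repetitions from random hashes.  The family `ℰ` lists the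
possible error patterns: an erroneous decision shares with the true value the part `b e`, for some
pattern `e`. -/
theorem slepian_wolf {Ω 𝒵 ℰ : Type*} [Fintype Ω] [Fintype 𝒵] [Fintype ℰ] {α β : ℰ → Type*}
    [∀ e, Fintype (α e)] [∀ e, Fintype (β e)] {p : Ω → ℝ} (hp : p ∈ stdSimplex ℝ Ω) (Z : Ω → 𝒵)
    (a : ∀ e, 𝒵 → α e) (b : ∀ e, 𝒵 → β e)
    (hinj : ∀ e z z', a e z = a e z' → b e z = b e z' → z = z') (rate : ℰ → ℝ)
    (hrate : ∀ e, condEntropy p (fun ω => a e (Z ω)) (fun ω => b e (Z ω)) < rate e)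
    {ε : ℝ} (hε : 0 < ε) :
    ∃ (typ : ∀ n, Set (Fin n → 𝒵)) (n₀ : ℕ), ∀ n, n₀ ≤ n →
      ∀ {R : Type*} {ℋ : Type*} [Fintype R] (w : R → ℝ) (_ : w ∈ stdSimplex ℝ R)
        (hash : R → (Fin n → 𝒵) → ℋ),
        (∀ z z', z' ≠ z → ∑ r, w r * ind (hash r z' = hash r z) ≤
          ∑ e, ind (∀ t, b e (z' t) = b e (z t)) * (2 : ℝ) ^ (-(n * rate e))) →
        ∑ r, w r * ∑ ω, iid p n ω * ind (Confused (typ n) (hash r) fun t => Z (ω t)) ≤ ε := by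
  set H : ℰ → ℝ := fun e => condEntropy p (fun ω => a e (Z ω)) (fun ω => b e (Z ω)) with hH
  set cp : ∀ e, α e → β e → ℝ := fun e =>
    condProb p (fun ω => a e (Z ω)) (fun ω => b e (Z ω)) with hcp
  have hcp0 : ∀ e x y, 0 ≤ cp e x y := fun e => condProb_nonneg hp.1 _ _
  obtain ⟨δ₀, hδ₀, hδle⟩ := exists_pos_forall_le fun e => sub_pos.2 (hrate e)
  -- Half of the gap between rate and entropy is spent on typicality; the other half remains as
  -- exponential decay.
  set δ := δ₀ / 2 with hδ
  have hδ0 : 0 < δ := half_pos hδ₀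
  set ε₁ := ε / (2 * (Fintype.card ℰ + 1)) with hε₁
  have hε₁0 : 0 < ε₁ := by positivity
  obtain ⟨n₁, hn₁⟩ := exists_forall_nat fun e =>
    aep hp (fun ω => a e (Z ω)) (fun ω => b e (Z ω)) hδ0 hε₁0
  obtain ⟨n₂, hn₂⟩ := exists_two_rpow_neg_le hδ0 hε₁0
  -- Only lower bounds on conditional probabilities enter the typical set, since it is used only for
  -- counting. It does not depend on the hash functions.
  refine ⟨fun n => {z | ∀ e, (2 : ℝ) ^ (-(n * (H e + δ))) ≤ ∏ t, cp e (a e (z t)) (b e (z t))},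
    max n₁ n₂, fun n hn R ℋ _ w hw hash hcoll => ?_⟩
  set typ : Set (Fin n → 𝒵) :=
    {z | ∀ e, (2 : ℝ) ^ (-(n * (H e + δ))) ≤ ∏ t, cp e (a e (z t)) (b e (z t))} with htyp
  -- Each typical `z'` that shares the part `b e` with `z` has conditional probability at least
  -- $2^{-n(H+\delta)}$, and these probabilities sum to at most one.
  have hcount : ∀ e (z : Fin n → 𝒵), ∑ z', ind (z' ∈ typ) * ind (∀ t, b e (z' t) = b e (z t)) ≤
      (2 : ℝ) ^ (n * (H e + δ)) := by
    intro e z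
    -- By `hinj`, distinct `z'` with the same part `b e` have distinct parts `a e`, so no
    -- conditional probability is counted twice.
    have hone : ∀ y, ∑ z', ind (b e z' = y) * cp e (a e z') y ≤ 1 := fun y => by
      have : ∀ z', ind (b e z' = y) * cp e (a e z') y =
          ∑ x, ind (a e z' = x ∧ b e z' = y) * cp e x y := fun z' => by
        simp_rw [ind_and, mul_assoc]
        exact (sum_ind_eq_mul (a e z') fun x => ind (b e z' = y) * cp e x y).symm
      simp_rw [this]
      rw [Finset.sum_comm]
      refine (Finset.sum_le_sum fun x _ => ?_).trans (sum_condProb_le_one p (fun ω => a e (Z ω)) (fun ω => b e (Z ω)) y)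
      rw [← Finset.sum_mul]
      refine mul_le_of_le_one_left (hcp0 e x y) (sum_ind_le_one fun z₁ z₂ h₁ h₂ =>
        hinj e _ _ (h₁.1.trans h₂.1.symm) (h₁.2.trans h₂.2.symm))
    calc _ ≤ ∑ z' : Fin n → 𝒵, (2 : ℝ) ^ (n * (H e + δ)) *
          ∏ t, (ind (b e (z' t) = b e (z t)) * cp e (a e (z' t)) (b e (z t))) := by
          refine Finset.sum_le_sum fun z' _ => ?_
          rw [Finset.prod_mul_distrib, ← ind_forall, mul_left_comm, mul_comm]
          by_cases hb : ∀ t, b e (z' t) = b e (z t)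
          · rw [ind_of hb, one_mul, one_mul]
            by_cases hz : z' ∈ typ
            · have h1 := hz e
              rw [ind_of hz]
              simp_rw [hb] at h1
              rw [Real.rpow_neg zero_le_two] at h1
              exact (inv_le_iff_one_le_mul₀' (by positivity)).1 h1
            · rw [ind_of_not hz]
              exact mul_nonneg (by positivity) (Finset.prod_nonneg fun t _ => hcp0 _ _ _)
          · rw [ind_of_not hb, zero_mul, zero_mul]
      _ ≤ (2 : ℝ) ^ (n * (H e + δ)) * 1 := by
          rw [← Finset.mul_sum]
          refine mul_le_mul_of_nonneg_left ?_ (by positivity)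
          rw [sum_pi_prod fun t z' => ind (b e z' = b e (z t)) * cp e (a e z') (b e (z t))]
          exact Finset.prod_le_one (fun t _ => Finset.sum_nonneg fun z' _ =>
            mul_nonneg (ind_nonneg _) (hcp0 _ _ _)) fun t _ => hone _
      _ = _ := mul_one _
  refine (sum_confused_le (iid_nonneg hp.1 n) hw _ typ hash).trans ?_
  have hfirst : ∑ ω, iid p n ω * ind ((fun t => Z (ω t)) ∉ typ) ≤ Fintype.card ℰ * ε₁ := by
    calc _ ≤ ∑ ω, iid p n ω * ∑ e, ind (¬((2 : ℝ) ^ (-(n * (H e + δ))) ≤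
            ∏ t, cp e (a e (Z (ω t))) (b e (Z (ω t))) ∧
          ∏ t, cp e (a e (Z (ω t))) (b e (Z (ω t))) ≤ (2 : ℝ) ^ (-(n * (H e - δ))))) := by
          refine Finset.sum_le_sum fun ω _ => mul_le_mul_of_nonneg_left
            ((ind_mono fun h => ?_).trans (ind_exists_le _)) (iid_nonneg hp.1 n ω)
          simp only [htyp, Set.mem_ofPred_eq, not_forall] at h
          obtain ⟨e, he⟩ := h
          exact ⟨e, fun h => he h.1⟩
      _ ≤ ∑ _e : ℰ, ε₁ := by
          simp_rw [Finset.mul_sum]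
          rw [Finset.sum_comm]
          exact Finset.sum_le_sum fun e _ => hn₁ n ((le_max_left _ _).trans hn) e
      _ = _ := by simp
  have hsecond : ∀ z : Fin n → 𝒵, ∑ z', ind (z' ∈ typ ∧ z' ≠ z) *
      ∑ r, w r * ind (hash r z' = hash r z) ≤ Fintype.card ℰ * ε₁ := fun z => by
    calc _ ≤ ∑ z', ∑ e, (2 : ℝ) ^ (-(n * rate e)) *
          (ind (z' ∈ typ) * ind (∀ t, b e (z' t) = b e (z t))) := by
          refine Finset.sum_le_sum fun z' _ => ?_
          by_cases hz : z' ∈ typ ∧ z' ≠ z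
          · rw [ind_of hz, one_mul]
            refine (hcoll z z' hz.2).trans (le_of_eq (Finset.sum_congr rfl fun e _ => ?_))
            rw [ind_of hz.1]; ring
          · rw [ind_of_not hz, zero_mul]
            exact Finset.sum_nonneg fun e _ => mul_nonneg (by positivity)
              (mul_nonneg (ind_nonneg _) (ind_nonneg _))
      _ ≤ ∑ _e : ℰ, ε₁ := by
          rw [Finset.sum_comm]
          refine Finset.sum_le_sum fun e _ => ?_
          rw [← Finset.mul_sum]
          calc _ ≤ (2 : ℝ) ^ (-(n * rate e)) * (2 : ℝ) ^ (n * (H e + δ)) :=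
                mul_le_mul_of_nonneg_left (hcount e z) (by positivity)
            _ = (2 : ℝ) ^ (n * (H e + δ - rate e)) := by
                rw [← Real.rpow_add two_pos]; congr 1; ring
            _ ≤ (2 : ℝ) ^ (-(n * δ)) := by
                refine Real.rpow_le_rpow_of_exponent_le one_le_two ?_
                have := hδle e
                rw [← mul_neg]
                refine mul_le_mul_of_nonneg_left ?_ (Nat.cast_nonneg n)
                simp only [hδ]
                linarith
            _ ≤ ε₁ := hn₂ n ((le_max_right _ _).trans hn)
      _ = _ := by simp
  have hthird : ∑ ω, iid p n ω * ∑ z', ind (z' ∈ typ ∧ z' ≠ fun t => Z (ω t)) *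
      ∑ r, w r * ind (hash r z' = hash r fun t => Z (ω t)) ≤ Fintype.card ℰ * ε₁ := by
    calc _ ≤ ∑ ω, iid p n ω * (Fintype.card ℰ * ε₁) :=
          Finset.sum_le_sum fun ω _ => mul_le_mul_of_nonneg_left (hsecond _) (iid_nonneg hp.1 n ω)
      _ = _ := by rw [← Finset.sum_mul, sum_iid hp, one_mul]
  have hfin : (Fintype.card ℰ : ℝ) * ε₁ ≤ ε / 2 := by
    rw [hε₁, ← mul_div_assoc, div_le_div_iff₀ (by positivity) two_pos]
    nlinarith
  linarith

end Decoding

end DIR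
end

noncomputable section
namespace DIR

/-! ### Uniformity of random hashes -/

section Leftover

/-- A leftover hash argument. The mass off `G` is discarded, at a cost of twice its size. On `G`,
the absolute deviation is controlled by the squared one, which counts colliding pairs; `d` bounds
the weighted excess of $|F|$ times their collision probability over one. The parameter `s` balances
the two terms. -/
theorem sum_abs_hash_sub_le {V F R : Type*} [Fintype V] [Fintype F] [Nonempty F] [Fintype R]
    {w : V → ℝ} (hw : w ∈ stdSimplex ℝ V) (G : Set V) {ν : R → ℝ} (hν : ν ∈ stdSimplex ℝ R)
    (hash : R → V → F) {d : ℝ}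
    (hcoll : ∑ v, ∑ v', w v * ind (v ∈ G) * (w v' * ind (v' ∈ G)) *
      (Fintype.card F * ∑ r, ν r * ind (hash r v = hash r v') - 1) ≤ d)
    {s : ℝ} (hs : 0 < s) :
    ∑ r, ν r * ∑ f, |(Fintype.card F : ℝ)⁻¹ - ∑ v, w v * ind (hash r v = f)| ≤
      2 * ∑ v, w v * ind (v ∉ G) + s / 2 + d / (2 * s) := by
  set m : ℝ := (Fintype.card F : ℝ) with hm
  have hm0 : 0 < m := by rw [hm]; exact_mod_cast Fintype.card_pos
  set g : V → ℝ := fun v => w v * ind (v ∈ G) with hg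
  have hg0 : ∀ v, 0 ≤ g v := fun v => mul_nonneg (hw.1 v) (ind_nonneg _)
  set b := ∑ v, w v * ind (v ∉ G) with hb
  have hsplit : ∀ v, w v = g v + w v * ind (v ∉ G) := fun v => by
    by_cases h : v ∈ G <;> simp [hg, ind, h]
  set T := ∑ v, g v with hT
  have hT1 : T + b = 1 := by
    rw [hT, hb, ← Finset.sum_add_distrib, ← hw.2]
    exact Finset.sum_congr rfl fun v _ => (hsplit v).symm
  have hb0 : 0 ≤ b := Finset.sum_nonneg fun v _ => mul_nonneg (hw.1 v) (ind_nonneg _)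
  have hpart : ∀ (r : R) (u : V → ℝ), ∑ f, ∑ v, u v * ind (hash r v = f) = ∑ v, u v := by
    intro r u
    rw [Finset.sum_comm]
    refine Finset.sum_congr rfl fun v _ => ?_
    rw [← Finset.mul_sum, sum_ind_eq, mul_one]
  have hr : ∀ r, ∑ f, |m⁻¹ - ∑ v, w v * ind (hash r v = f)| ≤ 2 * b + s / 2 +
      (∑ v, ∑ v', g v * g v' * (m * ind (hash r v = hash r v') - 1)) / (2 * s) := by
    intro r
    have h1 : ∀ f, |m⁻¹ - ∑ v, w v * ind (hash r v = f)| ≤ b / m +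
        ∑ v, w v * ind (v ∉ G) * ind (hash r v = f) +
          (s / m + m * (∑ v, g v * ind (hash r v = f) - T / m) ^ 2 / s) / 2 := by
      intro f
      have e : m⁻¹ - ∑ v, w v * ind (hash r v = f) = b / m -
          ∑ v, w v * ind (v ∉ G) * ind (hash r v = f) -
            (∑ v, g v * ind (hash r v = f) - T / m) := by
        have : ∑ v, w v * ind (hash r v = f) = ∑ v, g v * ind (hash r v = f) +
            ∑ v, w v * ind (v ∉ G) * ind (hash r v = f) := by
          rw [← Finset.sum_add_distrib]
          exact Finset.sum_congr rfl fun v _ => by rw [← add_mul, ← hsplit]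
        rw [this, inv_eq_one_div, ← hT1]
        ring
      have p1 : 0 ≤ b / m := by positivity
      have p2 : 0 ≤ ∑ v, w v * ind (v ∉ G) * ind (hash r v = f) :=
        Finset.sum_nonneg fun v _ => mul_nonneg (mul_nonneg (hw.1 v) (ind_nonneg _)) (ind_nonneg _)
      generalize ∑ v, g v * ind (hash r v = f) - T / m = y at e ⊢
      -- Arithmetic-geometric mean inequality, from $(s/m)(1-m|y|/s)^2\ge0$.
      have p3 : |y| ≤ (s / m + m * y ^ 2 / s) / 2 := by
        have : 0 ≤ (s / m) * (1 - m * |y| / s) ^ 2 := by positivity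
        have e2 : (s / m) * (1 - m * |y| / s) ^ 2 = s / m + m * |y| ^ 2 / s - 2 * |y| := by
          field_simp
          ring
        rw [sq_abs] at e2
        linarith
      rw [e]
      refine (abs_sub _ _).trans (add_le_add ((abs_sub _ _).trans ?_) p3)
      rw [abs_of_nonneg p1, abs_of_nonneg p2]
    refine (Finset.sum_le_sum fun f _ => h1 f).trans (le_of_eq ?_)
    have hc : ∀ c : ℝ, ∑ _f : F, c / m = c := fun c => by
      rw [Finset.sum_const, nsmul_eq_mul, Finset.card_univ, ← hm]; field_simp
    -- Expanding the square and summing over the hash values leaves the pairs with equal hash.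
    have hsq : ∑ f, (∑ v, g v * ind (hash r v = f) - T / m) ^ 2 =
        (∑ v, ∑ v', g v * g v' * (m * ind (hash r v = hash r v') - 1)) / m := by
      have e1 : ∀ f, (∑ v, g v * ind (hash r v = f) - T / m) ^ 2 =
          ∑ v, ∑ v', (g v * g v' * ind (hash r v' = f)) * ind (hash r v = f) -
            2 * (T / m) * ∑ v, g v * ind (hash r v = f) + T ^ 2 / m / m := by
        intro f
        rw [sub_sq, sq (∑ v, g v * _), Finset.sum_mul_sum]
        have : ∀ v v', g v * ind (hash r v = f) * (g v' * ind (hash r v' = f)) =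
          (g v * g v' * ind (hash r v' = f)) * ind (hash r v = f) := fun v v' => by ring
        simp_rw [this]
        ring
      have e2 : ∀ v v', ∑ f, (g v * g v' * ind (hash r v' = f)) * ind (hash r v = f) =
          g v * g v' * ind (hash r v = hash r v') := fun v v' => by
        have := sum_ind_eq_mul (hash r v) fun f => g v * g v' * ind (hash r v' = f)
        simp_rw [mul_comm (ind _)] at this
        rw [this, show (hash r v' = hash r v) = (hash r v = hash r v') from propext eq_comm]
      have e3 : ∑ f, ∑ v, ∑ v', (g v * g v' * ind (hash r v' = f)) * ind (hash r v = f) =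
          ∑ v, ∑ v', g v * g v' * ind (hash r v = hash r v') := by
        rw [Finset.sum_comm]
        refine Finset.sum_congr rfl fun v _ => ?_
        rw [Finset.sum_comm]
        exact Finset.sum_congr rfl fun v' _ => e2 v v'
      simp_rw [e1, Finset.sum_add_distrib, Finset.sum_sub_distrib]
      rw [hc, ← Finset.mul_sum, hpart, ← hT, e3]
      have e4 : ∑ v, ∑ v', g v * g v' * (m * ind (hash r v = hash r v') - 1) =
          m * ∑ v, ∑ v', g v * g v' * ind (hash r v = hash r v') - T * T := by
        simp_rw [hT, Finset.sum_mul_sum, Finset.mul_sum, ← Finset.sum_sub_distrib]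
        exact Finset.sum_congr rfl fun v _ => Finset.sum_congr rfl fun v' _ => by ring
      rw [e4]
      field_simp
      ring
    rw [Finset.sum_add_distrib, Finset.sum_add_distrib, ← Finset.sum_div _ _ (2 : ℝ),
      Finset.sum_add_distrib, ← Finset.sum_div _ _ s, ← Finset.mul_sum, hpart, hsq, ← hb, hc, hc]
    field_simp
    ring
  calc _ ≤ ∑ r, ν r * (2 * b + s / 2 +
        (∑ v, ∑ v', g v * g v' * (m * ind (hash r v = hash r v') - 1)) / (2 * s)) :=
        Finset.sum_le_sum fun r _ => mul_le_mul_of_nonneg_left (hr r) (hν.1 r)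
    _ = 2 * b + s / 2 + (∑ v, ∑ v', g v * g v' *
        (m * ∑ r, ν r * ind (hash r v = hash r v') - 1)) / (2 * s) := by
        simp_rw [mul_add, Finset.sum_add_distrib, ← Finset.sum_mul, hν.2, one_mul, ← mul_div_assoc,
          ← Finset.sum_div]
        congr 2
        simp_rw [Finset.mul_sum]
        rw [Finset.sum_comm]
        refine Finset.sum_congr rfl fun v _ => ?_
        rw [Finset.sum_comm]
        refine Finset.sum_congr rfl fun v' _ => ?_
        have : ∀ r, ν r * (g v * g v' * (m * ind (hash r v = hash r v') - 1)) =
          g v * g v' * (m * (ν r * ind (hash r v = hash r v'))) - g v * g v' * ν r :=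
          fun r => by ring
        simp_rw [this, Finset.sum_sub_distrib, ← Finset.mul_sum, hν.2]
        ring
    _ ≤ _ := by gcongr

/-- Random hashes of independent repetitions of `U` are nearly uniform and nearly independent of
`X`.  The family `ℰ` lists the parts `c e` that two values with dependent hashes may share. -/
theorem hash_nearly_uniform {𝒳 𝒰 ℰ : Type*} [Fintype 𝒳] [Fintype 𝒰] [Fintype ℰ] {γ : ℰ → Type*}
    [∀ e, Fintype (γ e)] {μ : 𝒳 → ℝ} (hμ : μ ∈ stdSimplex ℝ 𝒳) {W : 𝒳 → 𝒰 → ℝ}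
    (hW : ∀ x, W x ∈ stdSimplex ℝ 𝒰) (c : ∀ e, 𝒰 → γ e) (rate : ℰ → ℝ)
    (hrate : ∀ e, rate e <
      condEntropy (fun ω : 𝒳 × 𝒰 => μ ω.1 * W ω.1 ω.2) (fun ω => c e ω.2) fun ω => ω.1)
    {ε : ℝ} (hε : 0 < ε) :
    ∃ n₀ : ℕ, ∀ n, n₀ ≤ n →
      ∀ {R F : Type*} [Fintype R] [Fintype F] [Nonempty F] (ν : R → ℝ) (_ : ν ∈ stdSimplex ℝ R)
        (hash : R → (Fin n → 𝒰) → F),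
        (∀ v v', Fintype.card F * ∑ r, ν r * ind (hash r v = hash r v') ≤
          1 + ∑ e, ind (∀ t, c e (v' t) = c e (v t)) * (2 : ℝ) ^ (n * rate e)) →
        ∑ x, iid μ n x * ∑ r, ν r * ∑ f, |(Fintype.card F : ℝ)⁻¹ -
          ∑ v, (∏ t, W (x t) (v t)) * ind (hash r v = f)| ≤ ε := by
  set p : 𝒳 × 𝒰 → ℝ := fun ω => μ ω.1 * W ω.1 ω.2 with hpdef
  have hp : p ∈ stdSimplex ℝ (𝒳 × 𝒰) := by
    refine ⟨fun ω => mul_nonneg (hμ.1 _) ((hW _).1 _), ?_⟩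
    rw [Fintype.sum_prod_type]
    simp_rw [hpdef, ← Finset.mul_sum, (hW _).2, mul_one, hμ.2]
  set H : ℰ → ℝ := fun e => condEntropy p (fun ω => c e ω.2) fun ω => ω.1 with hH
  set cp : ∀ e, γ e → 𝒳 → ℝ := fun e => condProb p (fun ω => c e ω.2) fun ω => ω.1 with hcp
  obtain ⟨δ₀, hδ₀, hδle⟩ := exists_pos_forall_le fun e => sub_pos.2 (hrate e)
  set δ := δ₀ / 2 with hδ
  have hδ0 : 0 < δ := half_pos hδ₀
  set ε₁ := ε / (8 * (Fintype.card ℰ + 1)) with hε₁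
  have hε₁0 : 0 < ε₁ := by positivity
  -- Chosen so that the collision excess is at most $d=\varepsilon^2/4$; with $s=\varepsilon/2$, the
  -- last two terms of `sum_abs_hash_sub_le` then add up to $\varepsilon/2$.
  set ε₂ := ε ^ 2 / (4 * (Fintype.card ℰ + 1)) with hε₂
  have hε₂0 : 0 < ε₂ := by positivity
  obtain ⟨n₁, hn₁⟩ := exists_forall_nat fun e =>
    aep hp (fun ω => c e ω.2) (fun ω => ω.1) hδ0 hε₁0
  obtain ⟨n₂, hn₂⟩ := exists_two_rpow_neg_le hδ0 hε₂0
  refine ⟨max n₁ n₂, fun n hn R F _ _ _ ν hν hash hcoll => ?_⟩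
  -- Contrary to decoding, uniformity needs upper bounds on the conditional probabilities: no value
  -- may be too likely.
  set G : (Fin n → 𝒳) → Set (Fin n → 𝒰) := fun x =>
    {v | ∀ e, ∏ t, cp e (c e (v t)) (x t) ≤ (2 : ℝ) ^ (-(n * (H e - δ)))} with hG
  have hw : ∀ x : Fin n → 𝒳, (fun v : Fin n → 𝒰 => ∏ t, W (x t) (v t)) ∈
      stdSimplex ℝ (Fin n → 𝒰) := fun x => prod_mem_stdSimplex fun t => hW (x t)
  have hcpW : ∀ e g x, μ x ≠ 0 → cp e g x = ∑ u, W x u * ind (c e u = g) := by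
    intro e g x hx
    have h1 : law p (fun ω => (c e ω.2, ω.1)) (g, x) = μ x * ∑ u, W x u * ind (c e u = g) := by
      rw [law_eq, Fintype.sum_prod_type, Finset.mul_sum, Finset.sum_comm]
      refine Finset.sum_congr rfl fun u _ => ?_
      have := sum_ind_eq_mul x fun y => μ y * W y u * ind (c e u = g)
      rw [mul_assoc] at this
      rw [← this]
      refine Finset.sum_congr rfl fun y _ => ?_
      simp only [Prod.mk.injEq, ind_and, hpdef, eq_comm (a := y)]
      ring
    have h2 : law p (fun ω => ω.1) x = μ x := by
      rw [law_eq, Fintype.sum_prod_type]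
      have := sum_ind_eq_mul x μ
      refine Eq.trans (Finset.sum_congr rfl fun y _ => ?_) this
      simp only [hpdef]
      rw [← Finset.sum_mul, ← Finset.mul_sum, (hW y).2, eq_comm (a := y)]
      ring
    rw [hcp]
    simp only [condProb]
    rw [h1, h2, mul_div_cancel_left₀ _ hx]
  have hfix : ∀ x : Fin n → 𝒳, iid μ n x * ∑ r, ν r * ∑ f, |(Fintype.card F : ℝ)⁻¹ -
      ∑ v, (∏ t, W (x t) (v t)) * ind (hash r v = f)| ≤
      iid μ n x * (2 * ∑ v, (∏ t, W (x t) (v t)) * ind (v ∉ G x) + ε / 2) := by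
    intro x
    rcases (iid_nonneg hμ.1 n x).eq_or_lt with h0 | h0
    · simp [← h0]
    refine mul_le_mul_of_nonneg_left ?_ h0.le
    have hx : ∀ t, μ (x t) ≠ 0 := fun t hz => h0.ne' (Finset.prod_eq_zero (Finset.mem_univ t) hz)
    have hd : ∑ v, ∑ v', (∏ t, W (x t) (v t)) * ind (v ∈ G x) *
        ((∏ t, W (x t) (v' t)) * ind (v' ∈ G x)) *
        (Fintype.card F * ∑ r, ν r * ind (hash r v = hash r v') - 1) ≤ ε ^ 2 / 4 := by
      have h1 : ∀ v, ∑ v', (∏ t, W (x t) (v t)) * ind (v ∈ G x) *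
          ((∏ t, W (x t) (v' t)) * ind (v' ∈ G x)) *
          (Fintype.card F * ∑ r, ν r * ind (hash r v = hash r v') - 1) ≤
          (∏ t, W (x t) (v t)) * (Fintype.card ℰ * ε₂) := by
        intro v
        have hwv := (hw x).1 v
        by_cases hv : v ∈ G x
        swap
        · simp only [ind_of_not hv, mul_zero, zero_mul, Finset.sum_const_zero]
          exact mul_nonneg hwv (by positivity)
        simp_rw [ind_of hv, mul_one, mul_assoc, ← Finset.mul_sum]
        refine mul_le_mul_of_nonneg_left ?_ hwv
        have h2 : ∀ v', (∏ t, W (x t) (v' t)) * (ind (v' ∈ G x) *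
            (Fintype.card F * ∑ r, ν r * ind (hash r v = hash r v') - 1)) ≤
            ∑ e, (2 : ℝ) ^ (n * rate e) *
              ((∏ t, W (x t) (v' t)) * ind (∀ t, c e (v' t) = c e (v t))) := by
          intro v'
          have hs : 0 ≤ ∑ e, ind (∀ t, c e (v' t) = c e (v t)) * (2 : ℝ) ^ (n * rate e) :=
            Finset.sum_nonneg fun e _ => mul_nonneg (ind_nonneg _) (by positivity)
          have h3 : ind (v' ∈ G x) *
              (Fintype.card F * ∑ r, ν r * ind (hash r v = hash r v') - 1) ≤
              ∑ e, ind (∀ t, c e (v' t) = c e (v t)) * (2 : ℝ) ^ (n * rate e) := by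
            have := hcoll v v'
            by_cases hv' : v' ∈ G x
            · rw [ind_of hv', one_mul]; linarith
            · rw [ind_of_not hv', zero_mul]; exact hs
          refine (mul_le_mul_of_nonneg_left h3 ((hw x).1 v')).trans (le_of_eq ?_)
          rw [Finset.mul_sum]
          exact Finset.sum_congr rfl fun e _ => by ring
        refine (Finset.sum_le_sum fun v' _ => h2 v').trans ?_
        rw [Finset.sum_comm]
        calc _ ≤ ∑ _e : ℰ, ε₂ := by
              refine Finset.sum_le_sum fun e _ => ?_
              rw [← Finset.mul_sum]
              -- The conditional mass of all sequences that share the part `c e` with `v` is one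
              -- product of conditional probabilities, bounded because `v` lies in `G x`.
              have h4 : ∑ v' : Fin n → 𝒰, (∏ t, W (x t) (v' t)) *
                  ind (∀ t, c e (v' t) = c e (v t)) = ∏ t, cp e (c e (v t)) (x t) := by
                simp_rw [ind_forall, ← Finset.prod_mul_distrib]
                rw [sum_pi_prod fun t u => W (x t) u * ind (c e u = c e (v t))]
                exact Finset.prod_congr rfl fun t _ => (hcpW e _ _ (hx t)).symm
              rw [h4]
              calc _ ≤ (2 : ℝ) ^ (n * rate e) * (2 : ℝ) ^ (-(n * (H e - δ))) :=
                    mul_le_mul_of_nonneg_left (hv e) (by positivity)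
                _ = (2 : ℝ) ^ (n * (rate e - H e + δ)) := by
                    rw [← Real.rpow_add two_pos]; congr 1; ring
                _ ≤ (2 : ℝ) ^ (-(n * δ)) := by
                    refine Real.rpow_le_rpow_of_exponent_le one_le_two ?_
                    have := hδle e
                    rw [← mul_neg]
                    refine mul_le_mul_of_nonneg_left ?_ (Nat.cast_nonneg n)
                    simp only [hδ]
                    linarith
                _ ≤ ε₂ := hn₂ n ((le_max_right _ _).trans hn)
          _ = _ := by simp
      refine (Finset.sum_le_sum fun v _ => h1 v).trans ?_
      rw [← Finset.sum_mul, (hw x).2, one_mul, hε₂, ← mul_div_assoc,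
        div_le_div_iff₀ (by positivity) (by norm_num)]
      nlinarith [sq_nonneg ε]
    refine (sum_abs_hash_sub_le (hw x) (G x) hν hash hd (half_pos hε)).trans (le_of_eq ?_)
    field_simp
    ring
  refine (Finset.sum_le_sum fun x _ => hfix x).trans ?_
  simp_rw [mul_add, Finset.sum_add_distrib, ← Finset.sum_mul, sum_iid hμ, one_mul]
  have hatyp : ∑ x, iid μ n x * ∑ v, (∏ t, W (x t) (v t)) * ind (v ∉ G x) ≤
      Fintype.card ℰ * ε₁ := by
    have e1 : ∑ x, iid μ n x * ∑ v, (∏ t, W (x t) (v t)) * ind (v ∉ G x) =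
        ∑ ω, iid p n ω * ind ((fun t => (ω t).2) ∉ G fun t => (ω t).1) := by
      rw [Fintype.sum_equiv (Equiv.arrowProdEquivProdArrow (Fin n) (fun _ => 𝒳) (fun _ => 𝒰))
        (fun ω => iid p n ω * ind ((fun t => (ω t).2) ∉ G fun t => (ω t).1))
        (fun y => iid μ n y.1 * ((∏ t, W (y.1 t) (y.2 t)) * ind (y.2 ∉ G y.1))),
        Fintype.sum_prod_type]
      · simp_rw [Finset.mul_sum]
      · intro ω
        simp only [iid, hpdef, Equiv.arrowProdEquivProdArrow_apply, Finset.prod_mul_distrib]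
        ring
    rw [e1]
    calc _ ≤ ∑ ω, iid p n ω * ∑ e, ind (¬((2 : ℝ) ^ (-(n * (H e + δ))) ≤
            ∏ t, cp e (c e (ω t).2) (ω t).1 ∧
          ∏ t, cp e (c e (ω t).2) (ω t).1 ≤ (2 : ℝ) ^ (-(n * (H e - δ))))) := by
          refine Finset.sum_le_sum fun ω _ => mul_le_mul_of_nonneg_left
            ((ind_mono fun h => ?_).trans (ind_exists_le _)) (iid_nonneg hp.1 n ω)
          simp only [hG, Set.mem_ofPred_eq, not_forall] at h
          obtain ⟨e, he⟩ := h
          exact ⟨e, fun h => he h.2⟩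
      _ ≤ ∑ _e : ℰ, ε₁ := by
          simp_rw [Finset.mul_sum]
          rw [Finset.sum_comm]
          exact Finset.sum_le_sum fun e _ => hn₁ n ((le_max_left _ _).trans hn) e
      _ = _ := by simp
  have hfin : (Fintype.card ℰ : ℝ) * ε₁ ≤ ε / 8 := by
    rw [hε₁, ← mul_div_assoc, div_le_div_iff₀ (by positivity) (by norm_num)]
    nlinarith
  simp_rw [mul_left_comm _ (2 : ℝ), ← Finset.mul_sum]
  linarith

end Leftover

end DIR
end

noncomputable section
namespace DIR

/-! ### Choosing auxiliary sequences with prescribed hashes -/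

section Selection

theorem sum_pi_apply {ι : Type*} [Fintype ι] [DecidableEq ι] {Y : ι → Type*}
    [∀ i, Fintype (Y i)] {w : ∀ i, Y i → ℝ} (hw : ∀ i, w i ∈ stdSimplex ℝ (Y i)) (i : ι)
    (g : Y i → ℝ) : ∑ y : ∀ i, Y i, (∏ i, w i (y i)) * g (y i) = ∑ y, w i y * g y := by
  have := sum_pi_restrict hw (e := fun _ : Unit => i) (fun _ _ _ => rfl) fun u => g (u ())
  refine this.trans (Fintype.sum_equiv (Equiv.funUnique Unit (Y i)) _ _ fun u => ?_)
  simp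

/-- The distribution `V` conditioned on `h = y`. -/
def condOn {B F : Type*} [Fintype B] (V : B → ℝ) (h : B → F) (y : F) (v : B) : ℝ :=
  open Classical in
  -- Conditioning on an event of probability zero is void, so that the result is a probability
  -- distribution in every case.
  if law V h y = 0 then V v else V v * ind (h v = y) / law V h y

theorem condOn_mem_stdSimplex {B F : Type*} [Fintype B] {V : B → ℝ} (hV : V ∈ stdSimplex ℝ B)
    (h : B → F) (y : F) : condOn V h y ∈ stdSimplex ℝ B := by
  by_cases h0 : law V h y = 0
  · have : condOn V h y = V := by funext v; simp [condOn, h0]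
    rwa [this]
  · refine ⟨fun v => ?_, ?_⟩
    · simp only [condOn, h0, if_false]
      exact div_nonneg (mul_nonneg (hV.1 v) (ind_nonneg _)) (law_nonneg hV.1 _ _)
    · simp only [condOn, h0, if_false]
      rw [← Finset.sum_div, ← law_eq, div_self h0]

theorem law_mul_condOn {B F : Type*} [Fintype B] {V : B → ℝ} (hV : V ∈ stdSimplex ℝ B)
    (h : B → F) (y : F) (v : B) : law V h y * condOn V h y v = V v * ind (h v = y) := by
  by_cases h0 : law V h y = 0
  · rw [h0, zero_mul]
    rw [law_eq, Finset.sum_eq_zero_iff_of_nonneg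
      fun v _ => mul_nonneg (hV.1 v) (ind_nonneg _)] at h0
    exact (h0 v (Finset.mem_univ v)).symm
  · simp only [condOn, h0, if_false]
    field_simp

/-- Two laws of (hash, sequence) are compared for each `i`: a uniform hash followed by conditional
sampling, and a sequence from `V i` with its own hash. They have the same conditional law given the
hash, so their $\ell^1$ distance is that of the hash from uniformity. The distances add up over `i`
by `sum_abs_prod_sub_prod_le`. -/
theorem sum_condOn_le {N : ℕ} {B F : Fin N → Type*} [∀ i, Fintype (B i)] [∀ i, Fintype (F i)]
    [∀ i, Nonempty (F i)] {V : ∀ i, B i → ℝ} (hV : ∀ i, V i ∈ stdSimplex ℝ (B i))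
    (h : ∀ i, B i → F i) {g : (∀ i, B i) → (∀ i, F i) → ℝ} {C : ℝ} (hg0 : ∀ u f, 0 ≤ g u f)
    (hgC : ∀ u f, g u f ≤ C) :
    ∑ f : ∀ i, F i, (∏ i, unif (F i) (f i)) * ∑ u, (∏ i, condOn (V i) (h i) (f i) (u i)) * g u f ≤
      ∑ u, (∏ i, V i (u i)) * g u (fun i => h i (u i)) +
        C * ∑ i, ∑ y, |(Fintype.card (F i) : ℝ)⁻¹ - law (V i) (h i) y| := by
  set a : ∀ i, F i × B i → ℝ := fun i y =>
    unif (F i) y.1 * condOn (V i) (h i) y.1 y.2 with ha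
  set b : ∀ i, F i × B i → ℝ := fun i y =>
    V i y.2 * ind (h i y.2 = y.1) with hb
  have ha1 : ∀ i, a i ∈ stdSimplex ℝ (F i × B i) := fun i => by
    refine ⟨fun y => mul_nonneg ((unif_mem_stdSimplex _).1 _)
      ((condOn_mem_stdSimplex (hV i) _ _).1 _), ?_⟩
    rw [Fintype.sum_prod_type]
    simp_rw [ha, ← Finset.mul_sum, (condOn_mem_stdSimplex (hV i) _ _).2, mul_one]
    exact (unif_mem_stdSimplex _).2
  have hb1 : ∀ i, b i ∈ stdSimplex ℝ (F i × B i) := fun i => by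
    refine ⟨fun y => mul_nonneg ((hV i).1 _) (ind_nonneg _), ?_⟩
    rw [Fintype.sum_prod_type, Finset.sum_comm]
    simp_rw [hb, ← Finset.mul_sum, sum_ind_eq, mul_one]
    exact (hV i).2
  have hab : ∀ i, ∑ y, |a i y - b i y| =
      ∑ y, |(Fintype.card (F i) : ℝ)⁻¹ - law (V i) (h i) y| := by
    intro i
    rw [Fintype.sum_prod_type]
    refine Finset.sum_congr rfl fun y _ => ?_
    have : ∀ v, |a i (y, v) - b i (y, v)| =
        |(Fintype.card (F i) : ℝ)⁻¹ - law (V i) (h i) y| *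
          condOn (V i) (h i) y v := fun v => by
      simp only [ha, hb]
      rw [← law_mul_condOn (hV i), ← sub_mul, abs_mul,
        abs_of_nonneg ((condOn_mem_stdSimplex (hV i) (h i) y).1 v), unif]
    simp_rw [this, ← Finset.mul_sum, (condOn_mem_stdSimplex (hV i) _ _).2, mul_one]
  -- The bounds on `g` force $C\ge0$ only if some pair of arguments exists; the alternative
  -- contradicts the existence of the distributions.
  have hC : 0 ≤ C ∨ IsEmpty ((∀ i, F i) × ∀ i, B i) := by
    by_cases he : Nonempty ((∀ i, F i) × ∀ i, B i)
    · obtain ⟨y⟩ := he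
      exact Or.inl ((hg0 y.2 y.1).trans (hgC y.2 y.1))
    · exact Or.inr (not_nonempty_iff.1 he)
  set G : (∀ i, F i × B i) → ℝ := fun y => g (fun i => (y i).2) (fun i => (y i).1) with hG
  have e1 : ∑ f : ∀ i, F i, (∏ i, unif (F i) (f i)) *
      ∑ u, (∏ i, condOn (V i) (h i) (f i) (u i)) * g u f =
      ∑ y : ∀ i, F i × B i, (∏ i, a i (y i)) * G y := by
    rw [Fintype.sum_equiv (Equiv.arrowProdEquivProdArrow (Fin N) F B) (fun y => (∏ i, a i (y i)) * G y)
      (fun y => (∏ i, unif (F i) (y.1 i) * condOn (V i) (h i) (y.1 i) (y.2 i)) *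
        g y.2 y.1) (fun y => rfl), Fintype.sum_prod_type]
    refine Finset.sum_congr rfl fun f _ => ?_
    rw [Finset.mul_sum]
    exact Finset.sum_congr rfl fun u _ => by rw [Finset.prod_mul_distrib]; ring
  have e2 : ∑ u, (∏ i, V i (u i)) * g u (fun i => h i (u i)) =
      ∑ y : ∀ i, F i × B i, (∏ i, b i (y i)) * G y := by
    rw [Fintype.sum_equiv (Equiv.arrowProdEquivProdArrow (Fin N) F B) (fun y => (∏ i, b i (y i)) * G y)
      (fun y => (∏ i, V i (y.2 i) * ind (h i (y.2 i) = y.1 i)) *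
        g y.2 y.1) (fun y => rfl), Fintype.sum_prod_type, Finset.sum_comm]
    refine Finset.sum_congr rfl fun u _ => ?_
    have := sum_ind_eq_mul (fun i => h i (u i))
      fun f => (∏ i, V i (u i)) * g u f
    rw [← this]
    refine Finset.sum_congr rfl fun f _ => ?_
    rw [Finset.prod_mul_distrib, ← ind_forall, funext_iff]
    ring
  rw [e1, e2]
  have hdiff : ∑ y : ∀ i, F i × B i, (∏ i, a i (y i)) * G y ≤
      ∑ y : ∀ i, F i × B i, ((∏ i, b i (y i)) * G y +
        C * |∏ i, a i (y i) - ∏ i, b i (y i)|) := by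
    refine Finset.sum_le_sum fun y _ => ?_
    have h1 : (∏ i, a i (y i) - ∏ i, b i (y i)) * G y ≤
        C * |∏ i, a i (y i) - ∏ i, b i (y i)| := by
      rw [mul_comm C]
      exact (mul_le_mul_of_nonneg_right (le_abs_self _) (hg0 _ _)).trans
        (mul_le_mul_of_nonneg_left (hgC _ _) (abs_nonneg _))
    linarith
  refine hdiff.trans ?_
  rw [Finset.sum_add_distrib, ← Finset.mul_sum]
  refine add_le_add le_rfl ?_
  rcases hC with hC | hE
  · refine mul_le_mul_of_nonneg_left ?_ hC
    simp_rw [← hab]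
    exact sum_abs_prod_sub_prod_le ha1 hb1
  · have hN : ∀ i, F i × B i := fun i => by
      have h1 : (∑ y, b i y) ≠ 0 := by rw [(hb1 i).2]; exact one_ne_zero
      exact (Finset.exists_ne_zero_of_sum_ne_zero h1).choose
    exact (hE.false ((fun i => (hN i).1, fun i => (hN i).2))).elim

/-- Deterministic selections achieve, for some prescribed value of the hashes, the ideal cost up to
the deviation of the hashes from uniformity. -/
theorem exists_selection {N : ℕ} {S : Type*} [Fintype S] {A B F : Fin N → Type*}
    [∀ i, Fintype (A i)] [∀ i, Fintype (B i)] [∀ i, Fintype (F i)] [∀ i, Nonempty (F i)]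
    [∀ i, DecidableEq (A i)]
    {q : S → ℝ} (hq : ∀ s, 0 ≤ q s) (ξ : S → ∀ i, A i) {V : ∀ i, A i → B i → ℝ}
    (hV : ∀ i a, V i a ∈ stdSimplex ℝ (B i)) (h : ∀ i, B i → F i)
    {g : S → (∀ i, B i) → (∀ i, F i) → ℝ} {C : ℝ} (hg0 : ∀ s u f, 0 ≤ g s u f)
    (hgC : ∀ s u f, g s u f ≤ C) :
    ∃ (f : ∀ i, F i) (φ : ∀ i, A i → B i),
      ∑ s, q s * g s (fun i => φ i (ξ s i)) f ≤
        ∑ s, q s * ∑ u, (∏ i, V i (ξ s i) (u i)) * g s u (fun i => h i (u i)) +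
          C * ∑ i, ∑ s, q s * ∑ y, |(Fintype.card (F i) : ℝ)⁻¹ - law (V i (ξ s i)) (h i) y| := by
  set rhs := ∑ s, q s * ∑ u, (∏ i, V i (ξ s i) (u i)) * g s u (fun i => h i (u i)) +
    C * ∑ i, ∑ s, q s * ∑ y, |(Fintype.card (F i) : ℝ)⁻¹ - law (V i (ξ s i)) (h i) y| with hrhs
  have hf : ∃ f : ∀ i, F i, ∑ s, q s * ∑ u, (∏ i, condOn (V i (ξ s i)) (h i) (f i) (u i)) *
      g s u f ≤ rhs := by
    refine exists_le_of_sum_le (prod_mem_stdSimplex fun i => unif_mem_stdSimplex (F i)) ?_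
    have hs : ∀ s, ∑ f : ∀ i, F i, (∏ i, unif (F i) (f i)) *
        ∑ u, (∏ i, condOn (V i (ξ s i)) (h i) (f i) (u i)) * g s u f ≤
        ∑ u, (∏ i, V i (ξ s i) (u i)) * g s u (fun i => h i (u i)) +
          C * ∑ i, ∑ y, |(Fintype.card (F i) : ℝ)⁻¹ - law (V i (ξ s i)) (h i) y| :=
      fun s => sum_condOn_le (fun i => hV i _) h (hg0 s) (hgC s)
    have e3 : ∑ f : ∀ i, F i, (∏ i, unif (F i) (f i)) *
        ∑ s, q s * ∑ u, (∏ i, condOn (V i (ξ s i)) (h i) (f i) (u i)) * g s u f =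
        ∑ s, q s * ∑ f : ∀ i, F i, (∏ i, unif (F i) (f i)) *
          ∑ u, (∏ i, condOn (V i (ξ s i)) (h i) (f i) (u i)) * g s u f := by
      simp_rw [Finset.mul_sum (s := (Finset.univ : Finset S))]
      rw [Finset.sum_comm]
      refine Finset.sum_congr rfl fun s _ => ?_
      rw [Finset.mul_sum]
      exact Finset.sum_congr rfl fun f _ => by ring
    rw [e3]
    refine (Finset.sum_le_sum fun s _ => mul_le_mul_of_nonneg_left (hs s) (hq s)).trans
      (le_of_eq ?_)
    rw [hrhs, Finset.mul_sum _ _ C, Finset.sum_congr rfl fun i _ => Finset.mul_sum _ _ C,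
      Finset.sum_comm, ← Finset.sum_add_distrib]
    refine Finset.sum_congr rfl fun s _ => ?_
    rw [mul_add, ← Finset.mul_sum, ← Finset.mul_sum]
    ring
  obtain ⟨f, hf⟩ := hf
  refine ⟨f, ?_⟩
  -- The encoders are a table with independent entries for all pairs `(i, a)`. For a fixed `s` only
  -- the entries `(i, ξ s i)` are read; their indices are distinct, so they are independent as
  -- required, although each encoder depends on its own source alone.
  have hφ : ∃ φ : ∀ j : (i : Fin N) × A i, B j.1,
      ∑ s, q s * g s (fun i => φ ⟨i, ξ s i⟩) f ≤ rhs := by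
    refine exists_le_of_sum_le (w := fun φ : ∀ j : (i : Fin N) × A i, B j.1 =>
      ∏ j, condOn (V j.1 j.2) (h j.1) (f j.1) (φ j))
      (prod_mem_stdSimplex fun j => condOn_mem_stdSimplex (hV j.1 j.2) _ _) ?_
    refine le_trans (le_of_eq ?_) hf
    simp_rw [Finset.mul_sum (s := (Finset.univ : Finset S))]
    rw [Finset.sum_comm]
    refine Finset.sum_congr rfl fun s _ => ?_
    have := sum_pi_restrict (w := fun j : (i : Fin N) × A i => condOn (V j.1 j.2) (h j.1) (f j.1))
      (fun j => condOn_mem_stdSimplex (hV j.1 j.2) _ _)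
      (e := fun i => ⟨i, ξ s i⟩) (fun i i' hii => congrArg Sigma.fst hii) fun u => g s u f
    rw [← this, Finset.mul_sum]
    exact Finset.sum_congr rfl fun φ _ => by ring
  obtain ⟨φ, hφ⟩ := hφ
  exact ⟨fun i a => φ ⟨i, a⟩, hφ⟩

end Selection

/-! ### Sources with independent auxiliary channels -/

section TestChannel

variable {N M : ℕ} {𝒳 : Fin N → Type*} {𝒰 : Fin N → Packet M → Type*}
  [∀ i, Fintype (𝒳 i)] [∀ i K, Fintype (𝒰 i K)]

/-- The joint distribution of sources and auxiliary variables, when `{U_i}` is the output of a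
channel with input `X_i`, independently for all `i`. -/
def channelJoint (PX : (∀ i, 𝒳 i) → ℝ) (W : ∀ i, 𝒳 i → (∀ K, 𝒰 i K) → ℝ) (ω : Joint 𝒳 𝒰) : ℝ :=
  PX ω.1 * ∏ i, W i (ω.1 i) (ω.2 i)

variable {PX : (∀ i, 𝒳 i) → ℝ} {W : ∀ i, 𝒳 i → (∀ K, 𝒰 i K) → ℝ}

theorem channelJoint_mem_stdSimplex (hPX : PX ∈ stdSimplex ℝ (∀ i, 𝒳 i))
    (hW : ∀ i x, W i x ∈ stdSimplex ℝ (∀ K, 𝒰 i K)) :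
    channelJoint PX W ∈ stdSimplex ℝ (Joint 𝒳 𝒰) := by
  refine ⟨fun ω => mul_nonneg (hPX.1 _) (Finset.prod_nonneg fun i _ => (hW i _).1 _), ?_⟩
  rw [Fintype.sum_prod_type]
  simp_rw [channelJoint, ← Finset.mul_sum,
    fun x : ∀ i, 𝒳 i => (prod_mem_stdSimplex fun i => hW i (x i)).2, mul_one, hPX.2]

theorem law_channelJoint_local (hW : ∀ i x, W i x ∈ stdSimplex ℝ (∀ K, 𝒰 i K)) (i : Fin N)
    (x : 𝒳 i) (u : ∀ K, 𝒰 i K) :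
    law (channelJoint PX W) (fun ω => (ω.1 i, ω.2 i)) (x, u) =
      law PX (fun x => x i) x * W i x u := by
  rw [law_eq, law_eq, Fintype.sum_prod_type, Finset.sum_mul]
  refine Finset.sum_congr rfl fun y _ => ?_
  simp_rw [channelJoint, Prod.mk.injEq, ind_and, mul_assoc, ← Finset.mul_sum]
  congr 1
  have := sum_pi_apply (fun i => hW i (y i)) i fun v => ind (y i = x) * ind (v = u)
  rw [this]
  by_cases h : y i = x
  · subst h
    simp_rw [ind_of, one_mul, eq_comm (b := u), mul_comm _ (ind _)]
    rw [sum_ind_eq_mul]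
  · simp [ind_of_not h]

theorem law_channelJoint_global {α : Fin N → Type*} (A : ∀ i, (∀ K, 𝒰 i K) → α i)
    (x : ∀ i, 𝒳 i) (a : ∀ i, α i) :
    law (channelJoint PX W) (fun ω => (ω.1, fun i => A i (ω.2 i))) (x, a) =
      PX x * ∏ i, law (W i (x i)) (A i) (a i) := by
  rw [law_eq, Fintype.sum_prod_type]
  have := sum_ind_eq_mul x fun y => PX y * ∏ i, law (W i (y i)) (A i) (a i)
  rw [← this]
  refine Finset.sum_congr rfl fun y _ => ?_
  simp_rw [law_eq]
  rw [← sum_pi_prod fun i u => W i (y i) u * ind (A i u = a i), ← mul_assoc, Finset.mul_sum]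
  refine Finset.sum_congr rfl fun u _ => ?_
  have h : ind ((fun i => A i (u i)) = a) = ∏ i, ind (A i (u i) = a i) := by
    rw [← ind_forall, funext_iff]
  rw [Prod.mk.injEq, ind_and, eq_comm (a := y), h, Finset.prod_mul_distrib, channelJoint]
  ring

theorem sum_iid_channelJoint (n : ℕ) (g : (Fin n → ∀ i, 𝒳 i) → (∀ i, Fin n → ∀ K, 𝒰 i K) → ℝ) :
    ∑ ω, iid (channelJoint PX W) n ω * g (fun t => (ω t).1) (fun i t => (ω t).2 i) =
      ∑ x, iid PX n x * ∑ u : ∀ i, Fin n → ∀ K, 𝒰 i K,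
        (∏ i, ∏ t, W i (x t i) (u i t)) * g x u := by
  rw [Fintype.sum_equiv (Equiv.arrowProdEquivProdArrow (Fin n) (fun _ => ∀ i, 𝒳 i)
      (fun _ => ∀ i K, 𝒰 i K)) _
      (fun y => iid PX n y.1 * (∏ t, ∏ i, W i (y.1 t i) (y.2 t i)) * g y.1 fun i t => y.2 t i),
    Fintype.sum_prod_type]
  · refine Finset.sum_congr rfl fun x _ => ?_
    rw [Finset.mul_sum]
    refine Fintype.sum_equiv (Equiv.piComm fun _ i => ∀ K, 𝒰 i K) _ _ fun u => ?_
    rw [Finset.prod_comm, mul_assoc]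
    rfl
  · intro ω
    simp only [iid, channelJoint, Equiv.arrowProdEquivProdArrow_apply, Finset.prod_mul_distrib]

end TestChannel

end DIR
end

noncomputable section
namespace DIR

/-! ### Random hashes of auxiliary and source sequences, and their collision probabilities -/

section Hashes

variable {N M : ℕ} {𝒳 : Fin N → Type*} {𝒰 : Fin N → Packet M → Type*}

theorem mem_meeting_singleton {k : Fin M} {K : Packet M} : K ∈ meeting {k} ↔ k ∈ K.1 := by
  simp [meeting, Finset.card_pos, Finset.Nonempty]

/-- The values of the auxiliary variables of one source for all supersets of `K`. -/
abbrev Prefix (𝒱 : Packet M → Type*) (K : Packet M) : Type _ :=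
  ∀ K' : {K' : Packet M // K.1 ⊆ K'.1}, 𝒱 K'.1

/-- Restriction to the supersets of `K`. -/
def prefixOf {𝒱 : Packet M → Type*} (K : Packet M) (u : ∀ K, 𝒱 K) : Prefix 𝒱 K :=
  fun K' => u K'.1

/-- The values of the auxiliary variables available at sink `k`. -/
abbrev AuxAt (𝒰 : Fin N → Packet M → Type*) (k : Fin M) : Type _ :=
  ∀ i, ∀ K : {K : Packet M // K ∈ meeting {k}}, 𝒰 i K.1

/-- Restriction of the auxiliary variables available at sink `k`. -/
def prefixAt {k : Fin M} (z : AuxAt 𝒰 k) (i : Fin N) (K : {K : Packet M // K ∈ meeting {k}}) :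
    Prefix (𝒰 i) K.1 :=
  fun K' => z i ⟨K'.1, mem_meeting_singleton.2 (K'.2 (mem_meeting_singleton.1 K.2))⟩

/-- Families of hash functions for the auxiliary sequences. -/
abbrev AuxHash (𝒰 : Fin N → Packet M → Type*) (n : ℕ) (m : Fin N → Packet M → ℕ) : Type _ :=
  ∀ s : Fin N × Packet M, (Fin n → Prefix (𝒰 s.1) s.2) → Fin (m s.1 s.2)

/-- Families of hash functions for the source sequences. -/
abbrev SrcHash (𝒳 : Fin N → Type*) (n : ℕ) (m : Fin N → Packet M → ℕ) : Type _ :=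
  ∀ s : Fin N × Packet M, (Fin n → 𝒳 s.1) → Fin (m s.1 s.2)

/-- All hashes of the auxiliary sequence of source `i`. -/
def AuxHash.ofSource {n : ℕ} {m : Fin N → Packet M → ℕ} (h : AuxHash 𝒰 n m) (i : Fin N)
    (u : Fin n → ∀ K, 𝒰 i K) (K : Packet M) : Fin (m i K) :=
  h (i, K) fun t => prefixOf K (u t)

/-- All hashes available at sink `k`. -/
def AuxHash.atSink {n : ℕ} {m : Fin N → Packet M → ℕ} (h : AuxHash 𝒰 n m) (k : Fin M)
    (z : Fin n → AuxAt 𝒰 k) (s : Fin N × {K : Packet M // K ∈ meeting {k}}) :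
    Fin (m s.1 s.2.1) :=
  h (s.1, s.2.1) fun t => prefixAt (z t) s.1 s.2

/-- All hashes of requested sources that are available at sink `k`, and the auxiliary sequences. -/
def SrcHash.atSink {n : ℕ} {m : Fin N → Packet M → ℕ} (h : SrcHash 𝒳 n m) (E : Finset (Fin N))
    (k : Fin M) (z : Fin n → (∀ i : {i // i ∈ E}, 𝒳 i.1) × AuxAt 𝒰 k) :
    (∀ s : {i // i ∈ E} × {K : Packet M // K ∈ meeting {k}}, Fin (m s.1.1 s.2.1)) ×
      (Fin n → AuxAt 𝒰 k) :=
  (fun s => h (s.1.1, s.2.1) fun t => (z t).1 s.1, fun t => (z t).2)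

theorem prod_inv_rpow_ind_le {S : Type*} [Fintype S] {m ρ : S → ℝ} {n : ℕ}
    (h : ∀ s, (2 : ℝ) ^ (n * ρ s) ≤ m s) (c : S → Prop) :
    ∏ s, (m s)⁻¹ ^ ind (c s) ≤ (2 : ℝ) ^ (-(n * ∑ s, ρ s * ind (c s))) := by
  have : -(n * ∑ s, ρ s * ind (c s)) = ∑ s, -(n * (ρ s * ind (c s))) := by
    rw [Finset.mul_sum, Finset.sum_neg_distrib]
  rw [this, Real.rpow_sum_of_pos two_pos]
  have hm : ∀ s, 0 < m s := fun s => (Real.rpow_pos_of_pos two_pos _).trans_le (h s)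
  refine Finset.prod_le_prod (fun s _ => Real.rpow_nonneg (inv_nonneg.2 (hm s).le) _)
    fun s _ => ?_
  by_cases hc : c s
  · rw [ind_of hc, Real.rpow_one, mul_one, Real.rpow_neg zero_le_two]
    exact inv_anti₀ (Real.rpow_pos_of_pos two_pos _) (h s)
  · rw [ind_of_not hc]; simp

theorem sum_attach_mul_ind {α : Type*} [DecidableEq α] (s : Finset α) (f : α → ℝ) (Q : Finset α) :
    ∑ K : {K // K ∈ s}, f K.1 * ind (K.1 ∉ Q) = ∑ K ∈ s \ Q, f K := by
  rw [Finset.sum_coe_sort s fun K => f K * ind (K ∉ Q), Finset.sdiff_eq_filter, Finset.sum_filter]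
  refine Finset.sum_congr rfl fun K _ => ?_
  by_cases h : K ∈ Q <;> simp [ind, h]

variable [∀ i, Fintype (𝒳 i)] [∀ i K, Fintype (𝒰 i K)] [∀ i, DecidableEq (𝒳 i)]
  [∀ i K, DecidableEq (𝒰 i K)]

/-- The uniform distribution on families of functions. -/
def famUnif {T : Type*} [Fintype T] {A ℋ : T → Type*} [∀ t, Fintype (A t)] [∀ t, Fintype (ℋ t)]
    [∀ t, DecidableEq (A t)] (h : ∀ t, A t → ℋ t) : ℝ := ∏ t, unif (A t → ℋ t) (h t)

theorem famUnif_mem_stdSimplex {T : Type*} [Fintype T] [DecidableEq T] {A ℋ : T → Type*}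
    [∀ t, Fintype (A t)] [∀ t, Fintype (ℋ t)] [∀ t, DecidableEq (A t)] [∀ t, Nonempty (ℋ t)] :
    (famUnif : (∀ t, A t → ℋ t) → ℝ) ∈ stdSimplex ℝ (∀ t, A t → ℋ t) :=
  prod_mem_stdSimplex fun t => unif_mem_stdSimplex (A t → ℋ t)

theorem mul_mem_stdSimplex {R R' : Type*} [Fintype R] [Fintype R'] {w : R → ℝ} {w' : R' → ℝ}
    (hw : w ∈ stdSimplex ℝ R) (hw' : w' ∈ stdSimplex ℝ R') :
    (fun r : R × R' => w r.1 * w' r.2) ∈ stdSimplex ℝ (R × R') :=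
  ⟨fun r => mul_nonneg (hw.1 _) (hw'.1 _), by
    rw [Fintype.sum_prod_type]; simp_rw [← Finset.mul_sum, hw'.2, mul_one, hw.2]⟩

/-- Hashes with index in `Q i` have equal arguments and collide for sure; each of the others
collides independently with probability at most $2^{-n\rho}$. -/
theorem sum_auxHash_collision {n : ℕ} {m : Fin N → Packet M → ℕ} {ρ : Fin N → Packet M → ℝ}
    (hm : ∀ i K, 0 < m i K) (hρ : ∀ i K, (2 : ℝ) ^ (n * ρ i K) ≤ m i K) (k : Fin M)
    (z z' : Fin n → AuxAt 𝒰 k) (Q : Fin N → Finset (Packet M))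
    (hQ : ∀ i (K : {K : Packet M // K ∈ meeting {k}}), K.1 ∈ Q i ↔
      (fun t => prefixAt (z' t) i K) = fun t => prefixAt (z t) i K) :
    ∑ h : AuxHash 𝒰 n m, famUnif h * ind (h.atSink k z' = h.atSink k z) ≤
      (2 : ℝ) ^ (-(n * ∑ i, ∑ K ∈ meeting {k} \ Q i, ρ i K)) := by
  have : ∀ s : Fin N × Packet M, Nonempty (Fin (m s.1 s.2)) := fun s => ⟨⟨0, hm _ _⟩⟩
  have hinj : Function.Injective
      fun s : Fin N × {K : Packet M // K ∈ meeting {k}} => (s.1, s.2.1) := by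
    rintro ⟨i, K⟩ ⟨i', K'⟩ h
    simp only [Prod.mk.injEq] at h
    exact Prod.ext h.1 (Subtype.ext h.2)
  have := sum_unif_collision_family (A := fun s : Fin N × Packet M => Fin n → Prefix (𝒰 s.1) s.2)
    (ℋ := fun s => Fin (m s.1 s.2)) hinj
    (fun s t => prefixAt (z' t) s.1 s.2) (fun s t => prefixAt (z t) s.1 s.2)
  have e : ∀ h : AuxHash 𝒰 n m, ind (h.atSink k z' = h.atSink k z) =
      ind (∀ s : Fin N × {K : Packet M // K ∈ meeting {k}},
        h (s.1, s.2.1) (fun t => prefixAt (z' t) s.1 s.2) =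
          h (s.1, s.2.1) fun t => prefixAt (z t) s.1 s.2) := fun h => by
    rw [funext_iff]; rfl
  simp_rw [e, famUnif]
  rw [this]
  simp only [Fintype.card_fin]
  refine (prod_inv_rpow_ind_le
    (m := fun s : Fin N × {K : Packet M // K ∈ meeting {k}} => (m s.1 s.2.1 : ℝ))
    (ρ := fun s => ρ s.1 s.2.1) (fun s => hρ s.1 s.2.1) _).trans (le_of_eq ?_)
  rw [Fintype.sum_prod_type]
  congr 3
  refine Finset.sum_congr rfl fun i _ => ?_
  rw [← sum_attach_mul_ind]
  refine Finset.sum_congr rfl fun K _ => ?_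
  simp only [ne_eq, hQ]

-- `SrcHash.atSink` carries the auxiliary sequences along unhashed, so a collision forces them to
-- agree. Only the sources in `Γ`, which differ, contribute to the exponent.
omit [∀ i K, Fintype (𝒰 i K)] [∀ i K, DecidableEq (𝒰 i K)] in
theorem sum_srcHash_collision {n : ℕ} {m : Fin N → Packet M → ℕ} {ρ : Fin N → Packet M → ℝ}
    (hm : ∀ i K, 0 < m i K) (hρ : ∀ i K, (2 : ℝ) ^ (n * ρ i K) ≤ m i K) (E : Finset (Fin N))
    (k : Fin M) (z z' : Fin n → (∀ i : {i // i ∈ E}, 𝒳 i.1) × AuxAt 𝒰 k) (Γ : Finset (Fin N))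
    (hΓE : Γ ⊆ E)
    (hΓ : ∀ i : {i // i ∈ E}, i.1 ∈ Γ ↔ ¬(fun t => (z' t).1 i) = fun t => (z t).1 i) :
    ∑ h : SrcHash 𝒳 n m, famUnif h * ind (h.atSink E k z' = h.atSink E k z) ≤
      ind ((fun t => (z' t).2) = fun t => (z t).2) *
        (2 : ℝ) ^ (-(n * ∑ i ∈ Γ, ∑ K ∈ meeting {k}, ρ i K)) := by
  have : ∀ s : Fin N × Packet M, Nonempty (Fin (m s.1 s.2)) := fun s => ⟨⟨0, hm _ _⟩⟩
  have hinj : Function.Injective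
      fun s : {i // i ∈ E} × {K : Packet M // K ∈ meeting {k}} => (s.1.1, s.2.1) := by
    rintro ⟨i, K⟩ ⟨i', K'⟩ h
    simp only [Prod.mk.injEq] at h
    exact Prod.ext (Subtype.ext h.1) (Subtype.ext h.2)
  have := sum_unif_collision_family (A := fun s : Fin N × Packet M => Fin n → 𝒳 s.1)
    (ℋ := fun s => Fin (m s.1 s.2)) hinj
    (fun s t => (z' t).1 s.1) (fun s t => (z t).1 s.1)
  have e : ∀ h : SrcHash 𝒳 n m, ind (h.atSink E k z' = h.atSink E k z) =
      ind (∀ s : {i // i ∈ E} × {K : Packet M // K ∈ meeting {k}},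
        h (s.1.1, s.2.1) (fun t => (z' t).1 s.1) = h (s.1.1, s.2.1) fun t => (z t).1 s.1) *
      ind ((fun t => (z' t).2) = fun t => (z t).2) := fun h => by
    rw [← ind_and, SrcHash.atSink, SrcHash.atSink, Prod.mk.injEq, funext_iff]
  simp_rw [e, famUnif, ← mul_assoc]
  rw [← Finset.sum_mul, mul_comm]
  refine mul_le_mul_of_nonneg_left ?_ (ind_nonneg _)
  rw [this]
  simp only [Fintype.card_fin]
  refine (prod_inv_rpow_ind_le
    (m := fun s : {i // i ∈ E} × {K : Packet M // K ∈ meeting {k}} => (m s.1.1 s.2.1 : ℝ))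
    (ρ := fun s => ρ s.1.1 s.2.1) (fun s => hρ s.1.1 s.2.1) _).trans (le_of_eq ?_)
  rw [Fintype.sum_prod_type]
  congr 3
  have h1 : ∀ i : {i // i ∈ E}, ∑ K : {K : Packet M // K ∈ meeting {k}}, ρ i.1 K.1 *
      ind ((fun t => (z' t).1 i) ≠ fun t => (z t).1 i) =
      (∑ K ∈ meeting {k}, ρ i.1 K) * ind (i.1 ∉ E \ Γ) := fun i => by
    rw [← Finset.sum_mul, Finset.sum_coe_sort (meeting {k}) fun K => ρ i.1 K]
    congr 2
    rw [Finset.mem_sdiff, not_and_not_right, hΓ i, eq_iff_iff]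
    exact ⟨fun h _ => h, fun h => h i.2⟩
  simp_rw [h1]
  rw [sum_attach_mul_ind E fun i => ∑ K ∈ meeting {k}, ρ i K, Finset.sdiff_sdiff_eq_self hΓE]

/-- A hash with different arguments contributes $m\cdot m^{-1}=1$; one with equal arguments
contributes its full size $m\le2^{n\rho}$. -/
theorem card_mul_sum_auxHash_collision {n : ℕ} {m : Fin N → Packet M → ℕ}
    {ρ : Fin N → Packet M → ℝ} (hm : ∀ i K, 0 < m i K)
    (hρ : ∀ i K, (m i K : ℝ) ≤ (2 : ℝ) ^ (n * ρ i K)) (i : Fin N) (v v' : Fin n → ∀ K, 𝒰 i K)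
    (Q : Finset (Packet M))
    (hQ : ∀ K, K ∈ Q ↔ (fun t => prefixOf K (v t)) = fun t => prefixOf K (v' t)) :
    (Fintype.card (∀ K, Fin (m i K)) : ℝ) *
      ∑ h : AuxHash 𝒰 n m, famUnif h * ind (h.ofSource i v = h.ofSource i v') ≤
        (2 : ℝ) ^ (n * ∑ K ∈ Q, ρ i K) := by
  have : ∀ s : Fin N × Packet M, Nonempty (Fin (m s.1 s.2)) := fun s => ⟨⟨0, hm _ _⟩⟩
  have hinj : Function.Injective fun K : Packet M => (i, K) := fun K K' h => congrArg Prod.snd h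
  have := sum_unif_collision_family (A := fun s : Fin N × Packet M => Fin n → Prefix (𝒰 s.1) s.2)
    (ℋ := fun s => Fin (m s.1 s.2)) hinj
    (fun K t => prefixOf K (v t)) (fun K t => prefixOf K (v' t))
  simp only [famUnif, funext_iff (f := AuxHash.ofSource _ _ _)]
  simp only [AuxHash.ofSource]
  rw [this]
  simp only [Fintype.card_fin, Fintype.card_pi, Nat.cast_prod]
  rw [← Finset.prod_mul_distrib, Finset.mul_sum, Real.rpow_sum_of_pos two_pos,
    ← Finset.prod_subset (Finset.subset_univ Q)]
  · refine Finset.prod_le_prod (fun K _ => by positivity) fun K hK => ?_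
    rw [ind_of_not (not_not.2 ((hQ K).1 hK)), Real.rpow_zero, mul_one]
    exact hρ i K
  · intro K _ hK
    rw [ind_of fun h => hK ((hQ K).2 h), Real.rpow_one]
    exact mul_inv_cancel₀ (Nat.cast_ne_zero.2 (hm i K).ne')

end Hashes

end DIR
end

noncomputable section
namespace DIR

/-! ### Decoding at the sinks and uniformity of the hashes, in terms of the rates -/

section Errors

set_option synthInstance.maxSize 1000

variable {N M : ℕ} {𝒳 : Fin N → Type*} {𝒰 : Fin N → Packet M → Type*}
  [∀ i, Fintype (𝒳 i)] [∀ i K, Fintype (𝒰 i K)] [∀ i, DecidableEq (𝒳 i)]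
  [∀ i K, DecidableEq (𝒰 i K)]

omit [∀ i, DecidableEq (𝒳 i)] in
/-- Decoding of the auxiliary sequences available at a sink. -/
theorem exists_auxTypical {p : Joint 𝒳 𝒰 → ℝ} (hp : p ∈ stdSimplex ℝ (Joint 𝒳 𝒰)) (k : Fin M)
    {ρ R₂ : Fin N → Packet M → ℝ}
    (hrate : ∀ Q : Fin N → Finset (Packet M), (∀ i, Q i ⊆ meeting {k}) →
      (∀ i, IsUpClosed (Q i)) → (∃ i, Q i ≠ meeting {k}) →
      condEntropy p (UsAll fun i => meeting {k} \ Q i) (UsAll Q) <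
        ∑ i, ∑ K ∈ meeting {k} \ Q i, (ρ i K + R₂ i K))
    {ε : ℝ} (hε : 0 < ε) :
    ∃ (typ : ∀ n, Set (Fin n → AuxAt 𝒰 k)) (n₀ : ℕ), ∀ n, n₀ ≤ n →
      ∀ m m' : Fin N → Packet M → ℕ, (∀ i K, 0 < m i K) → (∀ i K, 0 < m' i K) →
        (∀ i K, (2 : ℝ) ^ (n * ρ i K) ≤ m i K) → (∀ i K, (2 : ℝ) ^ (n * R₂ i K) ≤ m' i K) →
        ∑ r : AuxHash 𝒰 n m × AuxHash 𝒰 n m', famUnif r.1 * famUnif r.2 *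
          ∑ ω, iid p n ω * ind (Confused (typ n) (fun z => (r.1.atSink k z, r.2.atSink k z))
            fun t => UsAll (fun _ => meeting {k}) (ω t)) ≤ ε := by
  classical
  let ℰ : Type := {Q : Fin N → Finset (Packet M) // (∀ i, Q i ⊆ meeting {k}) ∧
    (∀ i, IsUpClosed (Q i)) ∧ ∃ i, Q i ≠ meeting {k}}
  let _ : Fintype ℰ := Fintype.ofFinite _
  obtain ⟨typ, n₀, h⟩ := slepian_wolf hp
    (fun ω => (UsAll (fun _ => meeting {k}) ω : AuxAt 𝒰 k))
    (α := fun Q : ℰ => ∀ i, ∀ K : {K // K ∈ meeting {k} \ Q.1 i}, 𝒰 i K.1)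
    (β := fun Q : ℰ => ∀ i, ∀ K : {K // K ∈ Q.1 i}, 𝒰 i K.1)
    (fun _ z i K => z i ⟨K.1, (Finset.mem_sdiff.1 K.2).1⟩)
    (fun Q z i K => z i ⟨K.1, Q.2.1 i K.2⟩)
    (by
      intro Q z z' ha hb
      funext i K
      by_cases hK : K.1 ∈ Q.1 i
      · exact congrFun (congrFun hb i) ⟨K.1, hK⟩
      · exact congrFun (congrFun ha i) ⟨K.1, Finset.mem_sdiff.2 ⟨K.2, hK⟩⟩)
    (fun Q => ∑ i, ∑ K ∈ meeting {k} \ Q.1 i, (ρ i K + R₂ i K))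
    (fun Q => hrate Q.1 Q.2.1 Q.2.2.1 Q.2.2.2) hε
  refine ⟨typ, n₀, fun n hn m m' hm hm' hρ hR => ?_⟩
  have : ∀ s : Fin N × Packet M, Nonempty (Fin (m s.1 s.2)) := fun s => ⟨⟨0, hm _ _⟩⟩
  have : ∀ s : Fin N × Packet M, Nonempty (Fin (m' s.1 s.2)) := fun s => ⟨⟨0, hm' _ _⟩⟩
  refine h n hn (R := AuxHash 𝒰 n m × AuxHash 𝒰 n m') (fun r => famUnif r.1 * famUnif r.2)
    (mul_mem_stdSimplex famUnif_mem_stdSimplex famUnif_mem_stdSimplex)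
    (fun r z => (r.1.atSink k z, r.2.atSink k z)) fun z z' hz => ?_
  -- The error pattern: the indices whose whole prefix, not only the component itself, is the same
  -- for `z` and `z'`.
  let Q : Fin N → Finset (Packet M) := fun i => Finset.univ.filter fun K =>
    ∃ hK : K ∈ meeting {k}, (fun t => prefixAt (z' t) i ⟨K, hK⟩) = fun t => prefixAt (z t) i ⟨K, hK⟩
  have hQ : ∀ i (K : {K : Packet M // K ∈ meeting {k}}), K.1 ∈ Q i ↔
      (fun t => prefixAt (z' t) i K) = fun t => prefixAt (z t) i K := fun i K => by
    simp only [Q, Finset.mem_filter, Finset.mem_univ, true_and]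
    exact ⟨fun h => h.2, fun h => ⟨K.2, h⟩⟩
  have hQsub : ∀ i, Q i ⊆ meeting {k} := fun i K hK => (Finset.mem_filter.1 hK).2.1
  have hval : ∀ i K (hK : K ∈ Q i) t, z' t i ⟨K, hQsub i hK⟩ = z t i ⟨K, hQsub i hK⟩ :=
    fun i K hK t => congrFun (congrFun ((hQ i ⟨K, hQsub i hK⟩).1 hK) t) ⟨K, Finset.Subset.refl _⟩
  -- The prefix at a superset of `K` is part of the prefix at `K`.
  have hup : ∀ i, IsUpClosed (Q i) := by
    intro i K hK K' hK'
    have hsub : K.1 ⊆ K'.1 := (Finset.mem_filter.1 hK').2.2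
    have hk : K' ∈ meeting {k} :=
      mem_meeting_singleton.2 (hsub (mem_meeting_singleton.1 (hQsub i hK)))
    refine (hQ i ⟨K', hk⟩).2 (funext fun t => funext fun K'' => ?_)
    exact congrFun (congrFun ((hQ i ⟨K, hQsub i hK⟩).1 hK) t) ⟨K''.1, hsub.trans K''.2⟩
  have hne : ∃ i, Q i ≠ meeting {k} := by
    by_contra! hall
    refine hz (funext fun t => funext fun i => funext fun K => ?_)
    exact hval i K.1 (by rw [hall i]; exact K.2) t
  refine le_trans ?_ (Finset.single_le_sum (f := fun e : ℰ => _)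
    (fun e _ => mul_nonneg (ind_nonneg _) (by positivity))
    (Finset.mem_univ (⟨Q, hQsub, hup, hne⟩ : ℰ)))
  rw [ind_of fun t => funext fun i => funext fun K => hval i K.1 K.2 t, one_mul]
  -- The prescribed and the transmitted hashes are independent families, so their collision
  -- probabilities multiply and their rates add.
  have e : ∑ r : AuxHash 𝒰 n m × AuxHash 𝒰 n m', famUnif r.1 * famUnif r.2 *
      ind ((r.1.atSink k z', r.2.atSink k z') = (r.1.atSink k z, r.2.atSink k z)) =
      (∑ h : AuxHash 𝒰 n m, famUnif h * ind (h.atSink k z' = h.atSink k z)) *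
        ∑ h : AuxHash 𝒰 n m', famUnif h * ind (h.atSink k z' = h.atSink k z) := by
    rw [Finset.sum_mul_sum, Fintype.sum_prod_type]
    refine Finset.sum_congr rfl fun r _ => Finset.sum_congr rfl fun r' _ => ?_
    rw [Prod.mk.injEq, ind_and]
    ring
  rw [e]
  calc _ ≤ (2 : ℝ) ^ (-(n * ∑ i, ∑ K ∈ meeting {k} \ Q i, ρ i K)) *
        (2 : ℝ) ^ (-(n * ∑ i, ∑ K ∈ meeting {k} \ Q i, R₂ i K)) :=
        mul_le_mul (sum_auxHash_collision hm hρ k z z' Q hQ)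
          (sum_auxHash_collision hm' hR k z z' Q hQ)
          (Finset.sum_nonneg fun r _ => mul_nonneg (famUnif_mem_stdSimplex.1 r) (ind_nonneg _))
          (by positivity)
    _ = _ := by
        rw [← Real.rpow_add two_pos]
        simp_rw [Finset.sum_add_distrib]
        congr 1
        ring

/-- Decoding of the requested sources at a sink that knows the auxiliary sequences. -/
theorem exists_srcTypical {p : Joint 𝒳 𝒰 → ℝ} (hp : p ∈ stdSimplex ℝ (Joint 𝒳 𝒰))
    (D : Fin M → Finset (Fin N)) (k : Fin M) {R₃ : Fin N → Packet M → ℝ}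
    (hrate : ∀ Γ, Γ ⊆ D k → Γ.Nonempty →
      gamma p D k Γ < ∑ i ∈ Γ, ∑ K ∈ meeting {k}, R₃ i K)
    {ε : ℝ} (hε : 0 < ε) :
    ∃ (typ : ∀ n, Set (Fin n → (∀ i : {i // i ∈ D k}, 𝒳 i.1) × AuxAt 𝒰 k)) (n₀ : ℕ),
      ∀ n, n₀ ≤ n → ∀ m : Fin N → Packet M → ℕ, (∀ i K, 0 < m i K) →
        (∀ i K, (2 : ℝ) ^ (n * R₃ i K) ≤ m i K) →
        ∑ r : SrcHash 𝒳 n m, famUnif r *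
          ∑ ω, iid p n ω * ind (Confused (typ n) (r.atSink (D k) k)
            fun t => (Xs (D k) (ω t), UsAll (fun _ => meeting {k}) (ω t))) ≤ ε := by
  classical
  let ℰ : Type := {Γ : Finset (Fin N) // Γ ⊆ D k ∧ Γ.Nonempty}
  let _ : Fintype ℰ := Fintype.ofFinite _
  obtain ⟨typ, n₀, h⟩ := slepian_wolf hp
    (fun ω => ((Xs (D k) ω, UsAll (fun _ => meeting {k}) ω) :
      (∀ i : {i // i ∈ D k}, 𝒳 i.1) × AuxAt 𝒰 k))
    (α := fun Γ : ℰ => ∀ i : {i // i ∈ Γ.1}, 𝒳 i.1)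
    (β := fun Γ : ℰ => (∀ i : {i // i ∈ D k \ Γ.1}, 𝒳 i.1) × AuxAt 𝒰 k)
    (fun Γ z i => z.1 ⟨i.1, Γ.2.1 i.2⟩)
    (fun _ z => (fun i => z.1 ⟨i.1, (Finset.mem_sdiff.1 i.2).1⟩, z.2))
    (by
      intro Γ z z' ha hb
      rw [Prod.mk.injEq] at hb
      refine Prod.ext (funext fun i => ?_) hb.2
      by_cases hi : i.1 ∈ Γ.1
      · exact congrFun ha ⟨i.1, hi⟩
      · exact congrFun hb.1 ⟨i.1, Finset.mem_sdiff.2 ⟨i.2, hi⟩⟩)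
    (fun Γ => ∑ i ∈ Γ.1, ∑ K ∈ meeting {k}, R₃ i K)
    (fun Γ => hrate Γ.1 Γ.2.1 Γ.2.2) hε
  refine ⟨typ, n₀, fun n hn m hm hR => ?_⟩
  have : ∀ s : Fin N × Packet M, Nonempty (Fin (m s.1 s.2)) := fun s => ⟨⟨0, hm _ _⟩⟩
  refine h n hn (R := SrcHash 𝒳 n m) famUnif famUnif_mem_stdSimplex
    (fun r => r.atSink (D k) k) fun z z' hz => ?_
  -- The error pattern consists of the sources in which `z` and `z'` differ.
  let Γ : Finset (Fin N) := (D k).filter fun i =>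
    ∃ hi : i ∈ D k, ¬(fun t => (z' t).1 ⟨i, hi⟩) = fun t => (z t).1 ⟨i, hi⟩
  have hΓ : ∀ i : {i // i ∈ D k}, i.1 ∈ Γ ↔ ¬(fun t => (z' t).1 i) = fun t => (z t).1 i := by
    intro i
    simp only [Γ, Finset.mem_filter]
    exact ⟨fun h => h.2.2, fun h => ⟨i.2, i.2, h⟩⟩
  have hΓD : Γ ⊆ D k := Finset.filter_subset _ _
  refine (sum_srcHash_collision hm hR (D k) k z z' Γ hΓD hΓ).trans ?_
  by_cases hu : (fun t => (z' t).2) = fun t => (z t).2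
  swap
  · rw [ind_of_not hu, zero_mul]
    exact Finset.sum_nonneg fun e _ => mul_nonneg (ind_nonneg _) (by positivity)
  have hne : Γ.Nonempty := by
    by_contra! hempty
    refine hz (funext fun t => Prod.ext (funext fun i => ?_) (congrFun hu t))
    have h1 : i.1 ∉ Γ := by rw [hempty]; exact Finset.notMem_empty _
    exact congrFun (not_not.1 (mt (hΓ i).2 h1)) t
  refine le_trans ?_ (Finset.single_le_sum (f := fun e : ℰ => _)
    (fun e _ => mul_nonneg (ind_nonneg _) (by positivity))
    (Finset.mem_univ (⟨Γ, hΓD, hne⟩ : ℰ)))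
  rw [ind_of hu, ind_of]
  intro t
  refine Prod.ext (funext fun i => ?_) (congrFun hu t)
  have hi := Finset.mem_sdiff.1 i.2
  exact congrFun (not_not.1 (mt (hΓ ⟨i.1, hi.1⟩).2 hi.2)) t

omit [∀ i, DecidableEq (𝒳 i)] in
/-- Near uniformity of the hashes of the auxiliary sequence of a source. -/
theorem exists_auxHash_uniform {PX : (∀ i, 𝒳 i) → ℝ} (hPX : PX ∈ stdSimplex ℝ (∀ i, 𝒳 i))
    {W : ∀ i, 𝒳 i → (∀ K, 𝒰 i K) → ℝ} (hW : ∀ i x, W i x ∈ stdSimplex ℝ (∀ K, 𝒰 i K))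
    (i : Fin N) {ρ : Fin N → Packet M → ℝ}
    (hrate : ∀ Q, IsUpClosed Q → Q.Nonempty →
      ∑ K ∈ Q, ρ i K < condEntropy (channelJoint PX W) (Us i Q) fun ω => ω.1 i)
    {ε : ℝ} (hε : 0 < ε) :
    ∃ n₀ : ℕ, ∀ n, n₀ ≤ n → ∀ m : Fin N → Packet M → ℕ, (∀ i K, 0 < m i K) →
      (∀ i K, (m i K : ℝ) ≤ (2 : ℝ) ^ (n * ρ i K)) →
      ∑ r : AuxHash 𝒰 n m, famUnif r * ∑ x, iid PX n x *
        ∑ y, |(Fintype.card (∀ K, Fin (m i K)) : ℝ)⁻¹ -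
          law (fun u : Fin n → ∀ K, 𝒰 i K => ∏ t, W i (x t i) (u t)) (r.ofSource i) y| ≤ ε := by
  classical
  let ℰ : Type := {Q : Finset (Packet M) // IsUpClosed Q ∧ Q.Nonempty}
  let _ : Fintype ℰ := Fintype.ofFinite _
  have hμ := law_mem_stdSimplex hPX fun x => x i
  obtain ⟨n₀, h⟩ := hash_nearly_uniform hμ (hW i)
    (γ := fun Q : ℰ => ∀ K : {K // K ∈ Q.1}, 𝒰 i K.1) (fun _ u K => u K.1)
    (fun Q => ∑ K ∈ Q.1, ρ i K)
    (by
      intro Q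
      refine (hrate Q.1 Q.2.1 Q.2.2).trans_le (le_of_eq (condEntropy_congr_law fun a b => ?_))
      have e := law_law (channelJoint PX W) (fun ω => (ω.1 i, ω.2 i))
        fun y => ((fun K : {K // K ∈ Q.1} => y.2 K.1), y.1)
      have e' : law (channelJoint PX W) (fun ω => (ω.1 i, ω.2 i)) =
          fun ω => law PX (fun x => x i) ω.1 * W i ω.1 ω.2 :=
        funext fun y => law_channelJoint_local hW i y.1 y.2
      rw [e'] at e
      exact (congrFun e (a, b)).symm) hε
  refine ⟨n₀, fun n hn m hm hρ => ?_⟩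
  have : ∀ s : Fin N × Packet M, Nonempty (Fin (m s.1 s.2)) := fun s => ⟨⟨0, hm _ _⟩⟩
  have : ∀ K : Packet M, Nonempty (Fin (m i K)) := fun K => ⟨⟨0, hm _ _⟩⟩
  have key := h n hn (R := AuxHash 𝒰 n m) (F := ∀ K, Fin (m i K)) famUnif famUnif_mem_stdSimplex
    (fun r => r.ofSource i) (by
      intro v v'
      let Q : Finset (Packet M) := Finset.univ.filter fun K =>
        (fun t => prefixOf K (v t)) = fun t => prefixOf K (v' t)
      have hQ : ∀ K, K ∈ Q ↔ (fun t => prefixOf K (v t)) = fun t => prefixOf K (v' t) :=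
        fun K => by simp [Q]
      refine (card_mul_sum_auxHash_collision hm hρ i v v' Q hQ).trans ?_
      have hnn : ∀ e : ℰ, 0 ≤ ind (∀ t, (fun K : {K // K ∈ e.1} => v' t K.1) =
          fun K : {K // K ∈ e.1} => v t K.1) * (2 : ℝ) ^ (n * ∑ K ∈ e.1, ρ i K) :=
        fun e => mul_nonneg (ind_nonneg _) (by positivity)
      by_cases hne : Q.Nonempty
      · have hup : IsUpClosed Q := by
          intro K hK K' hK'
          have hsub : K.1 ⊆ K'.1 := (Finset.mem_filter.1 hK').2.2
          refine (hQ K').2 (funext fun t => funext fun K'' => ?_)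
          exact congrFun (congrFun ((hQ K).1 hK) t) ⟨K''.1, hsub.trans K''.2⟩
        refine le_trans ?_ (le_add_of_nonneg_left zero_le_one)
        refine le_trans ?_ (Finset.single_le_sum (fun e _ => hnn e)
          (Finset.mem_univ (⟨Q, hup, hne⟩ : ℰ)))
        rw [ind_of, one_mul]
        intro t
        funext K
        exact (congrFun (congrFun ((hQ K.1).1 K.2) t) ⟨K.1, Finset.Subset.refl _⟩).symm
      -- If no prefix agrees, the bound is $2^0$; the constant `1` in the collision condition of
      -- `hash_nearly_uniform` accounts for it.
      · rw [Finset.not_nonempty_iff_eq_empty] at hne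
        rw [hne, Finset.sum_empty, mul_zero, Real.rpow_zero]
        exact le_add_of_nonneg_right (Finset.sum_nonneg fun e _ => hnn e))
  rw [sum_iid_law PX (fun x => x i)] at key
  refine le_trans (le_of_eq ?_) key
  simp_rw [law_eq, Finset.mul_sum (s := (Finset.univ : Finset (AuxHash 𝒰 n m))),
    Finset.mul_sum (s := (Finset.univ : Finset (Fin n → ∀ i, 𝒳 i)))]
  rw [Finset.sum_comm]
  refine Finset.sum_congr rfl fun x _ => Finset.sum_congr rfl fun r _ => ?_
  ring

end Errors

end DIR
end

noncomputable section
namespace DIR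

/-! ### The code built from prescribed and transmitted hashes -/

section Coding

set_option synthInstance.maxSize 1000

variable {N M : ℕ} {𝒳 : Fin N → Type*} {𝒰 : Fin N → Packet M → Type*}

/-- The code in which encoder `i` hashes the source sequence and the auxiliary sequence selected
by `φ i`.  Sink `k` decodes first the auxiliary sequences, with the help of the prescribed hashes
`f`, and then the sources. -/
def hashCode (D : Fin M → Finset (Fin N)) {n : ℕ} {m m₂ m₃ : Fin N → Packet M → ℕ}
    (h : AuxHash 𝒰 n m) (h₂ : AuxHash 𝒰 n m₂) (h₃ : SrcHash 𝒳 n m₃) (f : ∀ i K, Fin (m i K))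
    (φ : ∀ i, (Fin n → 𝒳 i) → Fin n → ∀ K, 𝒰 i K) (typ : ∀ k, Set (Fin n → AuxAt 𝒰 k))
    (typ' : ∀ k, Set (Fin n → (∀ i : {i // i ∈ D k}, 𝒳 i.1) × AuxAt 𝒰 k))
    [∀ k, Nonempty (Fin n → AuxAt 𝒰 k)]
    [∀ k, Nonempty (Fin n → (∀ i : {i // i ∈ D k}, 𝒳 i.1) × AuxAt 𝒰 k)] :
    Code 𝒳 D n fun i K => m₂ i K * m₃ i K where
  enc i x K := finProdFinEquiv (h₂.ofSource i (φ i x) K, h₃ (i, K) x)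
  dec k msg i t := (decodeIn (typ' k) (h₃.atSink (D k) k)
    (fun s => (finProdFinEquiv.symm (msg s.1.1 ⟨s.2.1, mem_meeting_singleton.1 s.2.2⟩)).2,
      decodeIn (typ k) (fun z => (h.atSink k z, h₂.atSink k z))
        -- The values of the hashes `h` are the constants `f`, so no rate is spent on them.
        (fun s => f s.1 s.2.1, fun s =>
          (finProdFinEquiv.symm (msg s.1 ⟨s.2.1, mem_meeting_singleton.1 s.2.2⟩)).1)) t).1 i

theorem hashCode_estimate (D : Fin M → Finset (Fin N)) {n : ℕ} {m m₂ m₃ : Fin N → Packet M → ℕ}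
    (h : AuxHash 𝒰 n m) (h₂ : AuxHash 𝒰 n m₂) (h₃ : SrcHash 𝒳 n m₃) (f : ∀ i K, Fin (m i K))
    (φ : ∀ i, (Fin n → 𝒳 i) → Fin n → ∀ K, 𝒰 i K) (typ : ∀ k, Set (Fin n → AuxAt 𝒰 k))
    (typ' : ∀ k, Set (Fin n → (∀ i : {i // i ∈ D k}, 𝒳 i.1) × AuxAt 𝒰 k))
    [∀ k, Nonempty (Fin n → AuxAt 𝒰 k)]
    [∀ k, Nonempty (Fin n → (∀ i : {i // i ∈ D k}, 𝒳 i.1) × AuxAt 𝒰 k)]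
    (x : Fin n → ∀ i, 𝒳 i) (u : ∀ i, Fin n → ∀ K, 𝒰 i K)
    (hu : ∀ i, u i = φ i fun t => x t i) (hf : ∀ i, h.ofSource i (u i) = f i) (k : Fin M)
    (h1 : ¬Confused (typ k) (fun z => (h.atSink k z, h₂.atSink k z)) fun t i K => u i t K.1)
    (h2 : ¬Confused (typ' k) (h₃.atSink (D k) k)
      fun t => (fun i : {i // i ∈ D k} => x t i.1, fun i K => u i t K.1)) :
    (hashCode D h h₂ h₃ f φ typ typ').estimate x k =
      fun (i : {i // i ∈ D k}) t => x t i.1 := by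
  have e1 := decodeIn_eq h1
  have e2 := decodeIn_eq h2
  funext i t
  have hz : decodeIn (typ k) (fun z => (h.atSink k z, h₂.atSink k z))
      (fun s => f s.1 s.2.1, fun s => h₂.ofSource s.1 (φ s.1 fun t => x t s.1) s.2.1) =
      (fun t i K => u i t K.1 : Fin n → AuxAt 𝒰 k) := by
    rw [← e1]
    congr 1
    refine Prod.ext (funext fun s => ?_) (funext fun s => ?_)
    · exact (congrFun (hf s.1) s.2.1).symm
    · dsimp only
      rw [← hu]; rfl
  simp only [Code.estimate, hashCode, Equiv.symm_apply_apply, hz]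
  exact congrFun (congrArg Prod.fst (congrFun e2 t)) i

variable [∀ i, Fintype (𝒳 i)] [∀ i K, Fintype (𝒰 i K)] [∀ i, DecidableEq (𝒳 i)]
  [∀ i K, DecidableEq (𝒰 i K)]

theorem sum_mul_fst {R R' : Type*} [Fintype R] [Fintype R'] (w : R → ℝ) {w' : R' → ℝ}
    (hw' : w' ∈ stdSimplex ℝ R') (g : R → ℝ) :
    ∑ r : R × R', w r.1 * w' r.2 * g r.1 = ∑ r, w r * g r := by
  rw [Fintype.sum_prod_type]
  refine Finset.sum_congr rfl fun r _ => ?_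
  have h : ∀ y, w (r, y).1 * w' (r, y).2 * g (r, y).1 = w r * g r * w' y :=
    fun y => mul_right_comm _ _ _
  simp_rw [h, ← Finset.mul_sum, hw'.2, mul_one]

/-- The coding theorem for independent auxiliary channels, with strict rate conditions. -/
theorem exists_code {PX : (∀ i, 𝒳 i) → ℝ} (hPX : PX ∈ stdSimplex ℝ (∀ i, 𝒳 i))
    {W : ∀ i, 𝒳 i → (∀ K, 𝒰 i K) → ℝ} (hW : ∀ i x, W i x ∈ stdSimplex ℝ (∀ K, 𝒰 i K))
    (D : Fin M → Finset (Fin N)) {ρ ρ' R₂ R₃ : Fin N → Packet M → ℝ}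
    (hcov : ∀ i Q, IsUpClosed Q → Q.Nonempty →
      ∑ K ∈ Q, ρ' i K < condEntropy (channelJoint PX W) (Us i Q) fun ω => ω.1 i)
    (hpack : ∀ (k : Fin M) (Q : Fin N → Finset (Packet M)), (∀ i, Q i ⊆ meeting {k}) →
      (∀ i, IsUpClosed (Q i)) → (∃ i, Q i ≠ meeting {k}) →
      condEntropy (channelJoint PX W) (UsAll fun i => meeting {k} \ Q i) (UsAll Q) <
        ∑ i, ∑ K ∈ meeting {k} \ Q i, (ρ i K + R₂ i K))
    (hbin : ∀ k Γ, Γ ⊆ D k → Γ.Nonempty →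
      gamma (channelJoint PX W) D k Γ < ∑ i ∈ Γ, ∑ K ∈ meeting {k}, R₃ i K)
    {ε : ℝ} (hε : 0 < ε) :
    ∃ n₀ : ℕ, ∀ n, n₀ ≤ n → ∀ m m₂ m₃ : Fin N → Packet M → ℕ,
      (∀ i K, 0 < m i K) → (∀ i K, 0 < m₂ i K) → (∀ i K, 0 < m₃ i K) →
      (∀ i K, (2 : ℝ) ^ (n * ρ i K) ≤ m i K) → (∀ i K, (m i K : ℝ) ≤ (2 : ℝ) ^ (n * ρ' i K)) →
      (∀ i K, (2 : ℝ) ^ (n * R₂ i K) ≤ m₂ i K) → (∀ i K, (2 : ℝ) ^ (n * R₃ i K) ≤ m₃ i K) →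
      ∃ c : Code 𝒳 D n (fun i K => m₂ i K * m₃ i K), c.errorProb PX ≤ ε := by
  have hP := channelJoint_mem_stdSimplex hPX hW
  obtain ⟨x₀, -⟩ : ∃ x, PX x ≠ 0 := by
    by_contra! h
    have := hPX.2
    simp [h] at this
  have hne : ∀ i, Nonempty (∀ K, 𝒰 i K) := fun i => by
    by_contra h
    rw [not_nonempty_iff] at h
    have := (hW i (x₀ i)).2
    simp at this
  have hnA : ∀ k n, Nonempty (Fin n → AuxAt 𝒰 k) :=
    fun k n => ⟨fun _ i K => (hne i).some K.1⟩
  have hnS : ∀ k n, Nonempty (Fin n → (∀ i : {i // i ∈ D k}, 𝒳 i.1) × AuxAt 𝒰 k) :=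
    fun k n => ⟨fun _ => (fun i => x₀ i.1, fun i K => (hne i).some K.1)⟩
  -- $M\varepsilon_1$ for each of the two decoding stages, and $MN\varepsilon_1$ for the
  -- nonuniformity of $N$ sources at cost bound $M$; the `1` keeps the denominator positive.
  set ε₁ : ℝ := ε / (2 * M + M * N + 1) with hε₁
  have hε₁0 : 0 < ε₁ := by positivity
  choose typ nA hA using fun k => exists_auxTypical hP k (hpack k) hε₁0
  choose typ' nS hS using fun k => exists_srcTypical hP D k (hbin k) hε₁0
  obtain ⟨n₁, hn₁⟩ := exists_forall_nat fun k => ⟨nA k, hA k⟩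
  obtain ⟨n₂, hn₂⟩ := exists_forall_nat fun k => ⟨nS k, hS k⟩
  obtain ⟨n₃, hn₃⟩ := exists_forall_nat fun i => exists_auxHash_uniform hPX hW i (hcov i) hε₁0
  refine ⟨max n₁ (max n₂ n₃), fun n hn m m₂ m₃ hm hm₂ hm₃ hρ hρ' hR₂ hR₃ => ?_⟩
  have hA' := fun k => hn₁ n ((le_max_left _ _).trans hn) k m m₂ hm hm₂ hρ hR₂
  have hS' := fun k => hn₂ n (((le_max_left _ _).trans (le_max_right _ _)).trans hn) k m₃ hm₃ hR₃
  have hU' := fun i => hn₃ n (((le_max_right _ _).trans (le_max_right _ _)).trans hn) i m hm hρ'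
  clear hA hS hn₁ hn₂ hn₃
  have : ∀ s : Fin N × Packet M, Nonempty (Fin (m s.1 s.2)) := fun s => ⟨⟨0, hm _ _⟩⟩
  have : ∀ s : Fin N × Packet M, Nonempty (Fin (m₂ s.1 s.2)) := fun s => ⟨⟨0, hm₂ _ _⟩⟩
  have : ∀ s : Fin N × Packet M, Nonempty (Fin (m₃ s.1 s.2)) := fun s => ⟨⟨0, hm₃ _ _⟩⟩
  have : ∀ i (K : Packet M), Nonempty (Fin (m i K)) := fun i K => ⟨⟨0, hm _ _⟩⟩
  have : ∀ k, Nonempty (Fin n → AuxAt 𝒰 k) := fun k => hnA k n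
  have : ∀ k, Nonempty (Fin n → (∀ i : {i // i ∈ D k}, 𝒳 i.1) × AuxAt 𝒰 k) := fun k => hnS k n
  -- choice of the hash functions
  obtain ⟨h₃, hh₃⟩ : ∃ h₃ : SrcHash 𝒳 n m₃, ∑ k, ∑ ω, iid (channelJoint PX W) n ω *
      ind (Confused (typ' k n) (h₃.atSink (D k) k)
        fun t => (Xs (D k) (ω t), UsAll (fun _ => meeting {k}) (ω t))) ≤ M * ε₁ := by
    refine exists_le_of_sum_le famUnif_mem_stdSimplex ?_
    simp_rw [Finset.mul_sum (s := (Finset.univ : Finset (Fin M)))]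
    rw [Finset.sum_comm]
    exact (Finset.sum_le_sum fun k _ => hS' k).trans (by simp)
  let tv : AuxHash 𝒰 n m → Fin N → ℝ := fun h i => ∑ x, iid PX n x *
    ∑ y, |(Fintype.card (∀ K, Fin (m i K)) : ℝ)⁻¹ -
      law (fun u : Fin n → ∀ K, 𝒰 i K => ∏ t, W i (x t i) (u t)) (h.ofSource i) y|
  -- The same `h` must give both decodability and near uniformity, so both costs are averaged
  -- together. The factor `M` is the bound `C` of the selection below.
  obtain ⟨⟨h, h₂⟩, hh⟩ : ∃ h : AuxHash 𝒰 n m × AuxHash 𝒰 n m₂,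
      ∑ k, ∑ ω, iid (channelJoint PX W) n ω *
        ind (Confused (typ k n) (fun z => (h.1.atSink k z, h.2.atSink k z))
          fun t => UsAll (fun _ => meeting {k}) (ω t)) + M * ∑ i, tv h.1 i ≤
      M * ε₁ + M * (N * ε₁) := by
    refine exists_le_of_sum_le (w := fun h => famUnif h.1 * famUnif h.2)
      (mul_mem_stdSimplex famUnif_mem_stdSimplex famUnif_mem_stdSimplex) ?_
    simp_rw [mul_add]
    rw [Finset.sum_add_distrib]
    refine add_le_add ?_ ?_
    · simp_rw [Finset.mul_sum (s := (Finset.univ : Finset (Fin M)))]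
      rw [Finset.sum_comm]
      exact (Finset.sum_le_sum fun k _ => hA' k).trans (by simp)
    · rw [sum_mul_fst famUnif famUnif_mem_stdSimplex fun h => (M : ℝ) * ∑ i, tv h i]
      simp_rw [mul_left_comm _ (M : ℝ), ← Finset.mul_sum]
      refine mul_le_mul_of_nonneg_left ?_ (Nat.cast_nonneg M)
      simp_rw [Finset.mul_sum (s := (Finset.univ : Finset (Fin N)))]
      rw [Finset.sum_comm]
      exact (Finset.sum_le_sum fun i _ => hU' i).trans (by simp)
  -- choice of the auxiliary sequences
  let bad : Fin M → (Fin n → ∀ i, 𝒳 i) → (∀ i, Fin n → ∀ K, 𝒰 i K) → Prop := fun k x u =>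
    Confused (typ k n) (fun z => (h.atSink k z, h₂.atSink k z)) (fun t i K => u i t K.1) ∨
      Confused (typ' k n) (h₃.atSink (D k) k)
        fun t => (fun i : {i // i ∈ D k} => x t i.1, fun i K => u i t K.1)
  obtain ⟨f, φ, hφ⟩ := exists_selection (S := Fin n → ∀ i, 𝒳 i) (A := fun i => Fin n → 𝒳 i)
    (B := fun i => Fin n → ∀ K, 𝒰 i K) (F := fun i => ∀ K, Fin (m i K)) (C := M)
    (iid_nonneg hPX.1 n) (fun x i t => x t i) (V := fun i a u => ∏ t, W i (a t) (u t))
    (fun i a => prod_mem_stdSimplex fun t => hW i (a t)) (fun i => h.ofSource i)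
    -- The cost also counts violated hash constraints, possible when the prescribed value has
    -- conditional probability zero. Under the ideal law `f` is the hash itself and nothing is
    -- violated.
    (g := fun x u f => ∑ k, ind (¬(∀ i, h.ofSource i (u i) = f i) ∨ bad k x u))
    (fun _ _ _ => Finset.sum_nonneg fun _ _ => ind_nonneg _)
    (fun _ _ _ => (Finset.sum_le_sum fun _ _ => ind_le_one _).trans (by simp))
  refine ⟨hashCode D h h₂ h₃ f φ (fun k => typ k n) (fun k => typ' k n), ?_⟩
  have hideal : ∑ x, iid PX n x * ∑ u : ∀ i, Fin n → ∀ K, 𝒰 i K,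
      (∏ i, ∏ t, W i (x t i) (u i t)) *
        ∑ k, ind (¬(∀ i, h.ofSource i (u i) = h.ofSource i (u i)) ∨ bad k x u) ≤
      ∑ k, ∑ ω, iid (channelJoint PX W) n ω *
        ind (Confused (typ k n) (fun z => (h.atSink k z, h₂.atSink k z))
          fun t => UsAll (fun _ => meeting {k}) (ω t)) +
      ∑ k, ∑ ω, iid (channelJoint PX W) n ω *
        ind (Confused (typ' k n) (h₃.atSink (D k) k)
          fun t => (Xs (D k) (ω t), UsAll (fun _ => meeting {k}) (ω t))) := by
    simp only [implies_true, not_true_eq_false, false_or]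
    rw [← sum_iid_channelJoint n fun x u => ∑ k, ind (bad k x u), ← Finset.sum_add_distrib]
    simp_rw [Finset.mul_sum]
    rw [Finset.sum_comm]
    refine Finset.sum_le_sum fun k _ => ?_
    rw [← Finset.sum_add_distrib]
    refine Finset.sum_le_sum fun ω _ => ?_
    rw [← mul_add]
    exact mul_le_mul_of_nonneg_left (ind_or_le _ _) (iid_nonneg hP.1 n ω)
  have herr : (hashCode D h h₂ h₃ f φ (fun k => typ k n) (fun k => typ' k n)).errorProb PX ≤
      ∑ x, iid PX n x * ∑ k, ind (¬(∀ i, h.ofSource i (φ i fun t => x t i) = f i) ∨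
        bad k x fun i => φ i fun t => x t i) := by
    have hle : (1 / (M : ℝ)) ≤ 1 := by
      rcases Nat.eq_zero_or_pos M with h0 | h0
      · simp [h0]
      · rw [div_le_one (by exact_mod_cast h0)]; exact_mod_cast h0
    simp_rw [Finset.mul_sum]
    rw [Finset.sum_comm, Code.errorProb]
    refine (mul_le_of_le_one_left (Finset.sum_nonneg fun k _ => Finset.sum_nonneg fun x _ =>
      Set.indicator_nonneg (fun x _ => iid_nonneg hPX.1 n x) x) hle).trans ?_
    refine Finset.sum_le_sum fun k _ => Finset.sum_le_sum fun x _ => ?_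
    by_cases hx : ¬(∀ i, h.ofSource i (φ i fun t => x t i) = f i) ∨
        bad k x fun i => φ i fun t => x t i
    · rw [ind_of hx, mul_one]
      exact Set.indicator_le_self' (fun x _ => iid_nonneg hPX.1 n x) x
    · rw [ind_of_not hx, mul_zero, Set.indicator_of_notMem]
      simp only [bad, not_or, not_not] at hx
      simp only [Set.mem_ofPred_eq, not_not]
      exact hashCode_estimate D h h₂ h₃ f φ _ _ x _ (fun _ => rfl) hx.1 k hx.2.1 hx.2.2
  have hbound : M * ε₁ + M * (N * ε₁) + M * ε₁ ≤ ε := by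
    have : ε₁ * (2 * M + M * N + 1) = ε := div_mul_cancel₀ _ (by positivity)
    nlinarith
  linarith [hφ.trans (add_le_add_left hideal _)]

end Coding

end DIR
end

noncomputable section
namespace DIR

/-! ### Laws and conditional entropies of derived variables -/

section Derived

/-- Transfers entropies from `P` to the channel model, with `Y` the pair of a source and its
auxiliary variables, or the variables relevant to one sink. -/
theorem condEntropy_congr_of_law {Ω Ω' γ α β : Type*} [Fintype Ω] [Fintype Ω'] [Fintype γ]
    [Fintype α] [Fintype β] {p : Ω → ℝ} {p' : Ω' → ℝ} {Y : Ω → γ} {Y' : Ω' → γ}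
    (h : law p Y = law p' Y') (a : γ → α) (b : γ → β) :
    condEntropy p (fun ω => a (Y ω)) (fun ω => b (Y ω)) =
      condEntropy p' (fun ω => a (Y' ω)) fun ω => b (Y' ω) :=
  condEntropy_congr_law fun x y => by
    have e := law_law p Y fun c => (a c, b c)
    have e' := law_law p' Y' fun c => (a c, b c)
    rw [← e, ← e', h]

theorem sum_law_pair_mul_ind {Ω α β γ : Type*} [Fintype Ω] [Fintype α] (p : Ω → ℝ) (A : Ω → α)
    (B : Ω → β) (r : α → γ) (b : β) (c : γ) :
    ∑ a, law p (fun ω => (B ω, A ω)) (b, a) * ind (r a = c) =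
      law p (fun ω => (r (A ω), B ω)) (c, b) := by
  simp_rw [law_eq, Finset.sum_mul]
  rw [Finset.sum_comm]
  refine Finset.sum_congr rfl fun ω _ => ?_
  have := sum_ind_eq_mul (A ω) fun a => p ω * ind (B ω = b) * ind (r a = c)
  rw [Prod.mk.injEq, ind_and, mul_comm (ind _), ← mul_assoc, ← this]
  refine Finset.sum_congr rfl fun a _ => ?_
  rw [Prod.mk.injEq, ind_and]
  ring

theorem law_pair_le {Ω α β : Type*} [Fintype Ω] {p : Ω → ℝ} (hp : ∀ ω, 0 ≤ p ω) (A : Ω → α)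
    (B : Ω → β) (a : α) (b : β) : law p (fun ω => (A ω, B ω)) (a, b) ≤ law p A a := by
  rw [law_eq, law_eq]
  exact Finset.sum_le_sum fun ω _ => mul_le_mul_of_nonneg_left
    (ind_mono fun h => congrArg Prod.fst h) (hp ω)

end Derived

variable {N M : ℕ} {𝒳 : Fin N → Type*} {𝒰 : Fin N → Packet M → Type*}
  [∀ i, Fintype (𝒳 i)] [∀ i K, Fintype (𝒰 i K)]

/-! ### Auxiliary variables as outputs of independent channels -/

section Channel

/-- The conditional distribution of `{U_i}` given `X_i`. -/
def auxChannel (P : Joint 𝒳 𝒰 → ℝ) (i : Fin N) (x : 𝒳 i) (u : ∀ K, 𝒰 i K) : ℝ :=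
  open Classical in
  -- At a source symbol of probability zero any distribution would do.
  if law P (fun ω => ω.1 i) x = 0 then law P (fun ω => ω.2 i) u
  else law P (fun ω => (ω.1 i, ω.2 i)) (x, u) / law P (fun ω => ω.1 i) x

theorem auxChannel_mem_stdSimplex {P : Joint 𝒳 𝒰 → ℝ} (hP : P ∈ stdSimplex ℝ (Joint 𝒳 𝒰))
    (i : Fin N) (x : 𝒳 i) : auxChannel P i x ∈ stdSimplex ℝ (∀ K, 𝒰 i K) := by
  by_cases h : law P (fun ω => ω.1 i) x = 0
  · have e : auxChannel P i x = law P fun ω => ω.2 i := by funext u; simp [auxChannel, h]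
    rw [e]
    exact law_mem_stdSimplex hP _
  · have e : auxChannel P i x =
        fun u => law P (fun ω => (ω.1 i, ω.2 i)) (x, u) / law P (fun ω => ω.1 i) x := by
      funext u; simp [auxChannel, h]
    rw [e]
    refine ⟨fun u => div_nonneg (law_nonneg hP.1 _ _) (law_nonneg hP.1 _ _), ?_⟩
    rw [← Finset.sum_div]
    have := sum_law_pair_mul_ind P (fun ω => ω.2 i) (fun ω => ω.1 i) (fun _ => ()) x ()
    simp only [ind_of, mul_one] at this
    rw [this, law_congr (g := fun ω => ω.1 i) (b := x) fun ω => by simp, div_self h]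

theorem law_mul_auxChannel {P : Joint 𝒳 𝒰 → ℝ} (hP : P ∈ stdSimplex ℝ (Joint 𝒳 𝒰))
    (i : Fin N) (x : 𝒳 i) (u : ∀ K, 𝒰 i K) :
    law P (fun ω => ω.1 i) x * auxChannel P i x u = law P (fun ω => (ω.1 i, ω.2 i)) (x, u) := by
  by_cases h : law P (fun ω => ω.1 i) x = 0
  · rw [h, zero_mul]
    exact le_antisymm (law_nonneg hP.1 _ _)
      ((law_pair_le hP.1 (fun ω => ω.1 i) (fun ω => ω.2 i) x u).trans h.le)
  · simp only [auxChannel, h, if_false]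
    field_simp

variable {PX : (∀ i, 𝒳 i) → ℝ} {P : Joint 𝒳 𝒰 → ℝ}

/-- Serves the covering conditions, which concern one source at a time. -/
theorem IsAuxiliary.law_local (hP : IsAuxiliary PX P) (i : Fin N) :
    law (channelJoint PX (auxChannel P)) (fun ω => (ω.1 i, ω.2 i)) =
      law P fun ω => (ω.1 i, ω.2 i) := by
  funext y
  rw [law_channelJoint_local (fun i x => auxChannel_mem_stdSimplex hP.pmf i x),
    ← law_mul_auxChannel hP.pmf, ← funext hP.marginal, law_law]

/-- Here the Markov condition is used: at a single sink the auxiliary variables already behave as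
outputs of independent channels. Dependence between variables that no sink sees together may be
lost, but packing and binning involve one sink each. -/
theorem IsAuxiliary.law_sink (hP : IsAuxiliary PX P) (k : Fin M) :
    law (channelJoint PX (auxChannel P))
        (fun ω => (ω.1, (UsAll (fun _ => meeting {k}) ω : AuxAt 𝒰 k))) =
      law P fun ω => (ω.1, (UsAll (fun _ => meeting {k}) ω : AuxAt 𝒰 k)) := by
  funext ⟨x, u⟩
  refine (law_channelJoint_global (fun i v (K : {K : Packet M // K ∈ meeting {k}}) => v K.1)
    x u).trans (Eq.trans ?_ (hP.markov k x u).symm)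
  rw [hP.marginal]
  by_cases hx : PX x = 0
  · rw [hx, zero_mul, zero_mul]
  congr 1
  refine Finset.prod_congr rfl fun i _ => ?_
  have hi : law P (fun ω => ω.1 i) (x i) ≠ 0 := by
    have h1 := law_law P (fun ω => ω.1) fun y => y i
    rw [funext hP.marginal] at h1
    rw [← h1]
    have h0 : ∀ y, 0 ≤ PX y := fun y => by rw [← hP.marginal]; exact law_nonneg hP.pmf.1 _ _
    exact ((h0 x).lt_of_ne' hx |>.trans_le (le_law h0 (fun y => y i) x)).ne'
  rw [law_eq]
  have h2 := sum_law_pair_mul_ind P (fun ω => ω.2 i) (fun ω => ω.1 i)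
    (fun v (K : {K : Packet M // K ∈ meeting {k}}) => v K.1) (x i) (u i)
  rw [eq_div_iff hi, Finset.sum_mul]
  refine Eq.trans (Finset.sum_congr rfl fun v _ => ?_) h2
  rw [← law_mul_auxChannel hP.pmf]
  ring

end Channel

/-! ### Independent uniform components -/

omit [∀ i, Fintype (𝒳 i)] [∀ i K, Fintype (𝒰 i K)] in
theorem Us_eq_iff {i : Fin N} {Q : Finset (Packet M)} {ω ω' : Joint 𝒳 𝒰} :
    Us i Q ω = Us i Q ω' ↔ ∀ K ∈ Q, ω.2 i K = ω'.2 i K :=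
  ⟨fun h K hK => congrFun h ⟨K, hK⟩, fun h => funext fun K => h K.1 K.2⟩

omit [∀ i, Fintype (𝒳 i)] [∀ i K, Fintype (𝒰 i K)] in
theorem UsAll_eq_iff {Q : Fin N → Finset (Packet M)} {ω ω' : Joint 𝒳 𝒰} :
    UsAll Q ω = UsAll Q ω' ↔ ∀ i, ∀ K ∈ Q i, ω.2 i K = ω'.2 i K :=
  ⟨fun h i => Us_eq_iff.1 (congrFun h i), fun h => funext fun i => Us_eq_iff.2 (h i)⟩

section Augment

variable (q : ℕ)

/-- The channel with independent uniform components attached to all outputs. -/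
def augment (W : ∀ i, 𝒳 i → (∀ K, 𝒰 i K) → ℝ) (i : Fin N) (x : 𝒳 i)
    (u : ∀ K, 𝒰 i K × Fin q) : ℝ :=
  W i x (fun K => (u K).1) * ∏ _K : Packet M, (q : ℝ)⁻¹

/-- Dropping the uniform components. -/
def dropUniform (ω : Joint 𝒳 fun i K => 𝒰 i K × Fin q) : Joint 𝒳 𝒰 :=
  (ω.1, fun i K => (ω.2 i K).1)

/-- Splitting off the uniform components. -/
def splitUniform (𝒳 : Fin N → Type*) (𝒰 : Fin N → Packet M → Type*) :
    (Joint 𝒳 fun i K => 𝒰 i K × Fin q) ≃ Joint 𝒳 𝒰 × (Fin N → Packet M → Fin q) where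
  toFun ω := (dropUniform q ω, fun i K => (ω.2 i K).2)
  invFun y := (y.1.1, fun i K => (y.1.2 i K, y.2 i K))
  left_inv _ := rfl
  right_inv _ := rfl

variable {q} (hq : 0 < q) {W : ∀ i, 𝒳 i → (∀ K, 𝒰 i K) → ℝ}
  (hW : ∀ i x, W i x ∈ stdSimplex ℝ (∀ K, 𝒰 i K)) {PX : (∀ i, 𝒳 i) → ℝ}

omit [∀ i, Fintype (𝒳 i)] [∀ i K, Fintype (𝒰 i K)] in
theorem channelJoint_augment (ω : Joint 𝒳 fun i K => 𝒰 i K × Fin q) :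
    channelJoint PX (augment q W) ω =
      channelJoint PX W (dropUniform q ω) * ∏ _i : Fin N, ∏ _K : Packet M, (q : ℝ)⁻¹ := by
  simp only [channelJoint, augment, dropUniform, Finset.prod_mul_distrib]
  ring

include hq in
theorem sum_uniform_ind (S : Fin N → Finset (Packet M)) (v : Fin N → Packet M → Fin q) :
    ∑ y : Fin N → Packet M → Fin q, (∏ _i : Fin N, ∏ _K : Packet M, (q : ℝ)⁻¹) *
      ind (∀ i, ∀ K ∈ S i, y i K = v i K) = (q : ℝ)⁻¹ ^ ∑ i, (S i).card := by
  have h1 : ∀ y : Fin N → Packet M → Fin q, (∏ _i : Fin N, ∏ _K : Packet M, (q : ℝ)⁻¹) *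
      ind (∀ i, ∀ K ∈ S i, y i K = v i K) =
      ∏ i, ∏ K, (q : ℝ)⁻¹ * ind (K ∈ S i → y i K = v i K) := fun y => by
    simp_rw [ind_forall, Finset.prod_mul_distrib]
  have hq' : (q : ℝ) ≠ 0 := Nat.cast_ne_zero.2 hq.ne'
  simp_rw [h1]
  rw [sum_pi_prod fun i (y : Packet M → Fin q) =>
    ∏ K, (q : ℝ)⁻¹ * ind (K ∈ S i → y K = v i K), ← Finset.prod_pow_eq_pow_sum]
  refine Finset.prod_congr rfl fun i _ => ?_
  rw [sum_pi_prod fun K (y : Fin q) => (q : ℝ)⁻¹ * ind (K ∈ S i → y = v i K),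
    ← Finset.prod_const, ← Finset.prod_subset (Finset.subset_univ (S i))]
  · refine Finset.prod_congr rfl fun K hK => ?_
    simp only [hK, true_implies, eq_comm (b := v i K)]
    rw [← Finset.mul_sum, sum_ind_eq, mul_one]
  · intro K _ hK
    simp [hK, ind_of, hq']

include hq in
theorem sum_channelJoint_augment (g : Joint 𝒳 𝒰 → ℝ) (S : Fin N → Finset (Packet M))
    (v : Fin N → Packet M → Fin q) :
    ∑ ω, channelJoint PX (augment q W) ω * (g (dropUniform q ω) *
      ind (∀ i, ∀ K ∈ S i, (ω.2 i K).2 = v i K)) =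
      (∑ ω, channelJoint PX W ω * g ω) * (q : ℝ)⁻¹ ^ ∑ i, (S i).card := by
  rw [← sum_uniform_ind hq S v, Finset.sum_mul_sum, ← Fintype.sum_prod_type',
    Fintype.sum_equiv (splitUniform q 𝒳 𝒰)]
  intro ω
  rw [channelJoint_augment]
  have e : splitUniform q 𝒳 𝒰 ω = (dropUniform q ω, fun i K => (ω.2 i K).2) := rfl
  rw [e]
  ring

-- `hA` says that `A'` carries the same information as `A` together with the uniform components in
-- `S`, without naming a bijection.
include hq in
theorem law_channelJoint_augment {α α' : Type*} (A : Joint 𝒳 𝒰 → α)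
    (A' : (Joint 𝒳 fun i K => 𝒰 i K × Fin q) → α') (S : Fin N → Finset (Packet M))
    (hA : ∀ ω ω', A' ω = A' ω' ↔ A (dropUniform q ω) = A (dropUniform q ω') ∧
      ∀ i, ∀ K ∈ S i, (ω.2 i K).2 = (ω'.2 i K).2) (ω : Joint 𝒳 fun i K => 𝒰 i K × Fin q) :
    law (channelJoint PX (augment q W)) A' (A' ω) =
      law (channelJoint PX W) A (A (dropUniform q ω)) * (q : ℝ)⁻¹ ^ ∑ i, (S i).card := by
  rw [law_eq, law_eq, ← sum_channelJoint_augment hq _ S fun i K => (ω.2 i K).2]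
  simp_rw [hA, ind_and]

omit [∀ i, Fintype (𝒳 i)] in
include hq hW in
theorem augment_mem_stdSimplex (i : Fin N) (x : 𝒳 i) :
    augment q W i x ∈ stdSimplex ℝ (∀ K, 𝒰 i K × Fin q) := by
  refine ⟨fun u => mul_nonneg ((hW i x).1 _) (Finset.prod_nonneg fun K _ => by positivity), ?_⟩
  rw [Fintype.sum_equiv (Equiv.arrowProdEquivProdArrow (Packet M) (𝒰 i) fun _ => Fin q) (augment q W i x)
    (fun y => W i x y.1 * ∏ K : Packet M, (fun (_ : Packet M) (_ : Fin q) => (q : ℝ)⁻¹) K (y.2 K))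
    fun u => rfl, Fintype.sum_prod_type]
  simp_rw [← Finset.mul_sum]
  rw [sum_pi_prod fun (_ : Packet M) (_ : Fin q) => (q : ℝ)⁻¹]
  have hq' : (q : ℝ) ≠ 0 := Nat.cast_ne_zero.2 hq.ne'
  simp [hq', (hW i x).2]

include hq hW in
/-- Conditional entropies grow by the number of attached uniform components. -/
theorem condEntropy_augment (hPX : PX ∈ stdSimplex ℝ (∀ i, 𝒳 i)) {α α' β β' : Type*} [Fintype α]
    [Fintype α'] [Fintype β] [Fintype β'] (A : Joint 𝒳 𝒰 → α) (B : Joint 𝒳 𝒰 → β)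
    (A' : (Joint 𝒳 fun i K => 𝒰 i K × Fin q) → α') (B' : (Joint 𝒳 fun i K => 𝒰 i K × Fin q) → β')
    (S T : Fin N → Finset (Packet M)) (hST : ∀ i, Disjoint (S i) (T i))
    (hA : ∀ ω ω', (A' ω, B' ω) = (A' ω', B' ω') ↔
      (A (dropUniform q ω), B (dropUniform q ω)) = (A (dropUniform q ω'), B (dropUniform q ω')) ∧
        ∀ i, ∀ K ∈ S i ∪ T i, (ω.2 i K).2 = (ω'.2 i K).2)
    (hB : ∀ ω ω', B' ω = B' ω' ↔ B (dropUniform q ω) = B (dropUniform q ω') ∧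
      ∀ i, ∀ K ∈ T i, (ω.2 i K).2 = (ω'.2 i K).2) :
    condEntropy (channelJoint PX (augment q W)) A' B' =
      condEntropy (channelJoint PX W) A B + (∑ i, (S i).card : ℕ) * Real.logb 2 q := by
  have hP' := channelJoint_mem_stdSimplex hPX (augment_mem_stdSimplex hq hW)
  have hP := channelJoint_mem_stdSimplex hPX hW
  have hq' : (q : ℝ) ≠ 0 := Nat.cast_ne_zero.2 hq.ne'
  have hterm : ∀ ω, channelJoint PX (augment q W) ω *
      -Real.logb 2 (condProb (channelJoint PX (augment q W)) A' B' (A' ω) (B' ω)) =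
      channelJoint PX (augment q W) ω *
        (-Real.logb 2 (condProb (channelJoint PX W) A B (A (dropUniform q ω))
          (B (dropUniform q ω))) + (∑ i, (S i).card : ℕ) * Real.logb 2 q) := by
    intro ω
    by_cases h0 : channelJoint PX (augment q W) ω = 0
    · rw [h0, zero_mul, zero_mul]
    congr 1
    have hd : 0 < channelJoint PX W (dropUniform q ω) :=
      (hP.1 _).lt_of_ne' fun h => h0 (by rw [channelJoint_augment, h, zero_mul])
    have hc := condProb_pos hP.1 A B hd
    have e : condProb (channelJoint PX (augment q W)) A' B' (A' ω) (B' ω) =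
        condProb (channelJoint PX W) A B (A (dropUniform q ω)) (B (dropUniform q ω)) *
          (q : ℝ)⁻¹ ^ ∑ i, (S i).card := by
      have e1 := law_channelJoint_augment (PX := PX) (W := W) hq (fun ω => (A ω, B ω))
        (fun ω => (A' ω, B' ω)) (fun i => S i ∪ T i) hA ω
      have e2 := law_channelJoint_augment (PX := PX) (W := W) hq B B' T hB ω
      simp only [condProb]
      rw [e1, e2]
      -- The uniform components in the condition, indexed by `T`, cancel in the quotient; those in
      -- `S` remain.
      simp_rw [Finset.card_union_of_disjoint (hST _), Finset.sum_add_distrib, pow_add]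
      field_simp
    rw [e, Real.logb_mul hc.ne' (by positivity), Real.logb_pow, Real.logb_inv]
    ring
  rw [condEntropy_eq, condEntropy_eq]
  simp_rw [hterm, mul_add, Finset.sum_add_distrib, ← Finset.sum_mul, hP'.2, one_mul]
  congr 1
  -- With `S` empty the identity integrates out all uniform components.
  have := sum_channelJoint_augment (PX := PX) (W := W) hq
    (fun ω => -Real.logb 2 (condProb (channelJoint PX W) A B (A ω) (B ω))) (fun _ => ∅)
    fun _ _ => ⟨0, hq⟩
  simpa [ind_of] using this

include hq hW in
theorem condEntropy_augment_source (hPX : PX ∈ stdSimplex ℝ (∀ i, 𝒳 i)) (i : Fin N)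
    (Q : Finset (Packet M)) :
    condEntropy (channelJoint PX (augment q W)) (Us i Q) (fun ω => ω.1 i) =
      condEntropy (channelJoint PX W) (Us i Q) (fun ω => ω.1 i) + Q.card * Real.logb 2 q := by
  rw [condEntropy_augment hq hW hPX (Us i Q) (fun ω => ω.1 i) (Us i Q) (fun ω => ω.1 i)
    (fun j => if j = i then Q else ∅) (fun _ => ∅) (fun _ => Finset.disjoint_empty_right _)]
  · congr 3
    simp [apply_ite Finset.card]
  · intro ω ω'
    simp only [Prod.mk.injEq, Us_eq_iff, dropUniform, Finset.union_empty]
    constructor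
    · rintro ⟨h, hx⟩
      refine ⟨⟨fun K hK => congrArg Prod.fst (h K hK), hx⟩, fun j K hK => ?_⟩
      by_cases hj : j = i
      · subst hj
        rw [if_pos rfl] at hK
        exact congrArg Prod.snd (h K hK)
      · simp [hj] at hK
    · rintro ⟨⟨h, hx⟩, hv⟩
      exact ⟨fun K hK => Prod.ext (h K hK) (hv i K (by simpa using hK)), hx⟩
  · intro ω ω'
    simp [dropUniform]

include hq hW in
theorem condEntropy_augment_sink (hPX : PX ∈ stdSimplex ℝ (∀ i, 𝒳 i))
    (Q Q' : Fin N → Finset (Packet M)) (hQ : ∀ i, Disjoint (Q i) (Q' i)) :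
    condEntropy (channelJoint PX (augment q W)) (UsAll Q) (UsAll Q') =
      condEntropy (channelJoint PX W) (UsAll Q) (UsAll Q') +
        (∑ i, (Q i).card : ℕ) * Real.logb 2 q := by
  refine condEntropy_augment hq hW hPX (UsAll Q) (UsAll Q') (UsAll Q) (UsAll Q') Q Q' hQ ?_ ?_
  · intro ω ω'
    simp only [Prod.mk.injEq, UsAll_eq_iff, dropUniform, Finset.mem_union]
    constructor
    · rintro ⟨h, h'⟩
      refine ⟨⟨fun i K hK => congrArg Prod.fst (h i K hK),
        fun i K hK => congrArg Prod.fst (h' i K hK)⟩, fun i K hK => ?_⟩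
      exact hK.elim (fun hK => congrArg Prod.snd (h i K hK))
        fun hK => congrArg Prod.snd (h' i K hK)
    · rintro ⟨⟨h, h'⟩, hv⟩
      exact ⟨fun i K hK => Prod.ext (h i K hK) (hv i K (Or.inl hK)),
        fun i K hK => Prod.ext (h' i K hK) (hv i K (Or.inr hK))⟩
  · intro ω ω'
    simp only [UsAll_eq_iff, dropUniform]
    constructor
    · intro h
      exact ⟨fun i K hK => congrArg Prod.fst (h i K hK), fun i K hK => congrArg Prod.snd (h i K hK)⟩
    · rintro ⟨h, hv⟩ i K hK
      exact Prod.ext (h i K hK) (hv i K hK)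

-- All relevant uniform components stand in the condition, so they add no entropy.
include hq hW in
theorem gamma_augment (hPX : PX ∈ stdSimplex ℝ (∀ i, 𝒳 i)) (D : Fin M → Finset (Fin N))
    (k : Fin M) (Γ : Finset (Fin N)) :
    gamma (channelJoint PX (augment q W)) D k Γ = gamma (channelJoint PX W) D k Γ := by
  have hB : ∀ ω ω' : Joint 𝒳 fun i K => 𝒰 i K × Fin q,
      (Xs (D k \ Γ) ω, UsAll (fun _ => meeting {k}) ω) =
        (Xs (D k \ Γ) ω', UsAll (fun _ => meeting {k}) ω') ↔
      (Xs (D k \ Γ) (dropUniform q ω), UsAll (fun _ => meeting {k}) (dropUniform q ω)) =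
        (Xs (D k \ Γ) (dropUniform q ω'), UsAll (fun _ => meeting {k}) (dropUniform q ω')) ∧
      ∀ i, ∀ K ∈ meeting {k}, (ω.2 i K).2 = (ω'.2 i K).2 := by
    intro ω ω'
    have hX : ∀ ω : Joint 𝒳 fun i K => 𝒰 i K × Fin q,
        Xs (D k \ Γ) (dropUniform q ω) = Xs (D k \ Γ) ω := fun _ => rfl
    simp only [Prod.mk.injEq, UsAll_eq_iff, hX]
    simp only [dropUniform]
    constructor
    · rintro ⟨hx, h⟩
      exact ⟨⟨hx, fun i K hK => congrArg Prod.fst (h i K hK)⟩,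
        fun i K hK => congrArg Prod.snd (h i K hK)⟩
    · rintro ⟨⟨hx, h⟩, hv⟩
      exact ⟨hx, fun i K hK => Prod.ext (h i K hK) (hv i K hK)⟩
  have := condEntropy_augment hq hW hPX (Xs Γ)
    (fun ω => (Xs (D k \ Γ) ω, UsAll (fun _ => meeting {k}) ω)) (Xs Γ)
    (fun ω => (Xs (D k \ Γ) ω, UsAll (fun _ => meeting {k}) ω)) (fun _ => ∅)
    (fun _ => meeting {k}) (fun _ => Finset.disjoint_empty_left _) (fun ω ω' => by
      simp only [Finset.empty_union]
      rw [Prod.mk.injEq (Xs Γ ω), hB, Prod.mk.injEq (Xs Γ (dropUniform q ω)), and_assoc]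
      rfl) hB
  rw [gamma, this, gamma]
  simp

end Augment

end DIR
end

noncomputable section
namespace DIR

/-! ### Achievability from auxiliary random variables -/

section Direct

variable {N M : ℕ} {𝒳 : Fin N → Type*} {𝒰 : Fin N → Packet M → Type*}
  [∀ i, Fintype (𝒳 i)] [∀ i K, Fintype (𝒰 i K)] {PX : (∀ i, 𝒳 i) → ℝ}

theorem two_rpow_ceil {y : ℝ} (hy : 0 ≤ y) :
    0 < ⌈(2 : ℝ) ^ y⌉₊ ∧ (2 : ℝ) ^ y ≤ ⌈(2 : ℝ) ^ y⌉₊ ∧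
      (⌈(2 : ℝ) ^ y⌉₊ : ℝ) ≤ (2 : ℝ) ^ (y + 1) := by
  have h1 : (1 : ℝ) ≤ (2 : ℝ) ^ y := Real.one_le_rpow one_le_two hy
  refine ⟨Nat.ceil_pos.2 (by linarith), Nat.le_ceil _, ?_⟩
  rw [Real.rpow_add two_pos, Real.rpow_one]
  linarith [Nat.ceil_lt_add_one (zero_le_one.trans h1)]

/-- The slack $\eta$ pays for strict inequalities and for integer alphabet sizes. The bound
$\rho\ge1$ keeps the rates nonnegative after lowering them, so that rounding up costs at most one
bit. -/
theorem achievable_of_channel (hPX : PX ∈ stdSimplex ℝ (∀ i, 𝒳 i))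
    {W : ∀ i, 𝒳 i → (∀ K, 𝒰 i K) → ℝ} (hW : ∀ i x, W i x ∈ stdSimplex ℝ (∀ K, 𝒰 i K))
    (D : Fin M → Finset (Fin N)) {ρ R₂ R₃ R : Fin N → Packet M → ℝ}
    (hρ : ∀ i K, 1 ≤ ρ i K) (hR₂ : ∀ i K, 0 ≤ R₂ i K)
    (hR₃ : ∀ i K, K.1 ⊆ sinksOf D i → 0 ≤ R₃ i K)
    (hcov : ∀ i Q, IsUpClosed Q →
      ∑ K ∈ Q, ρ i K ≤ condEntropy (channelJoint PX W) (Us i Q) fun ω => ω.1 i)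
    (hpack : ∀ (k : Fin M) (Q : Fin N → Finset (Packet M)), (∀ i, Q i ⊆ meeting {k}) →
      (∀ i, IsUpClosed (Q i)) → (∃ i, Q i ≠ meeting {k}) →
      condEntropy (channelJoint PX W) (UsAll fun i => meeting {k} \ Q i) (UsAll Q) ≤
        ∑ i, ∑ K ∈ meeting {k} \ Q i, (ρ i K + R₂ i K))
    (hbin : ∀ (k : Fin M) (Γ : Finset (Fin N)), Γ ⊆ D k → Γ.Nonempty →
      gamma (channelJoint PX W) D k Γ ≤
        ∑ i ∈ Γ, ∑ K ∈ Finset.univ.filter (fun K : Packet M => k ∈ K.1 ∧ K.1 ⊆ sinksOf D i),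
          R₃ i K)
    (hrate : ∀ i K, (if K.1 ⊆ sinksOf D i then R₂ i K + R₃ i K else R₂ i K) ≤ R i K) :
    Achievable PX D R := by
  classical
  intro η hη ε hε _
  set s : ℝ := min (η / 8) (1 / 2) with hs
  have hs0 : 0 < s := by rw [hs]; positivity
  have hsη : s ≤ η / 8 := min_le_left _ _
  have hs2 : s ≤ 1 / 2 := min_le_right _ _
  -- Rate zero outside the subsets of $\Pi_i$ means a hash with a single value.
  set R₃' : Fin N → Packet M → ℝ := fun i K => if K.1 ⊆ sinksOf D i then R₃ i K + s else 0
    with hR₃'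
  have hR₃'0 : ∀ i K, 0 ≤ R₃' i K := fun i K => by
    by_cases h : K.1 ⊆ sinksOf D i
    · simp only [hR₃', h, if_true]; linarith [hR₃ i K h]
    · simp [hR₃', h]
  -- Packing gains $-s+2s=s$ per packet. The window between $\rho-s$ and $\rho-s/2$ leaves room for
  -- rounding the hash size.
  obtain ⟨n₀, h⟩ := exists_code hPX hW D (ρ := fun i K => ρ i K - s)
    (ρ' := fun i K => ρ i K - s / 2) (R₂ := fun i K => R₂ i K + 2 * s) (R₃ := R₃')
    (fun i Q hQ hne => (Finset.sum_lt_sum_of_nonempty hne fun K _ => by linarith).trans_le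
      (hcov i Q hQ))
    (fun k Q hsub hup hne => by
      refine (hpack k Q hsub hup hne).trans_lt ?_
      obtain ⟨i, hi⟩ := hne
      refine Finset.sum_lt_sum (fun j _ => Finset.sum_le_sum fun K _ => by linarith)
        ⟨i, Finset.mem_univ i, Finset.sum_lt_sum_of_nonempty ?_ fun K _ => by linarith⟩
      rw [Finset.sdiff_nonempty]
      exact fun hle => hi (Finset.Subset.antisymm (hsub i) hle))
    (fun k Γ hΓ hne => by
      refine (hbin k Γ hΓ hne).trans_lt (Finset.sum_lt_sum_of_nonempty hne fun i hi => ?_)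
      have e : ∑ K ∈ meeting {k}, R₃' i K =
          ∑ K ∈ Finset.univ.filter (fun K : Packet M => k ∈ K.1 ∧ K.1 ⊆ sinksOf D i),
            (R₃ i K + s) := by
        have hm : (Finset.univ.filter fun K : Packet M => k ∈ K.1 ∧ K.1 ⊆ sinksOf D i) =
            (meeting {k}).filter fun K => K.1 ⊆ sinksOf D i := by
          ext K
          simp [mem_meeting_singleton]
        rw [hm, Finset.sum_filter]
      rw [e]
      -- The packet for the sink `k` alone is always available, as `k` reconstructs every source in
      -- `Γ`; hence the inequality becomes strict.
      refine Finset.sum_lt_sum_of_nonempty ⟨⟨{k}, Finset.singleton_nonempty k⟩, ?_⟩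
        fun K _ => by linarith
      exact Finset.mem_filter.2 ⟨Finset.mem_univ _, Finset.mem_singleton_self k,
        Finset.singleton_subset_iff.2 (Finset.mem_filter.2 ⟨Finset.mem_univ _, hΓ hi⟩)⟩)
    (half_pos hε)
  obtain ⟨n₁, hn₁⟩ := exists_nat_ge (2 / s)
  refine ⟨max n₀ (n₁ + 1), fun n hn => ?_⟩
  have hn1 : n₁ + 1 ≤ n := (le_max_right _ _).trans hn
  have hn0 : (0 : ℝ) < n := by exact_mod_cast (Nat.succ_pos n₁).trans_le hn1
  have hns : 2 ≤ n * s := by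
    rw [div_le_iff₀ hs0] at hn₁
    have : (n₁ : ℝ) ≤ n := by exact_mod_cast (Nat.le_succ n₁).trans hn1
    nlinarith
  have c1 : ∀ i K, 0 ≤ n * (ρ i K - s) := fun i K =>
    mul_nonneg hn0.le (by linarith [hρ i K])
  have c2 : ∀ i K, 0 ≤ n * (R₂ i K + 2 * s) := fun i K =>
    mul_nonneg hn0.le (by linarith [hR₂ i K])
  have c3 : ∀ i K, 0 ≤ n * R₃' i K := fun i K => mul_nonneg hn0.le (hR₃'0 i K)
  obtain ⟨c, hc⟩ := h n ((le_max_left _ _).trans hn)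
    (fun i K => ⌈(2 : ℝ) ^ (n * (ρ i K - s))⌉₊) (fun i K => ⌈(2 : ℝ) ^ (n * (R₂ i K + 2 * s))⌉₊)
    (fun i K => ⌈(2 : ℝ) ^ (n * R₃' i K)⌉₊) (fun i K => (two_rpow_ceil (c1 i K)).1)
    (fun i K => (two_rpow_ceil (c2 i K)).1) (fun i K => (two_rpow_ceil (c3 i K)).1)
    (fun i K => (two_rpow_ceil (c1 i K)).2.1)
    (fun i K => (two_rpow_ceil (c1 i K)).2.2.trans
      (Real.rpow_le_rpow_of_exponent_le one_le_two (by nlinarith)))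
    (fun i K => (two_rpow_ceil (c2 i K)).2.1) (fun i K => (two_rpow_ceil (c3 i K)).2.1)
  refine ⟨_, c, fun i K => Nat.mul_pos (two_rpow_ceil (c2 i K)).1 (two_rpow_ceil (c3 i K)).1,
    fun i K => ?_, hc.trans_lt (half_lt_self hε)⟩
  have p2 : (0 : ℝ) < ⌈(2 : ℝ) ^ (n * (R₂ i K + 2 * s))⌉₊ :=
    Nat.cast_pos.2 (two_rpow_ceil (c2 i K)).1
  have p3 : (0 : ℝ) < ⌈(2 : ℝ) ^ (n * R₃' i K)⌉₊ := Nat.cast_pos.2 (two_rpow_ceil (c3 i K)).1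
  have l2 := (Real.logb_le_iff_le_rpow one_lt_two p2).2 (two_rpow_ceil (c2 i K)).2.2
  have l3 := (Real.logb_le_iff_le_rpow one_lt_two p3).2 (two_rpow_ceil (c3 i K)).2.2
  rw [Nat.cast_mul, Real.logb_mul p2.ne' p3.ne', one_div, inv_mul_le_iff₀ hn0]
  have hR : R₂ i K + R₃' i K ≤ R i K + s := by
    have := hrate i K
    by_cases hK : K.1 ⊆ sinksOf D i
    · simp only [hR₃', hK, if_true] at this ⊢; linarith
    · simp only [hR₃', hK, if_false] at this ⊢; linarith
  -- The `2` is one bit of rounding for each of the two transmitted hashes.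
  calc _ ≤ n * (R₂ i K + R₃' i K + 2 * s) + 2 := by linarith
    _ ≤ n * (R i K + s + 2 * s) + n * s := by gcongr
    _ = n * (R i K + 4 * s) := by ring
    _ ≤ n * (R i K + η) := by gcongr; linarith

/-- The layer entropies serve only as numbers in the definition of `ρ`: inserted there, they turn
`alpha` and `beta` into plain conditional entropies. They need not be computed for the augmented
variables. -/
theorem achievable_of_rateConditions (hPX : PX ∈ stdSimplex ℝ (∀ i, 𝒳 i))
    (D : Fin M → Finset (Fin N)) {P : Joint 𝒳 𝒰 → ℝ} (hP : IsAuxiliary PX P)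
    {R₁ R₂ R₃ R : Fin N → Packet M → ℝ} (h : RateConditions P D R₁ R₂ R₃ R) :
    Achievable PX D R := by
  have hW := fun i x => auxChannel_mem_stdSimplex hP.pmf i x
  -- Enough uniform bits to make every `ρ` at least `1`; with $q=2^t$ the entropy gain per component
  -- is exactly `t`.
  obtain ⟨t, ht⟩ : ∃ t : ℕ, ∀ s : Fin N × Packet M, 1 + R₁ s.1 s.2 - layerEntropy P s.1 s.2 ≤ t := by
    obtain ⟨B, hB⟩ := (Set.finite_range fun s : Fin N × Packet M =>
      1 + R₁ s.1 s.2 - layerEntropy P s.1 s.2).bddAbove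
    obtain ⟨t, ht⟩ := exists_nat_ge B
    exact ⟨t, fun s => (hB ⟨s, rfl⟩).trans ht⟩
  have hq : 0 < 2 ^ t := by positivity
  have hlog : Real.logb 2 ((2 ^ t : ℕ) : ℝ) = t := by
    rw [Nat.cast_pow, Nat.cast_ofNat, Real.logb_pow, Real.logb_self_eq_one one_lt_two, mul_one]
  refine achievable_of_channel hPX (augment_mem_stdSimplex hq hW) D
    (ρ := fun i K => layerEntropy P i K + t - R₁ i K) (fun i K => by linarith [ht (i, K)])
    h.nonneg₂ h.nonneg₃ (fun i Q hQ => ?_) (fun k Q hsub hup hne => ?_) (fun k Γ hΓ hne => ?_)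
    h.rate
  · rw [condEntropy_augment_source hq hW hPX, hlog]
    have e : condEntropy (channelJoint PX (auxChannel P)) (Us i Q) (fun ω => ω.1 i) =
        condEntropy P (Us i Q) (fun ω => ω.1 i) :=
      condEntropy_congr_of_law (hP.law_local i) (fun y (K : {K // K ∈ Q}) => y.2 K.1) fun y => y.1
    have := h.covering i Q hQ
    rw [alpha] at this
    rw [e, Finset.sum_sub_distrib, Finset.sum_add_distrib, Finset.sum_const, nsmul_eq_mul]
    linarith
  · rw [condEntropy_augment_sink hq hW hPX _ _ fun i => Finset.sdiff_disjoint, hlog]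
    have e : condEntropy (channelJoint PX (auxChannel P)) (UsAll fun i => meeting {k} \ Q i)
        (UsAll Q) = condEntropy P (UsAll fun i => meeting {k} \ Q i) (UsAll Q) :=
      condEntropy_congr_of_law (hP.law_sink k)
        (fun y i (K : {K // K ∈ meeting {k} \ Q i}) => y.2 i ⟨K.1, (Finset.mem_sdiff.1 K.2).1⟩)
        fun y i (K : {K // K ∈ Q i}) => y.2 i ⟨K.1, hsub i K.2⟩
    have := h.packing k Q hsub hup hne
    rw [beta] at this
    rw [e]
    simp_rw [Finset.sum_add_distrib, Finset.sum_sub_distrib, Finset.sum_add_distrib,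
      Finset.sum_const, nsmul_eq_mul]
    rw [← Finset.sum_mul, Nat.cast_sum]
    linarith
  · rw [gamma_augment hq hW hPX]
    have e : gamma (channelJoint PX (auxChannel P)) D k Γ = gamma P D k Γ :=
      condEntropy_congr_of_law (hP.law_sink k) (fun y (i : {i // i ∈ Γ}) => y.1 i.1)
        fun y => ((fun i : {i // i ∈ D k \ Γ} => y.1 i.1), y.2)
    rw [e]
    exact h.binning k Γ hΓ hne

end Direct

/-! ### The set of achievable tuples is closed and convex -/

section TimeSharing

variable {N M : ℕ} {𝒳 : Fin N → Type*} [∀ i, Fintype (𝒳 i)] {PX : (∀ i, 𝒳 i) → ℝ}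
  {D : Fin M → Finset (Fin N)}

/-- Codes for a tuple within $\eta/2$ serve the limit with slack $\eta$. -/
theorem isClosed_achievable : IsClosed {R | Achievable PX D R} := by
  refine isClosed_of_closure_subset fun R hR η hη ε hε hε1 => ?_
  obtain ⟨R', hR', hdist⟩ := Metric.mem_closure_iff.1 hR (η / 2) (half_pos hη)
  obtain ⟨n₀, h⟩ := hR' (η / 2) (half_pos hη) ε hε hε1
  refine ⟨n₀, fun n hn => ?_⟩
  obtain ⟨L, c, hL, hrate, herr⟩ := h n hn
  refine ⟨L, c, hL, fun i K => (hrate i K).trans ?_, herr⟩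
  have h1 : dist (R i K) (R' i K) ≤ dist R R' :=
    (dist_le_pi_dist (R i) (R' i) K).trans (dist_le_pi_dist R R' i)
  rw [Real.dist_eq] at h1
  linarith [neg_abs_le (R i K - R' i K)]

theorem Code.errorProb_eq {n : ℕ} {L : Fin N → Packet M → ℕ} (c : Code 𝒳 D n L) :
    c.errorProb PX = 1 / (M : ℝ) * ∑ j, ∑ x, iid PX n x *
      ind (c.estimate x j ≠ fun (i : {i : Fin N // i ∈ D j}) t => x t i.1) := by
  rw [Code.errorProb]
  congr 1
  refine Finset.sum_congr rfl fun j _ => Finset.sum_congr rfl fun x _ => ?_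
  by_cases h : c.estimate x j ≠ fun (i : {i : Fin N // i ∈ D j}) t => x t i.1
  · rw [ind_of h, Set.indicator_of_mem h, mul_one]; rfl
  · rw [ind_of_not h, Set.indicator_of_notMem h, mul_zero]

/-- Use of one code for the first `n₁` and of another code for the last `n₂` letters. -/
def Code.concat {n₁ n₂ : ℕ} {L₁ L₂ : Fin N → Packet M → ℕ} (c₁ : Code 𝒳 D n₁ L₁)
    (c₂ : Code 𝒳 D n₂ L₂) : Code 𝒳 D (n₁ + n₂) fun i K => L₁ i K * L₂ i K where
  enc i x K := finProdFinEquiv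
    (c₁.enc i (fun t => x (Fin.castAdd n₂ t)) K, c₂.enc i (fun t => x (Fin.natAdd n₁ t)) K)
  dec j msg i := Fin.append (c₁.dec j (fun i K => (finProdFinEquiv.symm (msg i K)).1) i)
    (c₂.dec j (fun i K => (finProdFinEquiv.symm (msg i K)).2) i)

/-- Union bound: the concatenation errs only if one of its parts does, and the two blocks are
independent. -/
theorem Code.errorProb_concat_le (hPX : PX ∈ stdSimplex ℝ (∀ i, 𝒳 i)) {n₁ n₂ : ℕ}
    {L₁ L₂ : Fin N → Packet M → ℕ} (c₁ : Code 𝒳 D n₁ L₁) (c₂ : Code 𝒳 D n₂ L₂) :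
    (c₁.concat c₂).errorProb PX ≤ c₁.errorProb PX + c₂.errorProb PX := by
  rw [Code.errorProb_eq, Code.errorProb_eq, Code.errorProb_eq, ← mul_add, ← Finset.sum_add_distrib]
  refine mul_le_mul_of_nonneg_left (Finset.sum_le_sum fun j _ => ?_) (by positivity)
  let e₁ : (Fin n₁ → ∀ i, 𝒳 i) → ℝ := fun x =>
    ind (c₁.estimate x j ≠ fun (i : {i : Fin N // i ∈ D j}) t => x t i.1)
  let e₂ : (Fin n₂ → ∀ i, 𝒳 i) → ℝ := fun x =>
    ind (c₂.estimate x j ≠ fun (i : {i : Fin N // i ∈ D j}) t => x t i.1)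
  have hiid : ∀ (x : Fin n₁ → ∀ i, 𝒳 i) (y : Fin n₂ → ∀ i, 𝒳 i),
      iid PX (n₁ + n₂) (Fin.append x y) = iid PX n₁ x * iid PX n₂ y := fun x y => by
    simp [iid, Fin.prod_univ_add]
  have herr : ∀ (x : Fin n₁ → ∀ i, 𝒳 i) (y : Fin n₂ → ∀ i, 𝒳 i),
      ind ((c₁.concat c₂).estimate (Fin.append x y) j ≠
        fun (i : {i : Fin N // i ∈ D j}) t => Fin.append x y t i.1) ≤ e₁ x + e₂ y := by
    intro x y
    refine (ind_mono fun h => ?_).trans (ind_or_le _ _)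
    by_contra hno
    simp only [not_or, not_not] at hno
    apply h
    have hest : (c₁.concat c₂).estimate (Fin.append x y) j = fun i =>
        Fin.append (c₁.estimate x j i) (c₂.estimate y j i) := by
      simp only [Code.estimate, Code.concat, Equiv.symm_apply_apply, Fin.append_left,
        Fin.append_right]
    rw [hest, hno.1, hno.2]
    funext i t
    refine Fin.addCases (fun t => ?_) (fun t => ?_) t <;> simp
  rw [← Fintype.sum_equiv (Fin.appendEquiv n₁ n₂) (fun z : (Fin n₁ → ∀ i, 𝒳 i) × (Fin n₂ → ∀ i, 𝒳 i) =>
    iid PX (n₁ + n₂) (Fin.append z.1 z.2) * ind ((c₁.concat c₂).estimate (Fin.append z.1 z.2) j ≠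
      fun (i : {i : Fin N // i ∈ D j}) t => Fin.append z.1 z.2 t i.1)) _ (fun _ => rfl),
    Fintype.sum_prod_type]
  calc _ ≤ ∑ x, ∑ y, iid PX n₁ x * iid PX n₂ y * (e₁ x + e₂ y) := by
        refine Finset.sum_le_sum fun x _ => Finset.sum_le_sum fun y _ => ?_
        rw [hiid]
        exact mul_le_mul_of_nonneg_left (herr x y)
          (mul_nonneg (iid_nonneg hPX.1 _ _) (iid_nonneg hPX.1 _ _))
    _ = (∑ x, iid PX n₁ x * e₁ x) * (∑ y, iid PX n₂ y) +
        (∑ x, iid PX n₁ x) * ∑ y, iid PX n₂ y * e₂ y := by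
        rw [Finset.sum_mul_sum, Finset.sum_mul_sum, ← Finset.sum_add_distrib]
        refine Finset.sum_congr rfl fun x _ => ?_
        rw [← Finset.sum_add_distrib]
        exact Finset.sum_congr rfl fun y _ => by ring
    _ = _ := by rw [sum_iid hPX, sum_iid hPX, mul_one, one_mul]

/-- Time sharing: a code for `R` on about $an$ letters and a code for `R'` on the rest. -/
theorem convex_achievable (hPX : PX ∈ stdSimplex ℝ (∀ i, 𝒳 i)) :
    Convex ℝ {R | Achievable PX D R} := by
  refine convex_iff_forall_pos.2 fun R hR R' hR' a b ha hb hab => ?_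
  intro η hη ε hε hε1
  obtain ⟨m₁, h₁⟩ := hR (η / 4) (by positivity) (ε / 2) (half_pos hε) (by linarith)
  obtain ⟨m₂, h₂⟩ := hR' (η / 4) (by positivity) (ε / 2) (half_pos hε) (by linarith)
  obtain ⟨B, hB⟩ := (Set.finite_range fun s : Fin N × Packet M =>
    |R s.1 s.2| + |R' s.1 s.2|).bddAbove
  -- One unit is lost to the floor of $an$ and one keeps the block nonempty; the second block, of
  -- length at least $bn$, loses nothing to the floor.
  obtain ⟨n₁, hn₁⟩ := exists_nat_ge ((m₁ + 2) / a)
  obtain ⟨n₂, hn₂⟩ := exists_nat_ge ((m₂ + 1) / b)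
  -- Rounding the block lengths costs at most $B$ bits in total, which this makes at most $n\eta/4$.
  obtain ⟨n₃, hn₃⟩ := exists_nat_ge (4 * B / η)
  refine ⟨max n₁ (max n₂ n₃), fun n hn => ?_⟩
  have l₁ : (n₁ : ℝ) ≤ n := by exact_mod_cast (le_max_left _ _).trans hn
  have l₂ : (n₂ : ℝ) ≤ n := by
    exact_mod_cast ((le_max_left _ _).trans (le_max_right _ _)).trans hn
  have l₃ : (n₃ : ℝ) ≤ n := by
    exact_mod_cast ((le_max_right _ _).trans (le_max_right _ _)).trans hn
  have k₁ : m₁ + 2 ≤ a * n := by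
    have := hn₁.trans l₁
    rwa [div_le_iff₀ ha, mul_comm] at this
  have k₂ : m₂ + 1 ≤ b * n := by
    have := hn₂.trans l₂
    rwa [div_le_iff₀ hb, mul_comm] at this
  have k₃ : 4 * B ≤ n * η := by
    have := hn₃.trans l₃
    rwa [div_le_iff₀ hη] at this
  have hn0 : (0 : ℝ) < n := by
    by_contra hle
    have : a * n ≤ 0 := mul_nonpos_of_nonneg_of_nonpos ha.le (not_lt.1 hle)
    have : (0 : ℝ) ≤ m₁ := Nat.cast_nonneg _
    linarith
  obtain ⟨p, r, hpr, hp1, hp2⟩ : ∃ p r : ℕ, n = p + r ∧ a * n - 1 ≤ p ∧ (p : ℝ) ≤ a * n := by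
    have hfl : (⌊a * (n : ℝ)⌋₊ : ℝ) ≤ a * n := Nat.floor_le (by positivity)
    have hle : ⌊a * (n : ℝ)⌋₊ ≤ n := by
      have : (⌊a * (n : ℝ)⌋₊ : ℝ) ≤ n := hfl.trans (by nlinarith)
      exact_mod_cast this
    exact ⟨⌊a * (n : ℝ)⌋₊, n - ⌊a * (n : ℝ)⌋₊, by omega,
      by linarith [Nat.lt_floor_add_one (a * (n : ℝ))], hfl⟩
  have hnpr : (n : ℝ) = p + r := by exact_mod_cast hpr
  have hr1 : b * n ≤ r := by
    have : (r : ℝ) = n - p := by linarith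
    have hb' : b = 1 - a := by linarith
    rw [this, hb']
    linarith
  have hm₁ : m₁ ≤ p := by
    have : (m₁ : ℝ) ≤ p := by linarith
    exact_mod_cast this
  have hm₂ : m₂ ≤ r := by
    have : (m₂ : ℝ) ≤ r := by linarith
    exact_mod_cast this
  have hp0 : (0 : ℝ) < p := by linarith [(Nat.cast_nonneg m₁ : (0 : ℝ) ≤ m₁)]
  have hr0 : (0 : ℝ) < r := by linarith [(Nat.cast_nonneg m₂ : (0 : ℝ) ≤ m₂)]
  obtain ⟨L₁, c₁, hL₁, hr₁, he₁⟩ := h₁ p hm₁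
  obtain ⟨L₂, c₂, hL₂, hr₂, he₂⟩ := h₂ r hm₂
  subst hpr
  refine ⟨_, c₁.concat c₂, fun i K => Nat.mul_pos (hL₁ i K) (hL₂ i K), fun i K => ?_, ?_⟩
  swap
  · exact (Code.errorProb_concat_le hPX c₁ c₂).trans_lt (by linarith)
  have q₁ := hr₁ i K
  have q₂ := hr₂ i K
  rw [one_div, inv_mul_le_iff₀ hp0] at q₁
  rw [one_div, inv_mul_le_iff₀ hr0] at q₂
  rw [Nat.cast_mul, Real.logb_mul (Nat.cast_ne_zero.2 (hL₁ i K).ne')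
    (Nat.cast_ne_zero.2 (hL₂ i K).ne'), one_div, inv_mul_le_iff₀ hn0]
  simp only [Pi.add_apply, Pi.smul_apply, smul_eq_mul]
  have hBK : |R i K| + |R' i K| ≤ B := hB ⟨(i, K), rfl⟩
  generalize ((p + r : ℕ) : ℝ) = ν at *
  -- The length `p` lies between $a\nu-1$ and $a\nu$.
  have t₁ : (p - a * ν) * R i K ≤ |R i K| := by
    rw [← sub_nonneg]
    nlinarith [neg_abs_le (R i K), le_abs_self (R i K), abs_nonneg (R i K)]
  have t₂ : (r - b * ν) * R' i K ≤ |R' i K| := by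
    have hb' : (r : ℝ) - b * ν = a * ν - p := by
      have : b = 1 - a := by linarith
      rw [this]; linarith
    rw [hb', ← sub_nonneg]
    nlinarith [neg_abs_le (R' i K), le_abs_self (R' i K), abs_nonneg (R' i K)]
  have e : (p : ℝ) * (η / 4) + r * (η / 4) = ν * (η / 4) := by rw [hnpr]; ring
  have hνη : 0 < ν * η := mul_pos hn0 hη
  nlinarith

end TimeSharing

end DIR

end

theorem theorem1 {N M : ℕ} {𝒳 : Fin N → Type*} [∀ i, Fintype (𝒳 i)]
    (PX : (∀ i, 𝒳 i) → ℝ) (hPX : PX ∈ stdSimplex ℝ (∀ i, 𝒳 i))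
    (D : Fin M → Finset (Fin N)) :
    (∀ (𝒰 : Fin N → DIR.Packet M → Type*) [∀ i K, Fintype (𝒰 i K)]
        (P : DIR.Joint 𝒳 𝒰 → ℝ), DIR.IsAuxiliary PX P →
        ∀ R₁ R₂ R₃ R : Fin N → DIR.Packet M → ℝ,
          DIR.RateConditions P D R₁ R₂ R₃ R → DIR.Achievable PX D R) ∧
    DIR.region PX D ⊆ {R | DIR.Achievable PX D R} := by
  refine ⟨fun 𝒰 _ P hP R₁ R₂ R₃ R h => DIR.achievable_of_rateConditions hPX D hP h, ?_⟩
  refine DIR.isClosed_achievable.closure_subset_iff.2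
    (convexHull_min ?_ (DIR.convex_achievable hPX))
  rintro R ⟨𝒱, _, P, R₁, R₂, R₃, hP, h⟩
  exact DIR.achievable_of_rateConditions hPX D hP h
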